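/- Let $N\ge 2$ and $\mathcal M=\mathbb R^N\times\mathbb R_{>0}^N$. For $(b,a)\in\mathcal M$ extend $b_k,a_k$ $N$-periodically in $k$ and consider the difference equation $$a_{k-1}y(k-1)+b_ky(k)+a_ky(k+1)=\lambda y(k).\qquad(\ast)$$ Let $y_1(\cdot,\lambda),y_2(\cdot,\lambda)$ be its solutions with $y_1(0)=1,\ y_1(1)=0$ and $y_2(0)=0,\ y_2(1)=1$, and let $\Delta(\lambda)=y_1(N,\lambda)+y_2(N+1,\lambda)$. Let $\lambda_1<\lambda_2\le\lambda_3<\dots\le\lambda_{2N-1}<\lambda_{2N}$ be the eigenvalues, listed with multiplicities, of the $2N\times 2N$ periodic Jacobi matrix $Q(b,a)$, which has diagonal $(b_1,\dots,b_N,b_1,\dots,b_N)$, off-diagonal entries $Q_{j,j+1}=Q_{j+1,j}=a_j$ $(1\le j<2N)$, corner entries $Q_{1,2N}=Q_{2N,1}=a_N$, and zeros elsewhere. They are the zeros of $\Delta^2-4$. Let $\mu_1<\dots<\mu_{N-1}$ be the zeros of $y_1(N+1,\cdot)$; one has $\lambda_{2k}\le\mu_k\le\lambda_{2k+1}$. For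 $1\le n\le N-1$ put $\gamma_n=\lambda_{2n+1}-\lambda_{2n}$ and $D_n=\{(b,a)\in\mathcal M:\gamma_n=0\}$. Let $\sqrt[c]{\Delta(\lambda)^2-4}$ be the analytic square root of $\Delta^2-4$ on $\mathbb C\setminus\big((-\infty,\lambda_1]\cup\bigcup_{k=1}^{N-1}[\lambda_{2k},\lambda_{2k+1}]\cup[\lambda_{2N},\infty)\big)$ with $-i\sqrt[c]{\Delta^2-4}>0$ on $(\lambda_{2N-1},\lambda_{2N})$. Let $\psi_n$ be the unique polynomial of degree at most $N-2$ with $$\frac1{2\pi}\int_{\Gamma_k}\frac{\psi_n(\lambda)}{\sqrt[c]{\Delta(\lambda)^2-4}}\,d\lambda=\delta_{kn}\qquad(1\le k\le N-1),$$ where $\Gamma_k$ is a counterclockwise circle whose closed disc contains $[\lambda_{2k},\lambda_{2k+1}]$ in its interior and no other $\lambda_j$. On $\mathcal M\setminus D_n$ let $$\eta_n=\int_{\lambda_{2n}}^{\mu_n^*}\frac{\psi_n(\lambda)}{\sqrt{\Delta(\lambda)^2-4}}\,d\lambda\pmod{2\pi},$$ the integral on the curve $z^2=\Delta(\lambda)^2-4$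 (with $z$ in the place of $\sqrt{\Delta(\lambda)^2-4}$) from $(\lambda_{2n},0)$ to $\mu_n^*=(\mu_n,\ y_1(N,\mu_n)-y_2(N+1,\mu_n))$ along a path lying over the closed gap $[\lambda_{2n},\lambda_{2n+1}]$. Let $z_n^+=\gamma_ne^{i\eta_n}$ on $\mathcal M\setminus D_n$, extended continuously by $z_n^+=0$ on $D_n$. For sequences $v,w$ let $v\cdot_{\mathbf s}w=\big((v(j)w(j))_{1\le j\le N},\,(v(j)w(j+1)+w(j)v(j+1))_{1\le j\le N}\big)\in\mathbb C^{2N}$ and $v^{\mathbf 2}=v\cdot_{\mathbf s}v$. **Proposition.** Let $1\le n\le N-1$ and $(b,a)\in D_n$. Let $g_n$ be the real solution of $(\ast)$ at $\lambda=\mu_n$ with $g_n(1)=0$, $g_n(0)>0$, $\sum_{j=1}^Ng_n(j)^2=1$, and let $h_n$ be the real solution of $(\ast)$ at $\lambda=\mu_n$ with $\sum_{j=1}^Nh_n(j)g_n(j)=0$, $\sum_{j=1}^Nh_n(j)^2=1$ and $h_n(1)>0$. Then $z_n^+$ is differentiable at $(b,a)$ and $$\nabla_{b,a}z_n^+=(\nabla_bz_n^+,\nabla_az_n^+)=(h_n-i\,g_n)^{\mathbf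 2}.$$ -/

import Mathlib

namespace Toda

noncomputable section

open Polynomial

/-- Points `(b, a) = ((b_1, …, b_N), (a_1, …, a_N))` of `ℝ^N × ℝ^N`. -/
abbrev Phase (N : ℕ) : Type := (Fin N → ℝ) × (Fin N → ℝ)

/-- The phase space `ℳ = ℝ^N × ℝ_{>0}^N`. -/
def phaseSpace (N : ℕ) : Set (Phase N) := {p | ∀ j, 0 < p.2 j}

/-- The `N`-periodic extension of a vector `(v_1, …, v_N)`: `per v k = v_k` for `1 ≤ k ≤ N`, and
`per v 0 = v_N`.  (The entry `v_k` is stored at position `k - 1` of `Fin N`.) -/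
def per {N : ℕ} [NeZero N] (v : Fin N → ℝ) (k : ℕ) : ℝ := v (Fin.ofNat N (k + (N - 1)))

/-- The sequence `b_k`. -/
def bSeq {N : ℕ} [NeZero N] (p : Phase N) (k : ℕ) : ℝ := per p.1 k

/-- The sequence `a_k`. -/
def aSeq {N : ℕ} [NeZero N] (p : Phase N) (k : ℕ) : ℝ := per p.2 k

/-- `y` solves the difference equation
`a_{k-1} y(k-1) + b_k y(k) + a_k y(k+1) = μ y(k)`, `k ≥ 1`. -/
def Solves {N : ℕ} [NeZero N] (p : Phase N) (μ : ℝ) (y : ℕ → ℝ) : Prop :=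
  ∀ k : ℕ, 1 ≤ k →
    aSeq p (k - 1) * y (k - 1) + bSeq p k * y k + aSeq p k * y (k + 1) = μ * y k

/-- The solution of the difference equation with initial values `y(0) = u`, `y(1) = v`; its
`k`-th entry is a polynomial in the spectral parameter. -/
def solPoly {N : ℕ} [NeZero N] (p : Phase N) (u v : ℝ) : ℕ → ℝ[X]
  | 0 => C u
  | 1 => C v
  | k + 2 =>
      C (aSeq p (k + 1))⁻¹ *
        ((X - C (bSeq p (k + 1))) * solPoly p u v (k + 1) - C (aSeq p k) * solPoly p u v k)

/-- The fundamental solution `y_1(k, ·)`, with `y_1(0) = 1`, `y_1(1) = 0`. -/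
def y₁ {N : ℕ} [NeZero N] (p : Phase N) (k : ℕ) : ℝ[X] := solPoly p 1 0 k

/-- The fundamental solution `y_2(k, ·)`, with `y_2(0) = 0`, `y_2(1) = 1`. -/
def y₂ {N : ℕ} [NeZero N] (p : Phase N) (k : ℕ) : ℝ[X] := solPoly p 0 1 k

/-- The discriminant `Δ(λ) = y_1(N, λ) + y_2(N + 1, λ)`. -/
def discr {N : ℕ} [NeZero N] (p : Phase N) : ℝ[X] := y₁ p N + y₂ p (N + 1)

/-- The periodic Jacobi matrix `Q(b, a)` of size `2N`. -/
def Q {N : ℕ} [NeZero N] (p : Phase N) : Matrix (Fin (2 * N)) (Fin (2 * N)) ℝ :=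
  fun i j =>
    if i = j then bSeq p (i.val + 1)
    else if (i.val + 1) % (2 * N) = j.val then aSeq p (i.val + 1)
    else if (j.val + 1) % (2 * N) = i.val then aSeq p (j.val + 1)
    else 0

/-- The `j`-th (`j = 1, 2, …`) real root of a polynomial, the roots being listed in increasing
order with multiplicities. -/
def orderedRoot (f : ℝ[X]) (j : ℕ) : ℝ := (f.roots.sort (· ≤ ·)).getD (j - 1) 0

/-- The eigenvalues `λ_1 ≤ … ≤ λ_{2N}` of `Q`, with multiplicities. -/
def lam {N : ℕ} [NeZero N] (p : Phase N) (j : ℕ) : ℝ := orderedRoot (Q p).charpoly j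

/-- The Dirichlet eigenvalues `μ_1 < … < μ_{N-1}`: the zeros of `y_1(N + 1, ·)`. -/
def dir {N : ℕ} [NeZero N] (p : Phase N) (n : ℕ) : ℝ := orderedRoot (y₁ p (N + 1)) n

/-- The gap length `γ_n = λ_{2n+1} - λ_{2n}`. -/
def gap {N : ℕ} [NeZero N] (p : Phase N) (n : ℕ) : ℝ := lam p (2 * n + 1) - lam p (2 * n)

/-- The set `ℳ ∩ D_n` of points of the phase space whose `n`-th gap is collapsed. -/
def collapsedSet (N : ℕ) [NeZero N] (n : ℕ) : Set (Phase N) :=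
  {p | p ∈ phaseSpace N ∧ gap p n = 0}

/-- The canonical root of `Δ(λ)^2 - 4 = (∏ a_j)^{-2} ∏_{j=1}^{2N} (λ - λ_j)`: as the square roots
on the right are principal ones, it is analytic off the closed gaps `[λ_{2k}, λ_{2k+1}]` and the
rays `(-∞, λ_1]`, `[λ_{2N}, ∞)`, and it lies in `i ℝ_{>0}` on `(λ_{2N-1}, λ_{2N})`. -/
def canonicalRoot {N : ℕ} [NeZero N] (p : Phase N) (z : ℂ) : ℂ :=
  Complex.I * (((∏ j, p.2 j)⁻¹ : ℝ) : ℂ)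
    * (z - (lam p 1 : ℂ)) ^ (1 / 2 : ℂ) * ((lam p (2 * N) : ℂ) - z) ^ (1 / 2 : ℂ)
    * ∏ k ∈ Finset.Icc 1 (N - 1),
        ((z - (lam p (2 * k) : ℂ)) ^ (1 / 2 : ℂ) * (z - (lam p (2 * k + 1) : ℂ)) ^ (1 / 2 : ℂ))

/-- The midpoint `τ_k` of the `k`-th gap. -/
def mid {N : ℕ} [NeZero N] (p : Phase N) (k : ℕ) : ℝ := (lam p (2 * k) + lam p (2 * k + 1)) / 2

/-- The radius of a circle about `τ_k` that encloses the closed `k`-th gap.  It exceeds `γ_k / 2`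
by a third of the length of the shorter one of the two adjacent bands `(λ_{2k-1}, λ_{2k})` and
`(λ_{2k+1}, λ_{2k+2})`, so that the closed discs for different `k` are pairwise disjoint and do
not contain `λ_1`, `λ_{2N}`. -/
def contourRadius {N : ℕ} [NeZero N] (p : Phase N) (k : ℕ) : ℝ :=
  gap p k / 2
    + min (lam p (2 * k) - lam p (2 * k - 1)) (lam p (2 * k + 2) - lam p (2 * k + 1)) / 3

/-- `ψ` has degree at most `N - 2` and, for `1 ≤ k ≤ N - 1`,
`(1 / 2π) ∫_{c_k} ψ(λ) / √(Δ(λ)^2 - 4) dλ = δ_{kn}`, where `c_k` is the lift of the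
counterclockwise circle `Γ_k` to the canonical sheet. -/
def IsAbelianPoly {N : ℕ} [NeZero N] (p : Phase N) (n : ℕ) (ψ : ℂ[X]) : Prop :=
  ψ.natDegree ≤ N - 2 ∧
    ∀ k : ℕ, 1 ≤ k → k ≤ N - 1 →
      (1 / (2 * (Real.pi : ℂ))) *
          (∮ z in C((mid p k : ℂ), contourRadius p k), ψ.eval z / canonicalRoot p z)
        = if k = n then 1 else 0

/-- The polynomial `ψ_n`. -/
def abelianPoly {N : ℕ} [NeZero N] (p : Phase N) (n : ℕ) : ℂ[X] :=
  Classical.epsilon (IsAbelianPoly p n)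

/-- The starred root `y_1(N, μ_n) - y_2(N + 1, μ_n)`, a square root of `Δ(μ_n)^2 - 4`; the
Dirichlet divisor is the point `μ_n^* = (μ_n, starRoot)` of the curve `z^2 = Δ(λ)^2 - 4`. -/
def starRoot {N : ℕ} [NeZero N] (p : Phase N) (n : ℕ) : ℝ :=
  (y₁ p N).eval (dir p n) - (y₂ p (N + 1)).eval (dir p n)

/-- The sheet `z = ± √(Δ(λ)^2 - 4)` over the `n`-th gap that contains `μ_n^*` (when
`starRoot = 0`, the point `μ_n^*` is a ramification point and lies on both). -/
def sheetSign {N : ℕ} [NeZero N] (p : Phase N) (n : ℕ) : ℝ := if 0 ≤ starRoot p n then 1 else -1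

/-- The angle `η_n`, the integral of `ψ_n(λ) / √(Δ(λ)^2 - 4) dλ` on the curve
`z^2 = Δ(λ)^2 - 4` from the ramification point `(λ_{2n}, 0)` to `μ_n^*`, for a point of the phase
space whose `n`-th gap is open.  The path is the lift of the real segment from `λ_{2n}` to `μ_n`,
which lies in the closed gap and hence in every isolating neighbourhood of it; other admissible
paths change the value by multiples of `2π`. -/
def eta {N : ℕ} [NeZero N] (p : Phase N) (n : ℕ) : ℂ :=
  ∫ x in (lam p (2 * n))..(dir p n),
    (abelianPoly p n).eval (x : ℂ)
      / ((sheetSign p n * Real.sqrt ((discr p).eval x ^ 2 - 4) : ℝ) : ℂ)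

/-- The function `z_n^+ = γ_n e^{i η_n}` on the phase space.  Where the `n`-th gap is collapsed
its value is `0`, because of the factor `γ_n`; this is the value of its continuous (and analytic)
extension there. -/
def zPlus {N : ℕ} [NeZero N] (n : ℕ) (p : Phase N) : ℂ :=
  (gap p n : ℂ) * Complex.exp (Complex.I * eta p n)

/-- `F` is differentiable at `p` with gradient `∇_{b,a} F = (G.1, G.2) ∈ ℂ^N × ℂ^N`, that is,
`dF(p)(β, α) = ∑_j (G.1 j * β_j + G.2 j * α_j)`. -/
def HasGradientBA {N : ℕ} (F : Phase N → ℂ) (G : (Fin N → ℂ) × (Fin N → ℂ)) (p : Phase N) :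
    Prop :=
  HasFDerivAt F
    (∑ j : Fin N,
      (((ContinuousLinearMap.proj (R := ℝ) (φ := fun _ : Fin N => ℝ) j).comp
          (ContinuousLinearMap.fst ℝ (Fin N → ℝ) (Fin N → ℝ))).smulRight (G.1 j)
        + ((ContinuousLinearMap.proj (R := ℝ) (φ := fun _ : Fin N => ℝ) j).comp
          (ContinuousLinearMap.snd ℝ (Fin N → ℝ) (Fin N → ℝ))).smulRight (G.2 j)))
    p

/-- The `2N`-vector `v ·_s w = (v(j) w(j), v(j) w(j+1) + w(j) v(j+1))_{1 ≤ j ≤ N}`; the position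
`j : Fin N` carries the index `j + 1`. -/
def symProd (N : ℕ) (v w : ℕ → ℂ) : (Fin N → ℂ) × (Fin N → ℂ) :=
  (fun j => v (j.val + 1) * w (j.val + 1),
    fun j => v (j.val + 1) * w (j.val + 2) + w (j.val + 1) * v (j.val + 2))

/-- `g = g_n`: the solution at `λ = μ_n` with `g(1) = 0`, `g(0) > 0` and
`∑_{j=1}^N g(j)^2 = 1`. -/
structure IsDirichletVector {N : ℕ} [NeZero N] (p : Phase N) (n : ℕ) (g : ℕ → ℝ) : Prop where
  solves : Solves p (dir p n) g
  at_one : g 1 = 0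
  at_zero : 0 < g 0
  normalized : ∑ j ∈ Finset.Icc 1 N, g j ^ 2 = 1

/-- `h = h_n`: the solution at `λ = μ_n` that is orthogonal to `g = g_n`, normalized by
`∑_{j=1}^N h(j)^2 = 1` and `h(1) > 0`. -/
structure IsConjugateVector {N : ℕ} [NeZero N] (p : Phase N) (n : ℕ) (g h : ℕ → ℝ) : Prop where
  solves : Solves p (dir p n) h
  orthogonal : ∑ j ∈ Finset.Icc 1 N, h j * g j = 0
  at_one : 0 < h 1
  normalized : ∑ j ∈ Finset.Icc 1 N, h j ^ 2 = 1

end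

end Toda

/-!
At a point `p` with collapsed `n`-th gap the monodromy matrix at `μ_n` is `e = ±1`
(`monodromy_collapsed`), and all solutions of the difference equation are periodic or all are
antiperiodic.  The claim is a statement of degenerate perturbation theory: near `p` everything
about the `n`-th gap is, to first order, governed by the symmetric form
`(v, w) ↦ ⟨v ·_s w, d⟩`, `d = q - p`, on the plane of solutions, which has the orthonormal basis
`g`, `h`.

*The angle.*  On the gap, `1 / √(Δ² - 4)` is the arcsine density times a continuous function, the
`weight`.  The normalizing integrals of `ψ_n` shrink to averages over the gaps (`period_eq`), so
that `ψ_n` is the solution of an invertible linear system that depends continuously on the point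
(`periodMatrix_det_ne_zero`).  Hence the density `ψ_n · weight` is continuous up to the collapsed
gap, where the normalization fixes it to be `s = -e` (`gapDensity_collapsed`).  For constant
density the integral `η_n` is elementary, and `zPlus_approx` gives
`z_n^+ = 2 (τ_n - μ_n) + 2 i s (y₁(N, μ_n) - y₂(N+1, μ_n)) weight(μ_n) + o(γ_n)`.

*The perturbation theory.*  Green's identity expands the entries of the monodromy matrix to first
order in `q - p` and `x - μ_n(p)` using nothing but the continuity of solutions
(`monodromy_expansion`).  In the basis `g`, `h` the determinant of the resulting forms is a
multiple of `2 - e Δ`, because the monodromy matrix is unimodular (`det_form`).  Comparing it with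
`(x - λ_{2n}) (x - λ_{2n+1})` determines `weight` at the collapsed gap (`weight_eq`), the sum
`λ_{2n} + λ_{2n+1}` up to `o(‖q - p‖)` (`edges_add`), and the estimate `γ_n = O(‖q - p‖)`
(`gap_isBigO`); the single edges need not be differentiable.  Since `y₁(N+1, ·)` is the form at
`(g, g)`, up to a constant, its zero `μ_n` moves by `⟨g ·_s g, d⟩` (`dir_expansion`), and the
starred root is given by `⟨g ·_s h, d⟩` (`starRoot_expansion`).  Altogether
`z_n^+ = ⟨h ·_s h - g ·_s g - 2 i g ·_s h, d⟩ + o(‖d‖)` (`zPlus_expansion`).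

Behind both parts lies the description of the spectrum: `charpoly_Q` identifies the eigenvalues of
`Q` with the zeros of `Δ² - 4`, `band_structure` orders them relative to the `μ_k`, and
`continuous_lam` gives their continuity.
-/

namespace Toda

open Polynomial

/-! ### Solutions of the difference equation -/

lemma per_add {N : ℕ} [NeZero N] (v : Fin N → ℝ) (k : ℕ) : per v (k + N) = per v k := by
  unfold per
  congr 1
  ext
  simp only [Fin.ofNat]
  rw [show k + N + (N - 1) = (k + (N - 1)) + N by omega, Nat.add_mod_right]

lemma per_succ {N : ℕ} [NeZero N] (v : Fin N → ℝ) (j : Fin N) : per v (j.val + 1) = v j := by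
  unfold per
  congr 1
  ext
  simp only [Fin.ofNat]
  have := j.isLt
  rw [show j.val + 1 + (N - 1) = j.val + N by omega, Nat.add_mod_right, Nat.mod_eq_of_lt this]

lemma aSeq_add {N : ℕ} [NeZero N] (p : Phase N) (k : ℕ) : aSeq p (k + N) = aSeq p k :=
  per_add _ _

lemma bSeq_add {N : ℕ} [NeZero N] (p : Phase N) (k : ℕ) : bSeq p (k + N) = bSeq p k :=
  per_add _ _

lemma aSeq_period {N : ℕ} [NeZero N] (p : Phase N) : aSeq p N = aSeq p 0 := by
  simpa using aSeq_add p 0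

lemma aSeq_pos {N : ℕ} [NeZero N] {p : Phase N} (hp : p ∈ phaseSpace N) (k : ℕ) :
    0 < aSeq p k := hp _

lemma prod_aSeq {N : ℕ} [NeZero N] (p : Phase N) :
    ∏ k ∈ Finset.range N, aSeq p (k + 1) = ∏ j, p.2 j := by
  rw [Finset.prod_range]
  exact Finset.prod_congr rfl fun j _ => per_succ _ j

lemma aSeq_continuous {N : ℕ} [NeZero N] (k : ℕ) : Continuous fun p : Phase N => aSeq p k := by
  unfold aSeq per; fun_prop

lemma bSeq_continuous {N : ℕ} [NeZero N] (k : ℕ) : Continuous fun p : Phase N => bSeq p k := by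
  unfold bSeq per; fun_prop

lemma isOpen_phaseSpace (N : ℕ) : IsOpen (phaseSpace N) := by
  have : phaseSpace N = ⋂ j, {p : Phase N | 0 < p.2 j} := by ext; simp [phaseSpace]
  rw [this]
  exact isOpen_iInter_of_finite fun j => isOpen_lt continuous_const (by fun_prop)

section Solutions

variable {N : ℕ} [NeZero N] {p : Phase N}

lemma solPoly_succ_succ (p : Phase N) (u v : ℝ) (k : ℕ) :
    solPoly p u v (k + 2) = C (aSeq p (k + 1))⁻¹ *
        ((X - C (bSeq p (k + 1))) * solPoly p u v (k + 1) - C (aSeq p k) * solPoly p u v k) := by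
  rw [solPoly]

lemma solPoly_rec (hp : p ∈ phaseSpace N) (u v : ℝ) (k : ℕ) :
    C (aSeq p (k + 1)) * solPoly p u v (k + 2) =
      (X - C (bSeq p (k + 1))) * solPoly p u v (k + 1) - C (aSeq p k) * solPoly p u v k := by
  rw [solPoly_succ_succ, ← mul_assoc, ← C_mul, mul_inv_cancel₀ (aSeq_pos hp _).ne', C_1, one_mul]

lemma solPoly_eval_rec (hp : p ∈ phaseSpace N) (u v x : ℝ) (k : ℕ) :
    aSeq p (k + 1) * (solPoly p u v (k + 2)).eval x =
      (x - bSeq p (k + 1)) * (solPoly p u v (k + 1)).eval x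
        - aSeq p k * (solPoly p u v k).eval x := by
  simpa using congrArg (eval x) (solPoly_rec hp u v k)

lemma solves_solPoly (hp : p ∈ phaseSpace N) (u v x : ℝ) :
    Solves p x fun k => (solPoly p u v k).eval x := by
  intro k hk
  obtain ⟨m, rfl⟩ : ∃ m, k = m + 1 := ⟨k - 1, by omega⟩
  have := solPoly_eval_rec hp u v x m
  simp only [Nat.add_sub_cancel]
  linear_combination this

/-- A solution is determined by its values at `0` and `1`. -/
lemma Solves.eq_solPoly (hp : p ∈ phaseSpace N) {x : ℝ} {y : ℕ → ℝ} (hy : Solves p x y) (k : ℕ) :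
    y k = (solPoly p (y 0) (y 1) k).eval x := by
  induction k using Nat.twoStepInduction with
  | zero => simp [solPoly]
  | one => simp [solPoly]
  | more k h0 h1 =>
    have ha := (aSeq_pos hp (k + 1)).ne'
    have h := hy (k + 1) (by omega)
    simp only [Nat.add_sub_cancel] at h
    apply mul_left_cancel₀ ha
    rw [solPoly_eval_rec hp, ← h0, ← h1]
    linear_combination h

lemma solPoly_linear (p : Phase N) (u v : ℝ) (k : ℕ) :
    solPoly p u v k = C u * y₁ p k + C v * y₂ p k := by
  unfold y₁ y₂
  induction k using Nat.twoStepInduction with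
  | zero => simp [solPoly]
  | one => simp [solPoly]
  | more k h0 h1 =>
    simp only [solPoly_succ_succ]
    rw [h0, h1]
    ring

lemma Solves.eq_fundamental (hp : p ∈ phaseSpace N) {x : ℝ} {y : ℕ → ℝ} (hy : Solves p x y)
    (k : ℕ) : y k = y 0 * (y₁ p k).eval x + y 1 * (y₂ p k).eval x := by
  rw [hy.eq_solPoly hp k, solPoly_linear]; simp

/-- Translation by one period acts on solutions through the monodromy matrix. -/
lemma solPoly_add_period (hp : p ∈ phaseSpace N) (u v : ℝ) (k : ℕ) :
    solPoly p u v (k + N) =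
      solPoly p u v N * y₁ p k + solPoly p u v (N + 1) * y₂ p k := by
  unfold y₁ y₂
  induction k using Nat.twoStepInduction with
  | zero => simp [solPoly]
  | one => simp [solPoly, add_comm]
  | more k h0 h1 =>
    have ha : (C (aSeq p (k + 1)) : ℝ[X]) ≠ 0 := C_ne_zero.2 (aSeq_pos hp (k + 1)).ne'
    apply mul_left_cancel₀ ha
    have e := solPoly_rec hp u v (k + N)
    rw [show k + N + 1 = k + 1 + N by omega, show k + N + 2 = k + 2 + N by omega, aSeq_add,
      bSeq_add, aSeq_add] at e
    rw [e, h0, h1]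
    linear_combination (-solPoly p u v N) * solPoly_rec hp 1 0 k
      - solPoly p u v (N + 1) * solPoly_rec hp 0 1 k

lemma wronskian (hp : p ∈ phaseSpace N) (k : ℕ) :
    C (aSeq p k) * (y₁ p k * y₂ p (k + 1) - y₁ p (k + 1) * y₂ p k) = C (aSeq p 0) := by
  unfold y₁ y₂
  induction k with
  | zero => simp [solPoly]
  | succ k ih =>
    linear_combination ih + solPoly p 1 0 (k + 1) * solPoly_rec hp 0 1 k
      - solPoly p 0 1 (k + 1) * solPoly_rec hp 1 0 k

/-- The monodromy matrix is unimodular. -/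
lemma monodromy_det (hp : p ∈ phaseSpace N) :
    y₁ p N * y₂ p (N + 1) - y₁ p (N + 1) * y₂ p N = 1 := by
  have h := wronskian hp N
  rw [aSeq_period] at h
  have ha : (C (aSeq p 0) : ℝ[X]) ≠ 0 := C_ne_zero.2 (aSeq_pos hp 0).ne'
  exact mul_left_cancel₀ ha (by rw [h, mul_one])

/-- At a zero of `y₁ (N + 1)` this exhibits `Δ² - 4` as the square of the starred root. -/
lemma discr_sq_sub_four (hp : p ∈ phaseSpace N) :
    discr p ^ 2 - 4 = (y₁ p N - y₂ p (N + 1)) ^ 2 + 4 * (y₁ p (N + 1) * y₂ p N) := by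
  unfold discr
  linear_combination 4 * monodromy_det hp

lemma solPoly_continuousAt (hp : p ∈ phaseSpace N) (u v x : ℝ) (k : ℕ) :
    ContinuousAt (fun z : Phase N × ℝ => (solPoly z.1 u v k).eval z.2) (p, x) := by
  induction k using Nat.twoStepInduction with
  | zero => simp only [solPoly, eval_C]; exact continuousAt_const
  | one => simp only [solPoly, eval_C]; exact continuousAt_const
  | more k h0 h1 =>
    simp only [solPoly_succ_succ, eval_mul, eval_sub, eval_C, eval_X]
    have hA (j : ℕ) : ContinuousAt (fun z : Phase N × ℝ => aSeq z.1 j) (p, x) :=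
      ((aSeq_continuous j).comp continuous_fst).continuousAt
    have hB (j : ℕ) : ContinuousAt (fun z : Phase N × ℝ => bSeq z.1 j) (p, x) :=
      ((bSeq_continuous j).comp continuous_fst).continuousAt
    exact ((hA _).inv₀ (aSeq_pos hp _).ne').mul
      (((continuousAt_snd.sub (hB _)).mul h1).sub ((hA _).mul h0))

lemma discr_continuousAt (hp : p ∈ phaseSpace N) (x : ℝ) :
    ContinuousAt (fun z : Phase N × ℝ => (discr z.1).eval z.2) (p, x) := by
  simp only [discr, eval_add]
  exact (solPoly_continuousAt hp 1 0 x N).add (solPoly_continuousAt hp 0 1 x (N + 1))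

/-- One step of a three-term recursion raises the degree by one and keeps the leading coefficient
positive. -/
lemma degree_three_term {f g : ℝ[X]} {a : ℝ} (b c : ℝ) (ha : 0 < a) (hf : 0 < f.leadingCoeff)
    (hg : g.degree < f.degree) :
    (C a⁻¹ * ((X - C b) * f - C c * g)).natDegree = f.natDegree + 1 ∧
      0 < (C a⁻¹ * ((X - C b) * f - C c * g)).leadingCoeff ∧
      f.degree < (C a⁻¹ * ((X - C b) * f - C c * g)).degree := by
  have hf0 : f ≠ 0 := leadingCoeff_ne_zero.1 hf.ne'
  have hlt : (C c * g).degree < ((X - C b) * f).degree := by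
    rw [← smul_eq_C_mul, mul_comm]
    exact (degree_smul_le c g).trans_lt
      (hg.trans_le (degree_le_mul_left f (X_sub_C_ne_zero b)))
  have hl : 0 < (C a⁻¹ * ((X - C b) * f - C c * g)).leadingCoeff := by
    rw [leadingCoeff_mul, leadingCoeff_C, leadingCoeff_sub_of_degree_lt hlt, leadingCoeff_mul,
      leadingCoeff_X_sub_C, one_mul]
    positivity
  have hd : (C a⁻¹ * ((X - C b) * f - C c * g)).natDegree = f.natDegree + 1 := by
    rw [natDegree_C_mul (inv_pos.2 ha).ne',
      natDegree_eq_of_degree_eq (degree_sub_eq_left_of_degree_lt hlt),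
      natDegree_mul (X_sub_C_ne_zero _) hf0, natDegree_X_sub_C, add_comm]
  refine ⟨hd, hl, ?_⟩
  rw [degree_eq_natDegree hf0, degree_eq_natDegree (leadingCoeff_ne_zero.1 hl.ne'), hd]
  norm_cast
  exact Nat.lt_succ_self _

/-- The sign is needed as `y₁ 2 = -a_0 / a_1` starts the recursion with a negative constant. -/
lemma neg_y₁_degree (hp : p ∈ phaseSpace N) (k : ℕ) :
    (-y₁ p (k + 2)).natDegree = k ∧ 0 < (-y₁ p (k + 2)).leadingCoeff ∧
      (-y₁ p (k + 1)).degree < (-y₁ p (k + 2)).degree := by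
  unfold y₁
  induction k with
  | zero =>
    have h : -solPoly p 1 0 2 = C ((aSeq p 1)⁻¹ * aSeq p 0) := by
      simp [solPoly]
    have h0 := aSeq_pos hp 0
    have h1 := aSeq_pos hp 1
    have h2 : (aSeq p 1)⁻¹ * aSeq p 0 ≠ 0 := by positivity
    rw [zero_add, h, natDegree_C, leadingCoeff_C, degree_C h2]
    exact ⟨rfl, by positivity, by simp [solPoly]⟩
  | succ k ih =>
    have hrec : -solPoly p 1 0 (k + 1 + 2) = C (aSeq p (k + 2))⁻¹ *
        ((X - C (bSeq p (k + 2))) * (-solPoly p 1 0 (k + 2))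
          - C (aSeq p (k + 1)) * -solPoly p 1 0 (k + 1)) := by
      rw [solPoly_succ_succ]; ring
    have h := degree_three_term (bSeq p (k + 2)) (aSeq p (k + 1)) (aSeq_pos hp (k + 2)) ih.2.1
      ih.2.2
    rw [← hrec, ih.1] at h
    exact h

lemma y₂_degree (hp : p ∈ phaseSpace N) (k : ℕ) :
    (y₂ p (k + 1)).natDegree = k ∧ 0 < (y₂ p (k + 1)).leadingCoeff ∧
      (y₂ p k).degree < (y₂ p (k + 1)).degree := by
  unfold y₂
  induction k with
  | zero => simp [solPoly]
  | succ k ih =>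
    have h := degree_three_term (bSeq p (k + 1)) (aSeq p k) (aSeq_pos hp (k + 1)) ih.2.1 ih.2.2
    rw [← solPoly_succ_succ, ih.1] at h
    exact h

lemma discr_degree (hp : p ∈ phaseSpace N) (hN : 2 ≤ N) :
    (discr p).natDegree = N ∧ 0 < (discr p).leadingCoeff := by
  obtain ⟨d2, l2, -⟩ := y₂_degree hp N
  obtain ⟨d1, l1, -⟩ := neg_y₁_degree hp (N - 2)
  rw [show N - 2 + 2 = N by omega, natDegree_neg] at d1
  have hlt : (y₁ p N).degree < (y₂ p (N + 1)).degree := by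
    apply degree_lt_degree
    omega
  unfold discr
  rw [natDegree_eq_of_degree_eq (degree_add_eq_right_of_degree_lt hlt),
    leadingCoeff_add_of_degree_lt hlt]
  exact ⟨d2, l2⟩

end Solutions

/-! ### Interlacing zeros -/

/-- The intermediate value theorem between consecutive points of alternating sign. -/
lemma exists_roots_of_alternating {f : ℝ[X]} {k : ℕ} {t : ℕ → ℝ} (ht : ∀ j ≤ k, t j < t (j + 1))
    (hs : ∀ j ≤ k + 1, 0 < (-1) ^ (k + 1 + j) * f.eval (t j)) :
    ∃ y : ℕ → ℝ, ∀ j ≤ k, t j < y j ∧ y j < t (j + 1) ∧ f.eval (y j) = 0 := by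
  have key : ∀ j, ∃ y, j ≤ k → t j < y ∧ y < t (j + 1) ∧ f.eval y = 0 := by
    intro j
    by_cases hj : j ≤ k
    swap
    · exact ⟨0, fun h => absurd h hj⟩
    have h0 := hs j (by omega)
    have h1 := hs (j + 1) (by omega)
    have hpow : ((-1 : ℝ)) ^ (k + 1 + (j + 1)) = -(-1) ^ (k + 1 + j) := by
      rw [← add_assoc, pow_succ]; ring
    rw [hpow] at h1
    have hc : ContinuousOn (fun x => (-1) ^ (k + 1 + j) * f.eval x) (Set.Icc (t j) (t (j + 1))) := by
      fun_prop
    obtain ⟨y, hy, hy0⟩ := intermediate_value_Ioo' (ht j hj).le hc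
      (show (0 : ℝ) ∈ _ from ⟨by linarith, h0⟩)
    refine ⟨y, fun _ => ⟨hy.1, hy.2, ?_⟩⟩
    simpa using hy0
  choose y hy using key
  exact ⟨y, fun j hj => hy j hj⟩

lemma exists_eval_pos_above {f : ℝ[X]} (hd : 0 < f.natDegree) (hl : 0 < f.leadingCoeff) (B : ℝ) :
    ∃ x, B < x ∧ 0 < f.eval x := by
  have h := tendsto_atTop_of_leadingCoeff_nonneg f (natDegree_pos_iff_degree_pos.1 hd) hl.le
  obtain ⟨x, hx, hx'⟩ := ((h.eventually_gt_atTop 0).and (Filter.eventually_gt_atTop B)).exists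
  exact ⟨x, hx', hx⟩

lemma exists_eval_pos_below {f : ℝ[X]} (hd : 0 < f.natDegree) (hl : 0 < f.leadingCoeff) (B : ℝ) :
    ∃ x, x < B ∧ 0 < (-1) ^ f.natDegree * f.eval x := by
  set g : ℝ[X] := C ((-1) ^ f.natDegree) * f.comp (-X) with hg
  have h1 : ((-1 : ℝ) ^ f.natDegree) ≠ 0 := pow_ne_zero _ (by norm_num)
  have hgd : g.natDegree = f.natDegree := by
    rw [hg, natDegree_C_mul h1, natDegree_comp, natDegree_neg, natDegree_X, mul_one]
  have hgl : g.leadingCoeff = f.leadingCoeff := by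
    rw [hg, leadingCoeff_mul, leadingCoeff_C, leadingCoeff_comp (by simp)]
    rw [leadingCoeff_neg, leadingCoeff_X, mul_comm, mul_assoc, ← mul_pow]
    simp
  obtain ⟨x, hx, hx'⟩ := exists_eval_pos_above (f := g) (by omega) (by rw [hgl]; exact hl) (-B)
  refine ⟨-x, by linarith, ?_⟩
  simpa [hg, eval_comp] using hx'

/-- A polynomial of degree `k + 1` whose signs alternate at `k` points in the way they do for a
polynomial with interlacing zeros has `k + 1` real zeros, interlacing with these points. -/
lemma exists_interlacing {f : ℝ[X]} {k : ℕ} {x : ℕ → ℝ} (hd : f.natDegree = k + 1)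
    (hl : 0 < f.leadingCoeff) (hx : ∀ j, j + 1 < k → x j < x (j + 1))
    (hs : ∀ j < k, 0 < (-1) ^ (k + j) * f.eval (x j)) :
    ∃ y : ℕ → ℝ, (∀ j ≤ k, f.eval (y j) = 0) ∧ (∀ j < k, y j < x j ∧ x j < y (j + 1)) := by
  obtain ⟨hi, hhi, hhi'⟩ := exists_eval_pos_above (by omega) hl (max (x (k - 1)) 0)
  obtain ⟨lo, hlo, hlo'⟩ := exists_eval_pos_below (f := f) (by omega) hl (min (x 0) 0)
  have hlo1 : lo < x 0 := hlo.trans_le (min_le_left _ _)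
  have hlo2 : lo < 0 := hlo.trans_le (min_le_right _ _)
  have hhi1 : x (k - 1) < hi := (le_max_left _ _).trans_lt hhi
  have hhi2 : 0 < hi := (le_max_right _ _).trans_lt hhi
  rw [hd] at hlo'
  let t : ℕ → ℝ := fun j => if j = 0 then lo else if j ≤ k then x (j - 1) else hi
  obtain ⟨y, hy⟩ := exists_roots_of_alternating (f := f) (k := k) (t := t) (by
    intro j hj
    rcases j with _ | j
    · rcases k with _ | k
      · simp [t]; linarith
      · simpa [t] using hlo1
    · rcases hj.lt_or_eq with h | h
      · simpa [t, hj, h] using hx j h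
      · subst h; simpa [t] using hhi1) (by
    intro j hj
    rcases j with _ | j
    · simpa [t] using hlo'
    · rcases hj.lt_or_eq with h | h
      · have h2 : j < k := by omega
        have := hs j h2
        have e : k + 1 + (j + 1) = k + j + 2 := by ring
        rw [e, pow_add]
        simpa [t, h2, Nat.succ_le_of_lt h2] using this
      · have : j = k := by omega
        subst this
        rw [← two_mul, pow_mul]
        simpa [t] using hhi')
  refine ⟨y, fun j hj => (hy j hj).2.2, fun j hj => ?_⟩
  have h1 := (hy j hj.le).2.1
  have h2 := (hy (j + 1) hj).1
  have : t (j + 1) = x j := by simp [t, Nat.succ_le_of_lt hj]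
  rw [this] at h1 h2
  exact ⟨h1, h2⟩

lemma orderedRoot_of_roots {f : ℝ[X]} {m : ℕ} {x : ℕ → ℝ} (hr : f.roots = (Multiset.range m).map x)
    (hx : ∀ i j, i < j → j < m → x i ≤ x j) {j : ℕ} (h1 : 1 ≤ j) (h2 : j ≤ m) :
    orderedRoot f j = x (j - 1) := by
  have hsort : f.roots.sort (· ≤ ·) = (List.range m).map x := by
    rw [hr]
    apply List.Perm.eq_of_pairwise' (r := (· ≤ ·))
    · exact Multiset.pairwise_sort _ _
    · rw [List.pairwise_map]
      refine List.Pairwise.imp_of_mem ?_ (List.pairwise_lt_range (n := m))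
      intro a b ha hb hab
      exact hx a b hab (by simpa using hb)
    · rw [← Multiset.coe_eq_coe, Multiset.sort_eq]
      rfl
  unfold orderedRoot
  rw [hsort, List.getD_eq_getElem _ _ (by simp; omega)]
  simp

lemma roots_eq_map_orderedRoot (f : ℝ[X]) :
    f.roots = (Multiset.range f.roots.card).map fun i => orderedRoot f (i + 1) := by
  conv_lhs => rw [← Multiset.sort_eq f.roots (· ≤ ·)]
  have hl : (f.roots.sort (· ≤ ·)).length = f.roots.card := Multiset.length_sort _
  refine congrArg (fun l : List ℝ => (l : Multiset ℝ))
    (a₂ := (List.range f.roots.card).map fun i => orderedRoot f (i + 1)) ?_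
  apply List.ext_getElem
  · simp
  · intro i h1 h2
    simp [orderedRoot, List.getElem?_eq_getElem h1]

lemma orderedRoot_mono (f : ℝ[X]) {i j : ℕ} (h1 : 1 ≤ i) (hij : i ≤ j) (hj : j ≤ f.roots.card) :
    orderedRoot f i ≤ orderedRoot f j := by
  have hl : (f.roots.sort (· ≤ ·)).length = f.roots.card := Multiset.length_sort _
  unfold orderedRoot
  rw [List.getD_eq_getElem _ _ (by omega), List.getD_eq_getElem _ _ (by omega)]
  rcases hij.lt_or_eq with h | h
  · exact List.pairwise_iff_getElem.1 (Multiset.pairwise_sort f.roots (· ≤ ·)) _ _ _ _ (by omega)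
  · subst h; rfl

/-- `x 0 < ⋯ < x (m - 1)` are the zeros of `f`, which are all simple. -/
structure IsRootSeq (f : ℝ[X]) (m : ℕ) (x : ℕ → ℝ) : Prop where
  ne_zero : f ≠ 0
  natDegree : f.natDegree = m
  lt : ∀ ⦃i j⦄, i < j → j < m → x i < x j
  root : ∀ j < m, f.eval (x j) = 0

namespace IsRootSeq

variable {f : ℝ[X]} {m : ℕ} {x : ℕ → ℝ}

lemma of_lt_succ (h0 : f ≠ 0) (hd : f.natDegree = m) (hlt : ∀ j, j + 1 < m → x j < x (j + 1))
    (hr : ∀ j < m, f.eval (x j) = 0) : IsRootSeq f m x where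
  ne_zero := h0
  natDegree := hd
  lt := by
    intro i j hij
    induction j, hij using Nat.le_induction with
    | base => exact hlt i
    | succ j hj ih => exact fun h => (ih (by omega)).trans (hlt j h)
  root := hr

lemma injOn (h : IsRootSeq f m x) : Set.InjOn x (Finset.range m) := by
  intro i hi j hj hij
  simp only [Finset.coe_range, Set.mem_Iio] at hi hj
  rcases lt_trichotomy i j with h1 | h1 | h1
  · exact absurd hij (h.lt h1 hj).ne
  · exact h1
  · exact absurd hij (h.lt h1 hi).ne'

lemma roots (h : IsRootSeq f m x) : f.roots = (Multiset.range m).map x := by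
  have hnd : ((Multiset.range m).map x).Nodup :=
    Multiset.Nodup.map_on (fun a ha b hb e => h.injOn (by simpa using ha) (by simpa using hb) e)
      (Multiset.nodup_range m)
  symm
  apply Multiset.eq_of_le_of_card_le
  · rw [Multiset.le_iff_subset hnd]
    intro a ha
    obtain ⟨j, hj, rfl⟩ := Multiset.mem_map.1 ha
    rw [mem_roots h.ne_zero]
    exact h.root j (by simpa using hj)
  · simpa [h.natDegree] using f.card_roots'

lemma eval_eq (h : IsRootSeq f m x) (t : ℝ) :
    f.eval t = f.leadingCoeff * ∏ i ∈ Finset.range m, (t - x i) := by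
  have hs : f.roots.card = f.natDegree := by rw [h.roots, h.natDegree]; simp
  have := C_leadingCoeff_mul_prod_multiset_X_sub_C hs
  conv_lhs => rw [← this, h.roots]
  rw [eval_mul, eval_C, Multiset.map_map, eval_multiset_prod, Multiset.map_map]
  simp [Finset.prod]

lemma orderedRoot_eq (h : IsRootSeq f m x) {j : ℕ} (h1 : 1 ≤ j) (h2 : j ≤ m) :
    orderedRoot f j = x (j - 1) :=
  orderedRoot_of_roots h.roots (fun _ _ hij hj => (h.lt hij hj).le) h1 h2

lemma rootMultiplicity_eq_one (h : IsRootSeq f m x) {j : ℕ} (hj : j < m) :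
    f.rootMultiplicity (x j) = 1 := by
  rw [← count_roots, h.roots, Multiset.count_eq_one_of_mem]
  · exact Multiset.Nodup.map_on
      (fun a ha b hb e => h.injOn (by simpa using ha) (by simpa using hb) e) (Multiset.nodup_range m)
  · exact Multiset.mem_map_of_mem _ (by simpa using hj)

/-- The sign of a polynomial with simple real zeros between two consecutive ones. -/
lemma sign_eval (h : IsRootSeq f m x) (hl : 0 < f.leadingCoeff) {j : ℕ} (hj : j ≤ m) {t : ℝ}
    (h1 : ∀ i < j, x i < t) (h2 : ∀ i < m, j ≤ i → t < x i) :
    0 < (-1) ^ (m + j) * f.eval t := by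
  have e : (-1 : ℝ) ^ (m + j) = (-1) ^ (m - j) := by
    rw [show m + j = (m - j) + 2 * j by omega, pow_add, pow_mul]; simp
  have e2 : ∏ i ∈ Finset.range m, (t - x i) =
      (∏ i ∈ Finset.range j, (t - x i)) * ((-1) ^ (m - j) * ∏ i ∈ Finset.Ico j m, (x i - t)) := by
    rw [← Finset.prod_range_mul_prod_Ico _ hj]
    congr 1
    rw [← Nat.card_Ico j m, ← Finset.prod_const, ← Finset.prod_mul_distrib]
    exact Finset.prod_congr rfl fun i _ => by ring
  rw [h.eval_eq, e2, e]
  have e3 : (-1 : ℝ) ^ (m - j) * (-1) ^ (m - j) = 1 := by rw [← mul_pow]; simp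
  have p1 : 0 < ∏ i ∈ Finset.range j, (t - x i) :=
    Finset.prod_pos fun i hi => sub_pos.2 (h1 i (Finset.mem_range.1 hi))
  have p2 : 0 < ∏ i ∈ Finset.Ico j m, (x i - t) :=
    Finset.prod_pos fun i hi => by
      rw [Finset.mem_Ico] at hi
      exact sub_pos.2 (h2 i hi.2 hi.1)
  have : (-1 : ℝ) ^ (m - j) * (f.leadingCoeff * ((∏ i ∈ Finset.range j, (t - x i)) *
      ((-1) ^ (m - j) * ∏ i ∈ Finset.Ico j m, (x i - t)))) =
      f.leadingCoeff * ((∏ i ∈ Finset.range j, (t - x i)) * ∏ i ∈ Finset.Ico j m, (x i - t)) := by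
    linear_combination (f.leadingCoeff * ((∏ i ∈ Finset.range j, (t - x i)) *
      ∏ i ∈ Finset.Ico j m, (x i - t))) * e3
  rw [this]
  positivity

end IsRootSeq

section Dirichlet

variable {N : ℕ} [NeZero N] {p : Phase N}

/-- The Sturm property of the fundamental solution `y₁`, by induction on the length: where `y₁ (k
+ 2)` vanishes, the recursion forces `y₁ (k + 3)` and `y₁ (k + 1)` to have opposite signs. -/
lemma sturm (hp : p ∈ phaseSpace N) (k : ℕ) :
    ∃ x : ℕ → ℝ, IsRootSeq (-y₁ p (k + 2)) k x ∧
      ∀ j < k, 0 < (-1) ^ (k + j) * (y₁ p (k + 1)).eval (x j) := by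
  induction k with
  | zero =>
    obtain ⟨d, l, -⟩ := neg_y₁_degree hp 0
    exact ⟨fun _ => 0, ⟨leadingCoeff_ne_zero.1 l.ne', d, by omega, by omega⟩, by omega⟩
  | succ k ih =>
    obtain ⟨x, hx, hs⟩ := ih
    obtain ⟨d, l, -⟩ := neg_y₁_degree hp (k + 1)
    obtain ⟨-, l0, -⟩ := neg_y₁_degree hp k
    obtain ⟨y, hy0, hy⟩ := exists_interlacing d l (fun j hj => hx.lt (Nat.lt_succ_self j) hj) (by
      intro j hj
      have h1 := solPoly_eval_rec hp 1 0 (x j) (k + 1)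
      have h2 : (solPoly p 1 0 (k + 2)).eval (x j) = 0 := by simpa [y₁] using hx.root j hj
      rw [h2, mul_zero, zero_sub] at h1
      have a1 := aSeq_pos hp (k + 1)
      have a2 := aSeq_pos hp (k + 1 + 1)
      have h3 : (-y₁ p (k + 1 + 2)).eval (x j) =
          aSeq p (k + 1) / aSeq p (k + 1 + 1) * (y₁ p (k + 1)).eval (x j) := by
        unfold y₁
        rw [eval_neg]
        field_simp
        linear_combination -h1
      rw [h3, mul_left_comm]
      exact mul_pos (by positivity) (hs j hj))
    have hroot : IsRootSeq (-y₁ p (k + 1 + 2)) (k + 1) y :=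
      IsRootSeq.of_lt_succ (leadingCoeff_ne_zero.1 l.ne') d
        (fun j hj => (hy j (by omega)).1.trans (hy j (by omega)).2)
        (fun j hj => hy0 j (by omega))
    refine ⟨y, hroot, fun j hj => ?_⟩
    have h := hx.sign_eval l0 (j := j) (t := y j) (by omega)
      (fun i hi => (hy i (by omega)).2.trans_le (by
        rcases Nat.lt_or_eq_of_le (Nat.succ_le_of_lt hi) with h | h
        · exact (hroot.lt h hj).le
        · rw [← h]))
      (fun i hi hij => by
        refine lt_of_le_of_lt ?_ (hy i hi).1
        rcases Nat.lt_or_eq_of_le hij with h | h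
        · exact (hroot.lt h (by omega)).le
        · rw [h])
    rw [eval_neg] at h
    rw [show k + 1 + j = k + j + 1 by omega, pow_succ]
    linarith

/-- The Dirichlet eigenvalues are the simple zeros of `y₁ (N + 1)`, and `y₁ N` alternates in sign
on them. -/
lemma dir_rootSeq (hp : p ∈ phaseSpace N) (hN : 2 ≤ N) :
    IsRootSeq (y₁ p (N + 1)) (N - 1) (fun j => dir p (j + 1)) ∧
      ∀ j < N - 1, 0 < (-1) ^ (N - 1 + j) * (y₁ p N).eval (dir p (j + 1)) := by
  obtain ⟨x, hx, hs⟩ := sturm hp (N - 1)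
  rw [show N - 1 + 2 = N + 1 by omega] at hx
  rw [show N - 1 + 1 = N by omega] at hs
  have hx' : IsRootSeq (y₁ p (N + 1)) (N - 1) x :=
    ⟨fun h => hx.ne_zero (by rw [h, neg_zero]), by rw [← hx.natDegree, natDegree_neg], hx.lt,
      fun j hj => by simpa using hx.root j hj⟩
  have hd : ∀ j < N - 1, dir p (j + 1) = x j := fun j hj =>
    hx'.orderedRoot_eq (j := j + 1) (by omega) (by omega)
  refine ⟨⟨hx'.ne_zero, hx'.natDegree, fun i j hij hj => ?_, fun j hj => ?_⟩, fun j hj => ?_⟩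
  · simp only [hd i (by omega), hd j hj]; exact hx'.lt hij hj
  · simp only [hd j hj]; exact hx'.root j hj
  · rw [hd j hj]; exact hs j hj

lemma monodromy_at_dir (hp : p ∈ phaseSpace N) (hN : 2 ≤ N) {j : ℕ} (hj : j < N - 1) :
    (y₁ p (N + 1)).eval (dir p (j + 1)) = 0 ∧
      (y₁ p N).eval (dir p (j + 1)) * (y₂ p (N + 1)).eval (dir p (j + 1)) = 1 := by
  have h := (dir_rootSeq hp hN).1.root j hj
  have h2 := congrArg (eval (dir p (j + 1))) (monodromy_det hp)
  simp only [eval_sub, eval_mul, h, eval_one] at h2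
  exact ⟨h, by simpa using h2⟩

/-- At a Dirichlet eigenvalue the monodromy matrix is triangular with reciprocal diagonal entries,
so that `Δ` has the sign of `y₁ N`. -/
lemma discr_sign_at_dir (hp : p ∈ phaseSpace N) (hN : 2 ≤ N) {j : ℕ} (hj : j < N - 1) :
    0 < (-1) ^ (N - 1 + j) * (discr p).eval (dir p (j + 1)) := by
  have h := (dir_rootSeq hp hN).2 j hj
  obtain ⟨-, h2⟩ := monodromy_at_dir hp hN hj
  set A := (y₁ p N).eval (dir p (j + 1))
  set D := (y₂ p (N + 1)).eval (dir p (j + 1))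
  set s : ℝ := (-1) ^ (N - 1 + j)
  have hss : s * s = 1 := by rw [← mul_pow]; simp
  have hsD : 0 < s * D := by
    have : (s * A) * (s * D) = 1 := by linear_combination h2 + (A * D) * hss
    exact pos_of_mul_pos_right (by rw [this]; norm_num) h.le
  have : s * (discr p).eval (dir p (j + 1)) = s * A + s * D := by
    simp only [discr, eval_add]; ring
  rw [this]; positivity

lemma discr_sq_at_dir (hp : p ∈ phaseSpace N) (hN : 2 ≤ N) {j : ℕ} (hj : j < N - 1) :
    (discr p).eval (dir p (j + 1)) ^ 2 - 4 = starRoot p (j + 1) ^ 2 := by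
  have h := congrArg (eval (dir p (j + 1))) (discr_sq_sub_four hp)
  obtain ⟨h1, -⟩ := monodromy_at_dir hp hN hj
  simp only [eval_sub, eval_pow, eval_add, eval_mul, h1] at h
  rw [starRoot]
  simpa using h

/-- The zeros of the discriminant interlace with the Dirichlet eigenvalues. -/
lemma discr_zeros (hp : p ∈ phaseSpace N) (hN : 2 ≤ N) :
    ∃ ν : ℕ → ℝ, (∀ j < N, (discr p).eval (ν j) = 0) ∧
      ∀ j < N - 1, ν j < dir p (j + 1) ∧ dir p (j + 1) < ν (j + 1) := by
  obtain ⟨d, l⟩ := discr_degree hp hN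
  obtain ⟨y, h1, h2⟩ := exists_interlacing (f := discr p) (k := N - 1)
    (x := fun j => dir p (j + 1)) (by omega) l
    (fun j hj => (dir_rootSeq hp hN).1.lt (Nat.lt_succ_self j) hj)
    (fun j hj => discr_sign_at_dir hp hN hj)
  exact ⟨y, fun j hj => h1 j (by omega), h2⟩

end Dirichlet

/-! ### The characteristic polynomial of the periodic Jacobi matrix -/

section Cyclic

/-- The periodic Jacobi matrix of size `m` with diagonal `b 1, …, b m` and off-diagonal entries
`a 1, …, a m`. -/
def cyclicJacobi (m : ℕ) (a b : ℕ → ℝ) : Matrix (Fin m) (Fin m) ℝ :=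
  fun i j =>
    if i = j then b (i.val + 1)
    else if (i.val + 1) % m = j.val then a (i.val + 1)
    else if (j.val + 1) % m = i.val then a (j.val + 1)
    else 0

/-- The unimodular matrix whose first two columns are the fundamental solutions `Y₁`, `Y₂` on one
period; the other columns are unit vectors. -/
noncomputable def solMatrix (m : ℕ) (Y₁ Y₂ : ℕ → ℝ[X]) : Matrix (Fin m) (Fin m) ℝ[X] :=
  fun j c => if c.val = 0 then Y₁ j.val else if c.val = 1 then Y₂ j.val else if j = c then 1 else 0

lemma det_solMatrix {m : ℕ} {Y₁ Y₂ : ℕ → ℝ[X]} (h10 : Y₁ 0 = 1) (h20 : Y₂ 0 = 0)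
    (h21 : Y₂ 1 = 1) : (solMatrix m Y₁ Y₂).det = 1 := by
  rw [Matrix.det_of_isLowerTriangular]
  · apply Finset.prod_eq_one
    intro i _
    unfold solMatrix
    split_ifs with h h'
    · rw [h, h10]
    · rw [h', h21]
    · rfl
    · contradiction
  · intro i j hij
    have hij : i < j := hij
    have hv : i.val < j.val := hij
    unfold solMatrix
    rw [if_neg (by omega)]
    split_ifs with h' h''
    · rw [show i.val = 0 by omega, h20]
    · exact absurd h'' hij.ne
    · rfl

variable {m : ℕ} [NeZero m]

lemma val_add_one_eq (i : Fin m) (hm : 2 ≤ m) : (i + 1).val = (i.val + 1) % m := by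
  rw [Fin.val_add]
  congr 2
  have : NeZero m := inferInstance
  rw [Fin.val_one']
  exact Nat.mod_eq_of_lt hm

lemma val_sub_one_eq (i : Fin m) (hm : 2 ≤ m) : (i - 1).val = (i.val + (m - 1)) % m := by
  rw [Fin.val_sub, Fin.val_one', Nat.mod_eq_of_lt (show 1 < m by omega), add_comm]

/-- The characteristic matrix as a three-term operator with cyclic indices; for `m ≥ 3` the two
neighbours of an index are distinct. -/
lemma charmatrix_cyclicJacobi_mulVec (hm : 3 ≤ m) {a b : ℕ → ℝ} (ha : a 0 = a m)
    (w : Fin m → ℝ[X]) (r : Fin m) :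
    ((cyclicJacobi m a b).charmatrix.mulVec w) r =
      (X - C (b (r.val + 1))) * w r - C (a (r.val + 1)) * w (r + 1) - C (a r.val) * w (r - 1) := by
  have e : ∀ j : Fin m, (cyclicJacobi m a b).charmatrix r j =
      (if j = r then X - C (b (r.val + 1)) else 0) + (if j = r + 1 then -C (a (r.val + 1)) else 0)
        + (if j = r - 1 then -C (a r.val) else 0) := by
    intro j
    have hr := r.isLt
    have hj := j.isLt
    have hs := val_add_one_eq r (by omega)
    have hs' := val_sub_one_eq r (by omega)
    have c1 : (j = r + 1) ↔ ((r.val + 1) % m = j.val) := by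
      rw [Fin.ext_iff, hs, eq_comm]
    have c2 : (j = r - 1) ↔ ((j.val + 1) % m = r.val) := by
      rw [eq_sub_iff_add_eq, Fin.ext_iff, val_add_one_eq j (by omega)]
    by_cases h0 : r = j
    · subst h0
      have n1 : ¬ (r = r + 1) := by
        rw [c1]; intro h
        rcases Nat.lt_or_ge (r.val + 1) m with h' | h'
        · rw [Nat.mod_eq_of_lt h'] at h; omega
        · rw [show r.val + 1 = m by omega, Nat.mod_self] at h; omega
      have n2 : ¬ (r = r - 1) := by
        rw [c2, ← c1]; exact n1
      rw [Matrix.charmatrix_apply_eq]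
      simp [n1, n2, cyclicJacobi]
    · rw [Matrix.charmatrix_apply_ne _ _ _ h0]
      have h0' : ¬ j = r := fun h => h0 h.symm
      simp only [h0', if_false, c1, c2, cyclicJacobi, h0]
      split_ifs with h1 h2 h3
      · exfalso
        rcases Nat.lt_or_ge (r.val + 1) m with h' | h'
        · rw [Nat.mod_eq_of_lt h'] at h1
          rcases Nat.lt_or_ge (j.val + 1) m with h'' | h''
          · rw [Nat.mod_eq_of_lt h''] at h2; omega
          · rw [show j.val + 1 = m by omega, Nat.mod_self] at h2; omega
        · rw [show r.val + 1 = m by omega, Nat.mod_self] at h1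
          rw [Nat.mod_eq_of_lt (by omega)] at h2; omega
      · simp
      · rcases Nat.lt_or_ge (j.val + 1) m with h'' | h''
        · rw [Nat.mod_eq_of_lt h''] at h3; rw [h3]; simp
        · rw [show j.val + 1 = m by omega, Nat.mod_self] at h3
          rw [show j.val + 1 = m by omega, ← h3, ha]; simp
      · simp
  simp only [Matrix.mulVec, dotProduct, e, add_mul, Finset.sum_add_distrib, ite_mul, zero_mul,
    Finset.sum_ite_eq', Finset.mem_univ, if_true]
  ring

/-- The equations of the difference equation, applied to the columns of `solMatrix`.  Row `i` is the
equation with last unknown `y i` (indices modulo `m`), so that the matrix is block triangular. -/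
noncomputable def systemMatrix (m : ℕ) [NeZero m] (a b : ℕ → ℝ) (Y₁ Y₂ : ℕ → ℝ[X]) :
    Matrix (Fin m) (Fin m) ℝ[X] :=
  fun i c => (X - C (b ((i - 1 - 1).val + 1))) * solMatrix m Y₁ Y₂ (i - 1) c
      - C (a ((i - 1 - 1).val + 1)) * solMatrix m Y₁ Y₂ i c
      - C (a (i - 1 - 1).val) * solMatrix m Y₁ Y₂ (i - 1 - 1) c

section

variable {k : ℕ} {a b : ℕ → ℝ} {Y₁ Y₂ : ℕ → ℝ[X]}

/-- `systemMatrix` is the characteristic matrix times the unimodular `solMatrix`, up to three cyclic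
permutations of rows, each of sign `(-1) ^ (k + 1)`. -/
lemma det_systemMatrix (hk : 1 ≤ k) (ha : a 0 = a (k + 2)) (h10 : Y₁ 0 = 1) (h20 : Y₂ 0 = 0)
    (h21 : Y₂ 1 = 1) :
    (systemMatrix (k + 2) a b Y₁ Y₂).det =
      (cyclicJacobi (k + 2) a b).charpoly * (-1) ^ (k + 1) := by
  set V := solMatrix (k + 2) Y₁ Y₂ with hV
  set σ : Equiv.Perm (Fin (k + 2)) := finRotate (k + 2) with hσ
  have hσ1 : ∀ i, σ i = i + 1 := fun i => finRotate_apply i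
  have hσ2 : ∀ i, σ.symm i = i - 1 := fun i => by
    rw [Equiv.symm_apply_eq, hσ1, sub_add_cancel]
  have hsign : (Equiv.Perm.sign σ : ℤ) = (-1) ^ (k + 1) := by
    rw [hσ, sign_finRotate]; simp
  have e1 : systemMatrix (k + 2) a b Y₁ Y₂ =
      (((cyclicJacobi (k + 2) a b).charmatrix * V.submatrix σ id).submatrix
        σ.symm id).submatrix σ.symm id := by
    ext1 i c
    have := charmatrix_cyclicJacobi_mulVec (m := k + 2) (by omega) (b := b) ha
      (fun j => V (j + 1) c) (i - 1 - 1)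
    simp only [sub_add_cancel] at this
    rw [systemMatrix, ← hV, ← this, Matrix.submatrix_apply, Matrix.submatrix_apply,
      Matrix.mul_apply]
    simp only [Matrix.submatrix_apply, hσ1, hσ2, id, Matrix.mulVec, dotProduct]
  rw [e1, Matrix.det_permute, Matrix.det_permute, Matrix.det_mul, Matrix.det_permute,
    det_solMatrix h10 h20 h21, Equiv.Perm.sign_symm, Matrix.charpoly]
  have hc : ((Equiv.Perm.sign σ : ℤ) : ℝ[X]) = (-1) ^ (k + 1) := by rw [hsign]; simp
  rw [hc, ← mul_assoc, ← mul_pow]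
  simp

lemma fin_sub_one_val (i : Fin (k + 2)) :
    (i - 1).val = if i.val = 0 then k + 1 else i.val - 1 := by
  rw [val_sub_one_eq i (by omega)]
  split_ifs with h
  · rw [h, zero_add, show k + 2 - 1 = k + 1 by omega]
    exact Nat.mod_eq_of_lt (by omega)
  · have := i.isLt
    rw [show i.val + (k + 2 - 1) = i.val - 1 + (k + 2) by omega, Nat.add_mod_right]
    exact Nat.mod_eq_of_lt (by omega)

lemma fin_sub_val {i : Fin (k + 2)} (hi : ¬ i.val < 2) :
    (i - 1).val = i.val - 1 ∧ (i - 1 - 1).val = i.val - 2 := by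
  have h1 : (i - 1).val = i.val - 1 := by rw [fin_sub_one_val, if_neg (by omega)]
  refine ⟨h1, ?_⟩
  rw [fin_sub_one_val, h1, if_neg (by omega)]; omega

/-- The fundamental solutions satisfy the equations that stay inside one period. -/
lemma systemMatrix_left
    (hr1 : ∀ j, C (a (j + 1)) * Y₁ (j + 2) = (X - C (b (j + 1))) * Y₁ (j + 1) - C (a j) * Y₁ j)
    (hr2 : ∀ j, C (a (j + 1)) * Y₂ (j + 2) = (X - C (b (j + 1))) * Y₂ (j + 1) - C (a j) * Y₂ j)
    (i : Fin (k + 2)) (hi : ¬ i.val < 2) (j : Fin (k + 2)) (hj : j.val < 2) :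
    systemMatrix (k + 2) a b Y₁ Y₂ i j = 0 := by
  obtain ⟨h1, h2⟩ := fin_sub_val hi
  unfold systemMatrix solMatrix
  rw [h1, h2]
  obtain ⟨l, hl⟩ : ∃ l, i.val = l + 2 := ⟨i.val - 2, by omega⟩
  rw [hl]
  rcases (show j.val = 0 ∨ j.val = 1 by omega) with h | h <;> simp only [h]
  · have := hr1 l
    simp only [if_true, Nat.add_sub_cancel, show l + 2 - 1 = l + 1 by omega]
    rw [this]; ring
  · have := hr2 l
    simp only [if_true, one_ne_zero, if_false, Nat.add_sub_cancel, show l + 2 - 1 = l + 1 by omega]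
    rw [this]; ring

lemma systemMatrix_right (i c : Fin (k + 2)) (hi : ¬ i.val < 2) (hc : ¬ c.val < 2)
    (hic : i.val ≤ c.val) :
    systemMatrix (k + 2) a b Y₁ Y₂ i c = if i = c then -C (a (i.val - 1)) else 0 := by
  obtain ⟨h1, h2⟩ := fin_sub_val hi
  have hw : ∀ j, solMatrix (k + 2) Y₁ Y₂ j c = if j = c then 1 else 0 := by
    intro j; unfold solMatrix; rw [if_neg (by omega), if_neg (by omega)]
  have n1 : ¬ i - 1 = c := by intro h; rw [← h, h1] at hic; omega
  have n2 : ¬ i - 1 - 1 = c := by intro h; rw [← h, h2] at hic; omega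
  rw [systemMatrix, hw, hw, hw, h2, if_neg n1, if_neg n2,
    show i.val - 2 + 1 = i.val - 1 by omega]
  split_ifs <;> simp

/-- The block of the two equations that close up the period has the determinant of `M - 1`, where
`M` is the monodromy matrix, as its essential factor. -/
lemma det_systemMatrix_top (h10 : Y₁ 0 = 1) (h11 : Y₁ 1 = 0) (h20 : Y₂ 0 = 0) (h21 : Y₂ 1 = 1)
    (hr1 : ∀ j, C (a (j + 1)) * Y₁ (j + 2) = (X - C (b (j + 1))) * Y₁ (j + 1) - C (a j) * Y₁ j)
    (hr2 : ∀ j, C (a (j + 1)) * Y₂ (j + 2) = (X - C (b (j + 1))) * Y₂ (j + 1) - C (a j) * Y₂ j) :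
    ((systemMatrix (k + 2) a b Y₁ Y₂).toSquareBlockProp fun i => i.val < 2).det =
      C (a (k + 1)) * C (a (k + 2)) * ((Y₁ (k + 2) - 1) * (Y₂ (k + 3) - 1)
        - Y₂ (k + 2) * Y₁ (k + 3)) := by
  let e : Fin 2 ≃ {i : Fin (k + 2) // i.val < 2} :=
    { toFun := fun i => ⟨⟨i.val, by omega⟩, i.isLt⟩
      invFun := fun i => ⟨i.val.val, i.2⟩
      left_inv := fun i => rfl
      right_inv := fun i => rfl }
  rw [← Matrix.det_submatrix_equiv_self e, Matrix.det_fin_two]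
  simp only [Matrix.submatrix_apply, Matrix.toSquareBlockProp_def, Matrix.of_apply]
  have z1 : ((e 0 : {i : Fin (k + 2) // i.val < 2}) : Fin (k + 2)).val = 0 := rfl
  have o1 : ((e 1 : {i : Fin (k + 2) // i.val < 2}) : Fin (k + 2)).val = 1 := rfl
  generalize ((e 0 : {i : Fin (k + 2) // i.val < 2}) : Fin (k + 2)) = i0 at *
  generalize ((e 1 : {i : Fin (k + 2) // i.val < 2}) : Fin (k + 2)) = i1 at *
  have a1 : (i0 - 1).val = k + 1 := by rw [fin_sub_one_val, if_pos z1]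
  have a2 : (i0 - 1 - 1).val = k := by rw [fin_sub_one_val, a1, if_neg (by omega)]; omega
  have c1 : (i1 - 1).val = 0 := by rw [fin_sub_one_val, o1]; simp
  have c2 : (i1 - 1 - 1).val = k + 1 := by rw [fin_sub_one_val, if_pos c1]
  simp only [systemMatrix, solMatrix, a1, a2, c1, c2, z1, o1, if_true, one_ne_zero, if_false, h10,
    h11, h20, h21]
  have e1 := hr1 k
  have e2 := hr2 k
  have e3 := hr1 (k + 1)
  have e4 := hr2 (k + 1)
  have f1 : (X - C (b (k + 1))) * Y₁ (k + 1) - C (a (k + 1)) * 1 - C (a k) * Y₁ k =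
    C (a (k + 1)) * (Y₁ (k + 2) - 1) := by linear_combination -e1
  have f2 : (X - C (b (k + 1))) * Y₂ (k + 1) - C (a (k + 1)) * 0 - C (a k) * Y₂ k =
    C (a (k + 1)) * Y₂ (k + 2) := by linear_combination -e2
  have f3 : (X - C (b (k + 1 + 1))) * 1 - C (a (k + 1 + 1)) * 0 - C (a (k + 1)) * Y₁ (k + 1) =
    (X - C (b (k + 2))) * (1 - Y₁ (k + 2)) + C (a (k + 2)) * Y₁ (k + 3) := by
    linear_combination -e3
  have f4 : (X - C (b (k + 1 + 1))) * 0 - C (a (k + 1 + 1)) * 1 - C (a (k + 1)) * Y₂ (k + 1) =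
    (X - C (b (k + 2))) * (0 - Y₂ (k + 2)) + C (a (k + 2)) * (Y₂ (k + 3) - 1) := by
    linear_combination -e4
  rw [f1, f2, f3, f4]
  ring

lemma det_systemMatrix_bottom :
    ((systemMatrix (k + 2) a b Y₁ Y₂).toSquareBlockProp fun i => ¬ i.val < 2).det =
      ∏ j ∈ Finset.range k, (-C (a (j + 1))) := by
  rw [Matrix.det_of_isLowerTriangular]
  · have e1 : ∀ i : {i : Fin (k + 2) // ¬ i.val < 2},
        (systemMatrix (k + 2) a b Y₁ Y₂).toSquareBlockProp (fun i => ¬ i.val < 2) i i =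
          -C (a (i.val.val - 1)) := by
      intro i
      rw [Matrix.toSquareBlockProp_def, Matrix.of_apply, systemMatrix_right _ _ i.2 i.2 le_rfl,
        if_pos rfl]
    rw [Finset.prod_congr rfl fun i _ => e1 i]
    rw [← Finset.prod_subtype (Finset.univ.filter fun i : Fin (k + 2) => ¬ i.val < 2)
      (by simp) (fun i : Fin (k + 2) => -C (a (i.val - 1))), Finset.prod_filter,
      Fin.prod_univ_succ, Fin.prod_univ_succ, Finset.prod_range]
    simp
  · intro i j hij
    have hij : i < j := hij
    have hv : i.val < j.val := hij
    rw [Matrix.toSquareBlockProp_def, Matrix.of_apply, systemMatrix_right _ _ i.2 j.2 hv.le,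
      if_neg hv.ne]

/-- The characteristic polynomial of a periodic Jacobi matrix in terms of the fundamental
solutions after one period. -/
lemma charpoly_cyclicJacobi (hk : 1 ≤ k) (ha : a 0 = a (k + 2))
    (h10 : Y₁ 0 = 1) (h11 : Y₁ 1 = 0) (h20 : Y₂ 0 = 0) (h21 : Y₂ 1 = 1)
    (hr1 : ∀ j, C (a (j + 1)) * Y₁ (j + 2) = (X - C (b (j + 1))) * Y₁ (j + 1) - C (a j) * Y₁ j)
    (hr2 : ∀ j, C (a (j + 1)) * Y₂ (j + 2) = (X - C (b (j + 1))) * Y₂ (j + 1) - C (a j) * Y₂ j) :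
    (cyclicJacobi (k + 2) a b).charpoly * (-1) ^ (k + 1) =
      C (a (k + 1)) * C (a (k + 2)) * ((Y₁ (k + 2) - 1) * (Y₂ (k + 3) - 1)
        - Y₂ (k + 2) * Y₁ (k + 3)) * ∏ j ∈ Finset.range k, (-C (a (j + 1))) := by
  -- The first two columns solve all equations but the two that close up the period.
  rw [← det_systemMatrix hk ha h10 h20 h21,
    Matrix.twoBlockTriangular_det _ (fun i => i.val < 2) (systemMatrix_left hr1 hr2),
    det_systemMatrix_top h10 h11 h20 h21 hr1 hr2, det_systemMatrix_bottom]

end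

end Cyclic

section CharpolyQ

variable {N : ℕ} [NeZero N] {p : Phase N}

lemma Q_eq_cyclicJacobi (p : Phase N) : Q p = cyclicJacobi (2 * N) (aSeq p) (bSeq p) := rfl

/-- `det (M² - 1) = det (M - 1) det (M + 1) = (2 - Δ) (2 + Δ)` for the monodromy matrix `M`. -/
lemma det_monodromy_sq_sub_one (hp : p ∈ phaseSpace N) :
    (y₁ p (2 * N) - 1) * (y₂ p (2 * N + 1) - 1) - y₂ p (2 * N) * y₁ p (2 * N + 1) =
      4 - discr p ^ 2 := by
  have h1 := solPoly_add_period hp 1 0 N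
  have h2 := solPoly_add_period hp 0 1 N
  have h3 := solPoly_add_period hp 1 0 (N + 1)
  have h4 := solPoly_add_period hp 0 1 (N + 1)
  rw [show N + 1 + N = 2 * N + 1 by ring] at h3 h4
  rw [← two_mul] at h1 h2
  have hd := monodromy_det hp
  unfold discr
  change y₁ p (2 * N) = y₁ p N * y₁ p N + y₁ p (N + 1) * y₂ p N at h1
  change y₂ p (2 * N) = y₂ p N * y₁ p N + y₂ p (N + 1) * y₂ p N at h2
  change y₁ p (2 * N + 1) = y₁ p N * y₁ p (N + 1) + y₁ p (N + 1) * y₂ p (N + 1) at h3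
  change y₂ p (2 * N + 1) = y₂ p N * y₁ p (N + 1) + y₂ p (N + 1) * y₂ p (N + 1) at h4
  rw [h1, h2, h3, h4]
  generalize y₁ p N = A at *
  generalize y₂ p (N + 1) = D at *
  generalize y₁ p (N + 1) = G at *
  generalize y₂ p N = B at *
  linear_combination (A * D - G * B + 3) * hd

/-- The eigenvalues of `Q` are the zeros of `Δ² - 4`. -/
lemma charpoly_Q (hp : p ∈ phaseSpace N) (hN : 2 ≤ N) :
    (Q p).charpoly = C ((∏ j, p.2 j) ^ 2) * (discr p ^ 2 - 4) := by
  obtain ⟨k, hk⟩ : ∃ k, 2 * N = k + 2 := ⟨2 * N - 2, by omega⟩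
  have hper : ∀ j, aSeq p (j + 2 * N) = aSeq p j := fun j => by
    rw [show j + 2 * N = j + N + N by ring, aSeq_add, aSeq_add]
  have h := charpoly_cyclicJacobi (k := k) (by omega) (a := aSeq p) (b := bSeq p)
    (by rw [← hk]; simpa using (hper 0).symm)
    (Y₁ := y₁ p) (Y₂ := y₂ p) (by simp [y₁, solPoly]) (by simp [y₁, solPoly])
    (by simp [y₂, solPoly]) (by simp [y₂, solPoly]) (fun j => solPoly_rec hp 1 0 j)
    (fun j => solPoly_rec hp 0 1 j)
  have hodd : (-1 : ℝ[X]) ^ (k + 1) = -1 := Odd.neg_one_pow (by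
    rw [show k + 1 = 2 * N - 1 by omega]; exact ⟨N - 1, by omega⟩)
  have heven : ∏ j ∈ Finset.range k, (-C (aSeq p (j + 1))) =
      ∏ j ∈ Finset.range k, C (aSeq p (j + 1)) := by
    rw [Finset.prod_neg, Even.neg_one_pow (by simp; rw [show k = 2 * (N - 1) by omega]; simp),
      one_mul]
  have hprod : C (aSeq p (k + 1)) * C (aSeq p (k + 2)) * ∏ j ∈ Finset.range k, C (aSeq p (j + 1))
      = C ((∏ j, p.2 j) ^ 2) := by
    have e1 : ∏ j ∈ Finset.range (2 * N), aSeq p (j + 1) = (∏ j, p.2 j) ^ 2 := by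
      rw [two_mul, Finset.prod_range_add, ← prod_aSeq, sq]
      congr 1
      exact Finset.prod_congr rfl fun j _ => by
        rw [show N + j + 1 = j + 1 + N by ring, aSeq_add]
    rw [← e1, hk, Finset.prod_range_succ, Finset.prod_range_succ]
    simp only [C_mul, map_prod]
    ring
  have hM := det_monodromy_sq_sub_one hp
  have hQ : (cyclicJacobi (k + 2) (aSeq p) (bSeq p)).charpoly = (Q p).charpoly := by
    rw [Q_eq_cyclicJacobi]
    exact congrArg (fun m => (cyclicJacobi m (aSeq p) (bSeq p)).charpoly) hk.symm
  rw [hQ, hodd, heven] at h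
  rw [hk, show k + 2 + 1 = k + 3 from rfl] at hM
  rw [← hprod]
  linear_combination -h - (C (aSeq p (k + 1)) * C (aSeq p (k + 2)) *
    ∏ j ∈ Finset.range k, C (aSeq p (j + 1))) * hM

end CharpolyQ

/-! ### The periodic eigenvalues -/

section Lam

variable {N : ℕ} [NeZero N]

lemma Q_isHermitian (p : Phase N) (hN : 2 ≤ N) : (Q p).IsHermitian := by
  ext i j
  rw [Matrix.conjTranspose_apply, star_trivial]
  unfold Q
  have hi := i.isLt
  have hj := j.isLt
  by_cases h : i = j
  · subst h; simp
  · have h' : ¬ j = i := fun e => h e.symm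
    simp only [h, h', if_false]
    split_ifs with h1 h2
    · exfalso
      rcases Nat.lt_or_ge (j.val + 1) (2 * N) with h3 | h3
      · rw [Nat.mod_eq_of_lt h3] at h1
        rcases Nat.lt_or_ge (i.val + 1) (2 * N) with h4 | h4
        · rw [Nat.mod_eq_of_lt h4] at h2; omega
        · rw [show i.val + 1 = 2 * N by omega, Nat.mod_self] at h2; omega
      · rw [show j.val + 1 = 2 * N by omega, Nat.mod_self] at h1
        rw [Nat.mod_eq_of_lt (by omega)] at h2; omega
    all_goals rfl

lemma card_roots_charpoly_Q (p : Phase N) (hN : 2 ≤ N) :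
    (Q p).charpoly.roots.card = 2 * N := by
  rw [splits_iff_card_roots.1 (Q_isHermitian p hN).splits_charpoly, Matrix.charpoly_natDegree_eq_dim,
    Fintype.card_fin]

lemma lam_mono (p : Phase N) (hN : 2 ≤ N) {i j : ℕ} (h1 : 1 ≤ i) (hij : i ≤ j)
    (hj : j ≤ 2 * N) : lam p i ≤ lam p j :=
  orderedRoot_mono _ h1 hij (by rw [card_roots_charpoly_Q p hN]; exact hj)

lemma roots_charpoly_Q (p : Phase N) (hN : 2 ≤ N) :
    (Q p).charpoly.roots = (Multiset.range (2 * N)).map fun i => lam p (i + 1) := by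
  conv_lhs => rw [roots_eq_map_orderedRoot, card_roots_charpoly_Q p hN]
  rfl

lemma charpoly_Q_eq_prod (p : Phase N) (hN : 2 ≤ N) :
    (Q p).charpoly = ∏ i ∈ Finset.range (2 * N), (X - C (lam p (i + 1))) := by
  rw [(Q_isHermitian p hN).splits_charpoly.eq_prod_roots_of_monic (Matrix.charpoly_monic _),
    roots_charpoly_Q p hN, Multiset.map_map]
  rfl

lemma discr_sq_eq_prod {p : Phase N} (hp : p ∈ phaseSpace N) (hN : 2 ≤ N) (x : ℝ) :
    (discr p).eval x ^ 2 - 4 =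
      ((∏ j, p.2 j) ^ 2)⁻¹ * ∏ i ∈ Finset.range (2 * N), (x - lam p (i + 1)) := by
  have h := congrArg (eval x) (charpoly_Q hp hN)
  rw [charpoly_Q_eq_prod p hN, eval_prod] at h
  simp only [eval_sub, eval_X, eval_C, eval_mul, eval_pow, eval_ofNat] at h
  have hne : (∏ j, p.2 j) ^ 2 ≠ 0 := pow_ne_zero _ (Finset.prod_pos fun j _ => hp j).ne'
  rw [h, ← mul_assoc, inv_mul_cancel₀ hne, one_mul]

lemma continuous_Q : Continuous (Q : Phase N → Matrix (Fin (2 * N)) (Fin (2 * N)) ℝ) := by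
  refine continuous_matrix fun i j => ?_
  unfold Q
  split_ifs
  · exact bSeq_continuous _
  · exact aSeq_continuous _
  · exact aSeq_continuous _
  · exact continuous_const

lemma continuous_charpoly_Q_eval (x : ℝ) : Continuous fun p : Phase N => (Q p).charpoly.eval x := by
  simp only [Matrix.eval_charpoly]
  exact (continuous_const.sub continuous_Q).matrix_det

/-- `|λ_j| ≤ |λ_j - i| ≤ ∏ |λ_k - i|`, which bounds the eigenvalues by a continuous function. -/
lemma abs_lam_le (p : Phase N) (hN : 2 ≤ N) {i : ℕ} (hi : i < 2 * N) :
    |lam p (i + 1)| ≤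
      ‖(Matrix.scalar (Fin (2 * N)) Complex.I - (Q p).map Complex.ofRealHom).det‖ := by
  rw [← Matrix.eval_charpoly, Matrix.charpoly_map, charpoly_Q_eq_prod p hN, Polynomial.map_prod,
    eval_prod, norm_prod]
  simp only [Polynomial.map_sub, map_X, map_C, eval_sub, eval_X, eval_C]
  have h1 : ∀ t : ℝ, 1 ≤ ‖Complex.I - Complex.ofRealHom t‖ := fun t => by
    have := Complex.abs_im_le_norm (Complex.I - Complex.ofRealHom t)
    simpa using this
  have h2 : ∀ t : ℝ, |t| ≤ ‖Complex.I - Complex.ofRealHom t‖ := fun t => by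
    have := Complex.abs_re_le_norm (Complex.I - Complex.ofRealHom t)
    simpa using this
  rw [← Finset.mul_prod_erase _ _ (Finset.mem_range.2 hi)]
  refine (h2 _).trans (le_mul_of_one_le_right (norm_nonneg _) ?_)
  exact Finset.one_le_prod fun j _ => h1 _

/-- The ordered eigenvalues depend continuously on the matrix: any limit point of them is the
ordered list of zeros of the limit of the characteristic polynomials. -/
lemma continuous_lam (hN : 2 ≤ N) {j : ℕ} (h1 : 1 ≤ j) (h2 : j ≤ 2 * N) :
    Continuous fun p : Phase N => lam p j := by
  rw [continuous_iff_continuousAt]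
  intro p
  rw [ContinuousAt, Filter.tendsto_iff_ultrafilter]
  intro U hU
  set B : Phase N → ℝ := fun q =>
    ‖(Matrix.scalar (Fin (2 * N)) Complex.I - (Q q).map Complex.ofRealHom).det‖ with hB
  have hBc : Continuous B := by
    refine (Continuous.matrix_det (continuous_const.sub ?_)).norm
    exact continuous_Q.matrix_map Complex.continuous_ofReal
  -- Along an ultrafilter each bounded eigenvalue has a limit.
  have hBU : ∀ᶠ q in (U : Filter (Phase N)), B q ≤ B p + 1 :=
    hU ((hBc.tendsto p).eventually (Iic_mem_nhds (lt_add_one _)))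
  have hlim : ∀ i, ∃ r, i < 2 * N → Filter.Tendsto (fun q : Phase N => lam q (i + 1)) U (nhds r) := by
    intro i
    by_cases hi : i < 2 * N
    · have hmem : ∀ᶠ q in (U : Filter (Phase N)),
          lam q (i + 1) ∈ Set.Icc (-(B p + 1)) (B p + 1) := by
        filter_upwards [hBU] with q hq
        exact abs_le.1 ((abs_lam_le q hN hi).trans hq)
      obtain ⟨r, -, hr⟩ := (isCompact_Icc (a := -(B p + 1)) (b := B p + 1)).ultrafilter_le_nhds'
        (U.map fun q => lam q (i + 1)) hmem
      exact ⟨r, fun _ => hr⟩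
    · exact ⟨0, fun h => absurd h hi⟩
  choose r hr using hlim
  -- The limits are the zeros of the characteristic polynomial at `p`, and they are still ordered.
  have hpoly : (Q p).charpoly = ∏ i ∈ Finset.range (2 * N), (X - C (r i)) := by
    apply Polynomial.funext
    intro x
    have t1 : Filter.Tendsto (fun q : Phase N => (Q q).charpoly.eval x) U
        (nhds ((Q p).charpoly.eval x)) :=
      ((continuous_charpoly_Q_eval x).tendsto p).mono_left hU
    have t2 : Filter.Tendsto (fun q : Phase N => (Q q).charpoly.eval x) U
        (nhds (∏ i ∈ Finset.range (2 * N), (x - r i))) := by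
      simp only [charpoly_Q_eq_prod _ hN, eval_prod, eval_sub, eval_X, eval_C]
      exact tendsto_finsetProd _ fun i hi =>
        tendsto_const_nhds.sub (hr i (Finset.mem_range.1 hi))
    rw [tendsto_nhds_unique t1 t2, eval_prod]
    simp
  have hroots : (Q p).charpoly.roots = (Multiset.range (2 * N)).map r := by
    rw [hpoly, roots_prod _ _ (Finset.prod_ne_zero_iff.2 fun i _ => X_sub_C_ne_zero _)]
    simp only [roots_X_sub_C, Finset.range_val]
    exact Multiset.bind_singleton _ _
  have hmono : ∀ i k, i < k → k < 2 * N → r i ≤ r k := fun i k hik hk =>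
    le_of_tendsto_of_tendsto (hr i (by omega)) (hr k hk)
      (Filter.Eventually.of_forall fun q => lam_mono q hN (by omega) (by omega) (by omega))
  have hj : lam p j = r (j - 1) := orderedRoot_of_roots hroots hmono h1 h2
  rw [hj]
  have := hr (j - 1) (by omega)
  rwa [Nat.sub_add_cancel h1] at this

/-- The number of eigenvalues above `x`. -/
noncomputable def countAbove (p : Phase N) (x : ℝ) : ℕ :=
  {i ∈ Finset.range (2 * N) | x < lam p (i + 1)}.card

/-- `x < λ_j` if and only if more than `2 N - j` eigenvalues lie above `x`. -/
lemma lt_lam_iff (p : Phase N) (hN : 2 ≤ N) (x : ℝ) {j : ℕ} (h1 : 1 ≤ j) (h2 : j ≤ 2 * N) :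
    x < lam p j ↔ 2 * N < j + countAbove p x := by
  constructor
  · intro h
    have hsub : Finset.Ico (j - 1) (2 * N) ⊆ {i ∈ Finset.range (2 * N) | x < lam p (i + 1)} := by
      intro i hi
      rw [Finset.mem_Ico] at hi
      rw [Finset.mem_filter, Finset.mem_range]
      exact ⟨hi.2, h.trans_le (lam_mono p hN h1 (by omega) (by omega))⟩
    have := Finset.card_le_card hsub
    rw [Nat.card_Ico] at this
    unfold countAbove
    omega
  · intro h
    by_contra hx
    rw [not_lt] at hx
    have hsub : {i ∈ Finset.range (2 * N) | x < lam p (i + 1)} ⊆ Finset.Ico j (2 * N) := by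
      intro i hi
      rw [Finset.mem_filter, Finset.mem_range] at hi
      rw [Finset.mem_Ico]
      refine ⟨?_, hi.1⟩
      by_contra hij
      exact absurd (hi.2.trans_le ((lam_mono p hN (by omega) (by omega) h2).trans hx)) (lt_irrefl _)
    have := Finset.card_le_card hsub
    rw [Nat.card_Ico] at this
    unfold countAbove at h
    omega

lemma countAbove_le (p : Phase N) (x : ℝ) : countAbove p x ≤ 2 * N := by
  refine (Finset.card_filter_le _ _).trans ?_
  simp

lemma countAbove_anti (p : Phase N) {x y : ℝ} (h : x ≤ y) : countAbove p y ≤ countAbove p x :=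
  Finset.card_le_card fun i hi => by
    rw [Finset.mem_filter] at hi ⊢
    exact ⟨hi.1, h.trans_lt hi.2⟩

/-- The sign of `Δ² - 4` is given by the parity of the number of eigenvalues above. -/
lemma sign_discr_sq {p : Phase N} (hp : p ∈ phaseSpace N) (hN : 2 ≤ N) (x : ℝ) :
    0 ≤ (-1) ^ countAbove p x * ((discr p).eval x ^ 2 - 4) := by
  rw [discr_sq_eq_prod hp hN, mul_left_comm]
  refine mul_nonneg (inv_nonneg.2 (sq_nonneg _)) ?_
  rw [← Finset.prod_filter_mul_prod_filter_not (Finset.range (2 * N))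
    (fun i => x < lam p (i + 1)), ← mul_assoc, countAbove, ← Finset.prod_const,
    ← Finset.prod_mul_distrib]
  refine mul_nonneg (Finset.prod_nonneg fun i hi => ?_) (Finset.prod_nonneg fun i hi => ?_)
  · have := (Finset.mem_filter.1 hi).2; linarith
  · have := (Finset.mem_filter.1 hi).2; linarith

lemma discr_sq_eq_zero_iff {p : Phase N} (hp : p ∈ phaseSpace N) (hN : 2 ≤ N) (x : ℝ) :
    (discr p).eval x ^ 2 - 4 = 0 ↔ ∃ j, 1 ≤ j ∧ j ≤ 2 * N ∧ x = lam p j := by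
  have hne : ((∏ j, p.2 j) ^ 2)⁻¹ ≠ 0 :=
    inv_ne_zero (pow_ne_zero _ (Finset.prod_pos fun j _ => hp j).ne')
  rw [discr_sq_eq_prod hp hN, mul_eq_zero, or_iff_right hne, Finset.prod_eq_zero_iff]
  constructor
  · rintro ⟨i, hi, h⟩
    exact ⟨i + 1, by omega, by have := Finset.mem_range.1 hi; omega, sub_eq_zero.1 h⟩
  · rintro ⟨j, h1, h2, h⟩
    exact ⟨j - 1, Finset.mem_range.2 (by omega), by rw [Nat.sub_add_cancel h1, h, sub_self]⟩

/-- The eigenvalues, the zeros `ν` of the discriminant and the Dirichlet eigenvalues are ordered as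
`λ_{2k-1} < ν_k < λ_{2k} ≤ μ_k ≤ λ_{2k+1}`. -/
lemma band_structure {p : Phase N} (hp : p ∈ phaseSpace N) (hN : 2 ≤ N) :
    (∀ k, 1 ≤ k → k ≤ N → lam p (2 * k - 1) < lam p (2 * k)) ∧
      ∀ k, 1 ≤ k → k ≤ N - 1 → lam p (2 * k) ≤ dir p k ∧ dir p k ≤ lam p (2 * k + 1) := by
  obtain ⟨ν, hν0, hν⟩ := discr_zeros hp hN
  have hodd : ∀ x, (discr p).eval x ^ 2 - 4 < 0 → Odd (countAbove p x) := by
    intro x hx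
    by_contra h
    have := sign_discr_sq hp hN x
    rw [(Nat.not_odd_iff_even.1 h).neg_one_pow, one_mul] at this
    linarith
  have hνneg : ∀ k < N, (discr p).eval (ν k) ^ 2 - 4 < 0 := fun k hk => by
    rw [hν0 k hk]; norm_num
  have hμ : ∀ k < N - 1, Odd (countAbove p (dir p (k + 1))) →
      ∃ j, 1 ≤ j ∧ j ≤ 2 * N ∧ dir p (k + 1) = lam p j := by
    intro k hk ho
    rw [← discr_sq_eq_zero_iff hp hN]
    have h1 := sign_discr_sq hp hN (dir p (k + 1))
    have h2 := discr_sq_at_dir hp hN hk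
    have h3 := sq_nonneg (starRoot p (k + 1))
    rw [ho.neg_one_pow] at h1
    linarith
  -- Between two zeros of `Δ` there is a Dirichlet eigenvalue, where `Δ² ≥ 4`; hence at least one
  -- eigenvalue is passed there, and by parity at least two.
  have hstep : ∀ k < N - 1, countAbove p (ν (k + 1)) + 2 ≤ countAbove p (ν k) := by
    intro k hk
    obtain ⟨h1, h2⟩ := hν k hk
    obtain ⟨c1, hc1⟩ := hodd _ (hνneg k (by omega))
    obtain ⟨c2, hc2⟩ := hodd _ (hνneg (k + 1) (by omega))
    have h3 := countAbove_anti p h1.le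
    have h4 := countAbove_anti p h2.le
    have h5 : countAbove p (ν (k + 1)) ≠ countAbove p (ν k) := by
      intro h
      obtain ⟨j, hj1, hj2, hj⟩ := hμ k hk (by
        rw [show countAbove p (dir p (k + 1)) = countAbove p (ν k) by omega]
        exact hodd _ (hνneg k (by omega)))
      have e1 := (lt_lam_iff p hN (ν k) hj1 hj2).1 (by rw [← hj]; exact h1)
      have e2 := (lt_lam_iff p hN (dir p (k + 1)) hj1 hj2).2 (by omega)
      rw [hj] at e2
      exact lt_irrefl _ e2
    omega
  have hle : ∀ k < N, countAbove p (ν k) + 2 * k + 1 ≤ 2 * N := by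
    intro k
    induction k with
    | zero =>
      intro _
      obtain ⟨c, hc⟩ := hodd _ (hνneg 0 (by omega))
      have := countAbove_le p (ν 0)
      omega
    | succ k ih => intro hk; have := hstep k (by omega); have := ih (by omega); omega
  have hge : ∀ i < N, 2 * i + 1 ≤ countAbove p (ν (N - 1 - i)) := by
    intro i
    induction i with
    | zero =>
      intro _
      obtain ⟨c, hc⟩ := hodd _ (hνneg (N - 1 - 0) (by omega))
      omega
    | succ i ih =>
      intro hi
      have := hstep (N - 1 - (i + 1)) (by omega)
      rw [show N - 1 - (i + 1) + 1 = N - 1 - i by omega] at this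
      have := ih (by omega)
      omega
  -- There are only `2 N` eigenvalues, so that exactly two of them are passed each time.
  have heq : ∀ k < N, countAbove p (ν k) + 2 * k + 1 = 2 * N := by
    intro k hk
    have h1 := hle k hk
    have h2 := hge (N - 1 - k) (by omega)
    rw [show N - 1 - (N - 1 - k) = k by omega] at h2
    omega
  have hνl : ∀ k < N, lam p (2 * k + 1) < ν k := by
    intro k hk
    refine lt_of_le_of_ne ?_ ?_
    · rw [← not_lt, lt_lam_iff p hN _ (by omega) (by omega)]
      have := heq k hk
      omega
    · intro h
      have := (discr_sq_eq_zero_iff hp hN (ν k)).2 ⟨2 * k + 1, by omega, by omega, h.symm⟩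
      exact absurd this (hνneg k hk).ne
  have hνr : ∀ k < N, ν k < lam p (2 * k + 2) := by
    intro k hk
    rw [lt_lam_iff p hN _ (by omega) (by omega)]
    have := heq k hk
    omega
  refine ⟨fun k h1 h2 => ?_, fun k h1 h2 => ?_⟩
  · have e1 := hνl (k - 1) (by omega)
    have e2 := hνr (k - 1) (by omega)
    rw [show 2 * (k - 1) + 1 = 2 * k - 1 by omega] at e1
    rw [show 2 * (k - 1) + 2 = 2 * k by omega] at e2
    exact e1.trans e2
  · obtain ⟨i, rfl⟩ : ∃ i, k = i + 1 := ⟨k - 1, by omega⟩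
    obtain ⟨h3, h4⟩ := hν i (by omega)
    have c1 := countAbove_anti p h3.le
    have c2 := countAbove_anti p h4.le
    have q1 := heq i (by omega)
    have q2 := heq (i + 1) (by omega)
    constructor
    · by_contra h
      rw [not_le] at h
      have h' := (lt_lam_iff p hN _ (by omega) (by omega)).1 h
      obtain ⟨j, hj1, hj2, hj⟩ := hμ i (by omega) ⟨N - 1 - i, by omega⟩
      rw [hj] at h h3
      have e1 := (lt_lam_iff p hN _ hj1 hj2).1 h3
      have e2 := lam_mono p hN (i := 2 * (i + 1)) (by omega) (show _ ≤ j by omega) (by omega)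
      exact absurd h (not_lt.2 e2)
    · by_contra h
      rw [not_le] at h
      have h' : countAbove p (dir p (i + 1)) = countAbove p (ν (i + 1)) := by
        have : ¬ dir p (i + 1) < lam p (2 * (i + 1) + 1) := not_lt.2 h.le
        rw [lt_lam_iff p hN _ (by omega) (by omega)] at this
        omega
      obtain ⟨j, hj1, hj2, hj⟩ := hμ i (by omega) (by
        rw [h']; exact hodd _ (hνneg (i + 1) (by omega)))
      rw [hj] at h
      have e0 : ¬ dir p (i + 1) < lam p j := by rw [hj]; exact lt_irrefl _
      rw [lt_lam_iff p hN _ hj1 hj2, h'] at e0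
      have e2 := lam_mono p hN hj1 (show j ≤ 2 * (i + 1) + 1 by omega) (by omega)
      exact absurd h (not_lt.2 e2)

end Lam

/-! ### Contour integrals around a cut -/

section Cut

open Complex

lemma cpow_half_sq (z : ℂ) : (z ^ (1 / 2 : ℂ)) * (z ^ (1 / 2 : ℂ)) = z := by
  rw [← sq, one_div]
  exact Complex.cpow_nat_inv_pow z (n := 2) two_ne_zero

/-- For `z` off the cut `[c, d]` the square roots of `z - c` and `z - d` form an acute angle. -/
lemma norm_sqrt_sub_lt {c d : ℝ} {z : ℂ} (hcd : c ≤ d)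
    (hz : z.im ≠ 0 ∨ z.re < c ∨ d < z.re) :
    ‖(z - c) ^ (1 / 2 : ℂ) - (z - d) ^ (1 / 2 : ℂ)‖ <
      ‖(z - c) ^ (1 / 2 : ℂ) + (z - d) ^ (1 / 2 : ℂ)‖ := by
  set u := (z - c) ^ (1 / 2 : ℂ) with hu
  set v := (z - d) ^ (1 / 2 : ℂ) with hv
  rw [one_div] at hu hv
  have hure : u.re = √((‖z - c‖ + (z - c).re) / 2) := by rw [hu, cpow_inv_two_re]
  have hvre : v.re = √((‖z - d‖ + (z - d).re) / 2) := by rw [hv, cpow_inv_two_re]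
  have him : ∀ t : ℝ, (z - t).im = z.im := fun t => by simp
  have himmul : u.im * v.im = √((‖z - c‖ - (z - c).re) / 2) * √((‖z - d‖ - (z - d).re) / 2) := by
    rcases le_or_gt 0 z.im with h | h
    · rw [hu, hv, cpow_inv_two_im_eq_sqrt (by rwa [him]), cpow_inv_two_im_eq_sqrt (by rwa [him])]
    · rw [hu, hv, cpow_inv_two_im_eq_neg_sqrt (by rwa [him]),
        cpow_inv_two_im_eq_neg_sqrt (by rwa [him]), neg_mul_neg]
  have hpos : 0 < u.re * v.re + u.im * v.im := by
    rw [himmul, hure, hvre]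
    have habs : ∀ t : ℝ, z.im ≠ 0 → |(z - t).re| < ‖z - t‖ := fun t h =>
      abs_re_lt_norm.2 (by rwa [him])
    have hle : ∀ t : ℝ, |(z - t).re| ≤ ‖z - t‖ := fun t => abs_re_le_norm _
    rcases hz with h | h | h
    · have h1 := abs_lt.1 (habs c h)
      have h2 := abs_lt.1 (habs d h)
      have : 0 < √((‖z - c‖ + (z - c).re) / 2) * √((‖z - d‖ + (z - d).re) / 2) :=
        mul_pos (Real.sqrt_pos.2 (by linarith)) (Real.sqrt_pos.2 (by linarith))
      positivity
    · have h1 : (z - c).re < 0 := by simp; linarith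
      have h2 : (z - d).re < 0 := by simp; linarith
      have n1 := norm_nonneg (z - c)
      have n2 := norm_nonneg (z - d)
      have : 0 < √((‖z - c‖ - (z - c).re) / 2) * √((‖z - d‖ - (z - d).re) / 2) :=
        mul_pos (Real.sqrt_pos.2 (by linarith)) (Real.sqrt_pos.2 (by linarith))
      positivity
    · have h1 : 0 < (z - c).re := by simp; linarith
      have h2 : 0 < (z - d).re := by simp; linarith
      have n1 := norm_nonneg (z - c)
      have n2 := norm_nonneg (z - d)
      have : 0 < √((‖z - c‖ + (z - c).re) / 2) * √((‖z - d‖ + (z - d).re) / 2) :=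
        mul_pos (Real.sqrt_pos.2 (by linarith)) (Real.sqrt_pos.2 (by linarith))
      positivity
  have h2 : ‖u - v‖ ^ 2 < ‖u + v‖ ^ 2 := by
    rw [← normSq_eq_norm_sq, ← normSq_eq_norm_sq, normSq_apply, normSq_apply]
    simp only [sub_re, sub_im, add_re, add_im]
    nlinarith
  exact lt_of_pow_lt_pow_left₀ 2 (norm_nonneg _) h2

/-- The normalization of the Poisson kernel, for a complex parameter `κ`. -/
lemma integral_poisson {κ : ℂ} (hκ : ‖κ‖ < 1) :
    ∫ θ in (0 : ℝ)..2 * Real.pi,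
      ((1 - κ ^ 2) / (1 - 2 * κ * Real.cos θ + κ ^ 2) : ℂ) = (2 * Real.pi : ℂ) := by
  have hne : ∀ e : ℂ, ‖e‖ ≤ 1 → 1 - κ * e ≠ 0 := by
    intro e he h
    have h1 : κ * e = 1 := (sub_eq_zero.1 h).symm
    have h2 : ‖κ * e‖ < 1 := by
      rw [norm_mul]
      nlinarith [norm_nonneg κ, norm_nonneg e]
    rw [h1, norm_one] at h2
    exact lt_irrefl _ h2
  set f : ℂ → ℂ := fun e => (1 - κ * e)⁻¹ with hf
  have hdiff : DiffContOnCl ℂ f (Metric.ball 0 |1|) := by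
    rw [abs_one]
    apply DifferentiableOn.diffContOnCl
    rw [closure_ball _ one_ne_zero]
    intro e he
    have he : ‖e‖ ≤ 1 := by simpa using he
    exact ((by fun_prop : DifferentiableAt ℂ (fun e => 1 - κ * e) e).inv
      (hne e he)).differentiableWithinAt
  have h1 : Real.circleAverage f 0 1 = 1 := by
    rw [hdiff.circleAverage]; simp [hf]
  have h2 : Real.circleAverage (fun e => f e⁻¹) 0 1 = 1 := by
    rw [Real.circleAverage_zero_one_congr_inv, h1]
  have hnorm : ∀ θ : ℝ, ‖circleMap 0 1 θ‖ = 1 := fun θ => by simp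
  have hcont : Continuous fun θ : ℝ => f (circleMap 0 1 θ) := by
    refine Continuous.inv₀ (by fun_prop) fun θ => hne _ (hnorm θ).le
  have hcont' : Continuous fun θ : ℝ => f (circleMap 0 1 θ)⁻¹ := by
    have h0 : ∀ θ : ℝ, (circleMap 0 1 θ)⁻¹ = circleMap 0 1 (-θ) := fun θ => by
      rw [circleMap_zero_inv]; simp
    simp only [h0]
    exact hcont.comp continuous_neg
  -- The kernel is `f e + f e⁻¹ - 1` on the unit circle, and both means of `f` are `f 0 = 1`.
  have hpt : ∀ θ : ℝ, (1 - κ ^ 2) / (1 - 2 * κ * Real.cos θ + κ ^ 2) =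
      f (circleMap 0 1 θ) + f (circleMap 0 1 θ)⁻¹ - 1 := by
    intro θ
    set e := circleMap 0 1 θ with he
    have he0 : e ≠ 0 := by rw [← norm_ne_zero_iff, hnorm]; norm_num
    have n1 := hne e (hnorm θ).le
    have n2 := hne e⁻¹ (by rw [norm_inv, hnorm]; norm_num)
    have hc : (2 : ℂ) * Real.cos θ = e + e⁻¹ := by
      rw [he, circleMap_zero_inv, circleMap_zero, circleMap_zero]
      push_cast
      rw [Complex.cos]
      simp
      ring
    have hden : 1 - 2 * κ * Real.cos θ + κ ^ 2 = (1 - κ * e) * (1 - κ * e⁻¹) := by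
      have : e * e⁻¹ = 1 := mul_inv_cancel₀ he0
      linear_combination (-κ) * hc - κ ^ 2 * this
    rw [hden, hf]
    simp only
    rw [div_eq_iff (mul_ne_zero n1 n2)]
    have i1 := inv_mul_cancel₀ n1
    have i2 := inv_mul_cancel₀ n2
    have i3 : e * e⁻¹ = 1 := mul_inv_cancel₀ he0
    linear_combination (-(1 - κ * e⁻¹)) * i1 - (1 - κ * e) * i2 + κ ^ 2 * i3
  have hpi : (2 * Real.pi : ℝ) ≠ 0 := by positivity
  have e1 : ∫ θ in (0 : ℝ)..2 * Real.pi, f (circleMap 0 1 θ) = 2 * Real.pi := by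
    rw [Real.circleAverage_def, inv_smul_eq_iff₀ hpi] at h1
    rw [h1]; simp
  have e2 : ∫ θ in (0 : ℝ)..2 * Real.pi, f (circleMap 0 1 θ)⁻¹ = 2 * Real.pi := by
    rw [Real.circleAverage_def, inv_smul_eq_iff₀ hpi] at h2
    rw [h2]; simp
  have hsum : IntervalIntegrable (fun θ => f (circleMap 0 1 θ) + f (circleMap 0 1 θ)⁻¹)
      MeasureTheory.volume 0 (2 * Real.pi) := (hcont.add hcont').intervalIntegrable _ _
  simp only [hpt]
  rw [intervalIntegral.integral_sub hsum (continuous_const.intervalIntegrable _ _),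
    intervalIntegral.integral_add (hcont.intervalIntegrable _ _) (hcont'.intervalIntegrable _ _),
    e1, e2]
  simp

/-- The Stieltjes transform of the arcsine distribution on `[m - r, m + r]`. -/
lemma integral_stieltjes {m r : ℝ} (hr : 0 ≤ r) {z : ℂ} (hz : r < ‖z - m‖) :
    ∫ θ in (0 : ℝ)..2 * Real.pi, (z - (m + r * Real.cos θ : ℝ))⁻¹ =
      2 * Real.pi * ((z - (m - r : ℝ)) ^ (1 / 2 : ℂ) * (z - (m + r : ℝ)) ^ (1 / 2 : ℂ))⁻¹ := by
  have hz' : z.im ≠ 0 ∨ z.re < m - r ∨ m + r < z.re := by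
    by_contra! h
    obtain ⟨h1, h2, h3⟩ := h
    have : z - m = ((z.re - m : ℝ) : ℂ) := by
      apply Complex.ext <;> simp [h1]
    rw [this, norm_real, Real.norm_eq_abs, lt_abs] at hz
    rcases hz with h | h <;> linarith
  have hlt := norm_sqrt_sub_lt (c := m - r) (d := m + r) (by linarith) hz'
  have hu := cpow_half_sq (z - (m - r : ℝ))
  have hv := cpow_half_sq (z - (m + r : ℝ))
  set u := (z - (m - r : ℝ)) ^ (1 / 2 : ℂ)
  set v := (z - (m + r : ℝ)) ^ (1 / 2 : ℂ)
  push_cast at hu hv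
  have huv : u + v ≠ 0 := by
    rw [← norm_ne_zero_iff]; exact ((norm_nonneg _).trans_lt hlt).ne'
  -- Joukowski's substitution: `z - m = w (1 + κ²) / 2` and `r = w κ` with `w = (u + v)² / 2`.
  set κ := (u - v) / (u + v) with hκ
  have hκ1 : ‖κ‖ < 1 := by
    rw [hκ, norm_div, div_lt_one ((norm_nonneg _).trans_lt hlt)]; exact hlt
  set w := (u + v) ^ 2 / 2 with hw
  have hw0 : w ≠ 0 := div_ne_zero (pow_ne_zero _ huv) two_ne_zero
  have e1 : κ * (u + v) = u - v := div_mul_cancel₀ _ huv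
  have e2 : w * κ = r := by
    rw [hw]
    linear_combination (u + v) / 2 * e1 + hu / 2 - hv / 2
  have e3 : w * (1 + κ ^ 2) / 2 = z - m := by
    rw [hw]
    linear_combination (κ * (u + v) + (u - v)) / 4 * e1 + hu / 2 + hv / 2
  have e4 : w * (1 - κ ^ 2) / 2 = u * v := by
    rw [hw]
    linear_combination -(κ * (u + v) + (u - v)) / 4 * e1
  have hκ2 : 1 - κ ^ 2 ≠ 0 := by
    intro h
    have : ‖κ ^ 2‖ < 1 := by rw [norm_pow]; exact pow_lt_one₀ (norm_nonneg _) hκ1 two_ne_zero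
    rw [← sub_eq_zero.1 h, norm_one] at this
    exact lt_irrefl _ this
  have hpt : ∀ θ : ℝ, (z - (m + r * Real.cos θ : ℝ))⁻¹ =
      (u * v)⁻¹ * ((1 - κ ^ 2) / (1 - 2 * κ * Real.cos θ + κ ^ 2)) := by
    intro θ
    have h1 : z - (m + r * Real.cos θ : ℝ) = w / 2 * (1 - 2 * κ * Real.cos θ + κ ^ 2) := by
      rw [ofReal_add, ofReal_mul, ← e2]
      linear_combination -e3
    rw [h1, ← e4]
    rw [mul_inv, div_eq_mul_inv (1 - κ ^ 2)]
    generalize (1 - 2 * κ * Real.cos θ + κ ^ 2 : ℂ)⁻¹ = D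
    field_simp
  simp only [hpt]
  rw [intervalIntegral.integral_const_mul, integral_poisson hκ1]
  ring

/-- A contour integral around the cut `[m - r, m + r]`, as an average over the cut with respect to
the arcsine distribution.  This includes the case `r = 0`, where it is the residue theorem. -/
lemma circleIntegral_div_sqrt {m r R : ℝ} (hr : 0 ≤ r) (hrR : r < R) {φ : ℂ → ℂ}
    (hφ : DiffContOnCl ℂ φ (Metric.ball (m : ℂ) R)) :
    (∮ z in C((m : ℂ), R), φ z / ((z - (m - r : ℝ)) ^ (1 / 2 : ℂ) * (z - (m + r : ℝ)) ^ (1 / 2 : ℂ)))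
      = I * ∫ θ in (0 : ℝ)..2 * Real.pi, φ (m + r * Real.cos θ : ℝ) := by
  have hR : 0 < R := hr.trans_lt hrR
  have hx : ∀ θ : ℝ, ‖((m + r * Real.cos θ : ℝ) : ℂ) - m‖ ≤ r := by
    intro θ
    rw [ofReal_add, add_sub_cancel_left, norm_real, Real.norm_eq_abs, abs_mul, abs_of_nonneg hr]
    exact mul_le_of_le_one_right hr (Real.abs_cos_le_one θ)
  have hcm : ∀ t : ℝ, ‖circleMap (m : ℂ) R t - m‖ = R := fun t => by
    simp [circleMap, abs_of_pos hR]
  have hpi : (2 * Real.pi : ℂ) ≠ 0 := by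
    simp [Real.pi_ne_zero]
  set F : ℝ → ℝ → ℂ := fun t θ => deriv (circleMap (m : ℂ) R) t *
    ((circleMap (m : ℂ) R t - (m + r * Real.cos θ : ℝ))⁻¹ * φ (circleMap (m : ℂ) R t)) with hF
  have hne : ∀ t θ : ℝ, circleMap (m : ℂ) R t - (m + r * Real.cos θ : ℝ) ≠ 0 := by
    intro t θ h
    have h1 := hcm t
    rw [sub_eq_zero.1 h] at h1
    have := hx θ
    linarith
  have hφc : Continuous fun t : ℝ => φ (circleMap (m : ℂ) R t) := by
    refine hφ.continuousOn.comp_continuous (continuous_circleMap _ _) fun t => ?_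
    rw [closure_ball _ hR.ne', mem_closedBall_iff_norm, hcm]
  have hFc : Continuous F.uncurry := by
    have h1 : Continuous fun q : ℝ × ℝ => deriv (circleMap (m : ℂ) R) q.1 := by
      simp only [deriv_circleMap]
      exact ((continuous_circleMap _ _).comp continuous_fst).mul continuous_const
    have h2 : Continuous fun q : ℝ × ℝ =>
        (circleMap (m : ℂ) R q.1 - (m + r * Real.cos q.2 : ℝ))⁻¹ := by
      refine Continuous.inv₀ ?_ fun q => hne q.1 q.2
      have := (continuous_circleMap (m : ℂ) R).comp (continuous_fst (X := ℝ) (Y := ℝ))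
      exact this.sub (by fun_prop)
    exact h1.mul (h2.mul (hφc.comp continuous_fst))
  have hswap : ∫ t in (0 : ℝ)..2 * Real.pi, ∫ θ in (0 : ℝ)..2 * Real.pi, F t θ =
      ∫ θ in (0 : ℝ)..2 * Real.pi, ∫ t in (0 : ℝ)..2 * Real.pi, F t θ := by
    apply MeasureTheory.intervalIntegral_intervalIntegral_swap
    refine (hFc.continuousOn.integrableOn_compact
      ((isCompact_uIcc (a := 0) (b := 2 * Real.pi)).prod
        (isCompact_uIcc (a := 0) (b := 2 * Real.pi)))).mono_set ?_
    exact Set.prod_mono Set.uIoc_subset_uIcc Set.uIoc_subset_uIcc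
  -- In one order the double integral gives the root, in the other one Cauchy's formula for `φ`.
  have hL : ∀ t : ℝ, ∫ θ in (0 : ℝ)..2 * Real.pi, F t θ = 2 * Real.pi *
      (deriv (circleMap (m : ℂ) R) t * (φ (circleMap (m : ℂ) R t) /
        ((circleMap (m : ℂ) R t - (m - r : ℝ)) ^ (1 / 2 : ℂ)
          * (circleMap (m : ℂ) R t - (m + r : ℝ)) ^ (1 / 2 : ℂ)))) := by
    intro t
    rw [hF]
    simp only
    rw [intervalIntegral.integral_const_mul, intervalIntegral.integral_mul_const,
      integral_stieltjes hr (by rw [hcm]; exact hrR)]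
    ring
  have hRR : ∀ θ : ℝ, ∫ t in (0 : ℝ)..2 * Real.pi, F t θ =
      2 * Real.pi * I * φ (m + r * Real.cos θ : ℝ) := by
    intro θ
    have := hφ.circleIntegral_sub_inv_smul (w := ((m + r * Real.cos θ : ℝ) : ℂ))
      (by rw [mem_ball_iff_norm]; exact (hx θ).trans_lt hrR)
    simpa [circleIntegral, smul_eq_mul, hF] using this
  simp only [hL, hRR] at hswap
  rw [intervalIntegral.integral_const_mul, intervalIntegral.integral_const_mul,
    mul_assoc (2 * Real.pi : ℂ) I] at hswap
  have := mul_left_cancel₀ hpi hswap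
  rw [← this]
  simp [circleIntegral, smul_eq_mul]

end Cut

section Arccos

/-- The arcsine law: the angle swept out up to `y` in the gap `[m - r, m + r]`. -/
lemma integral_inv_sqrt {m r y : ℝ} (hr : 0 < r) (h1 : m - r ≤ y) (h2 : y ≤ m + r) :
    IntervalIntegrable (fun x => (√((x - (m - r)) * ((m + r) - x)))⁻¹) MeasureTheory.volume (m - r) y ∧
      ∫ x in (m - r)..y, (√((x - (m - r)) * ((m + r) - x)))⁻¹ = Real.arccos ((m - y) / r) := by
  have hcont : Continuous fun x => Real.arccos ((m - x) / r) :=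
    Real.continuous_arccos.comp (by fun_prop)
  have hder : ∀ x ∈ Set.Ioo (m - r) y, HasDerivAt (fun x => Real.arccos ((m - x) / r))
      (√((x - (m - r)) * ((m + r) - x)))⁻¹ x := by
    intro x hx
    have hx2 : x < m + r := hx.2.trans_le h2
    have ha : (m - x) / r ≠ -1 := by
      rw [Ne, div_eq_iff hr.ne']; intro h; linarith
    have hb : (m - x) / r ≠ 1 := by
      rw [Ne, div_eq_iff hr.ne']; intro h; linarith [hx.1]
    have hd : HasDerivAt (fun x : ℝ => (m - x) / r) (-1 / r) x :=
      ((hasDerivAt_id x).const_sub m).div_const r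
    refine ((Real.hasDerivAt_arccos ha hb).comp x hd).congr_deriv ?_
    have e : 1 - ((m - x) / r) ^ 2 = ((x - (m - r)) * ((m + r) - x)) / r ^ 2 := by
      field_simp; ring
    rw [e, Real.sqrt_div' _ (sq_nonneg r), Real.sqrt_sq hr.le]
    have hpos : 0 < √((x - (m - r)) * ((m + r) - x)) :=
      Real.sqrt_pos.2 (mul_pos (by linarith [hx.1]) (by linarith))
    field_simp
  have hint : IntervalIntegrable (fun x => (√((x - (m - r)) * ((m + r) - x)))⁻¹)
      MeasureTheory.volume (m - r) y := by
    refine intervalIntegral.intervalIntegrable_deriv_of_nonneg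
      (g := fun x => Real.arccos ((m - x) / r)) hcont.continuousOn ?_ ?_
    · rw [min_eq_left h1, max_eq_right h1]; exact hder
    · intro x _; positivity
  refine ⟨hint, ?_⟩
  rw [intervalIntegral.integral_eq_sub_of_hasDerivAt_of_le h1 hcont.continuousOn hder hint]
  have : (m - (m - r)) / r = 1 := by field_simp; ring
  simp only [this, Real.arccos_one, sub_zero]

end Arccos

/-! ### The canonical root near a gap -/

section Rest

variable {N : ℕ} [NeZero N]

/-- The factor of `Δ² - 4` that does not vanish on the `k`-th gap, up to the factor `(∏ a_j)⁻²`;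
the signs are chosen such that it is positive there. -/
noncomputable def restProd (q : Phase N) (k : ℕ) (x : ℝ) : ℝ :=
  (x - lam q 1) * (lam q (2 * N) - x) *
    ∏ j ∈ (Finset.Icc 1 (N - 1)).erase k, ((x - lam q (2 * j)) * (x - lam q (2 * j + 1)))

/-- Splitting off the extreme eigenvalues and grouping the others by gaps. -/
lemma prod_pairs (g : ℕ → ℝ) (M : ℕ) :
    ∏ i ∈ Finset.range (2 * (M + 1)), g (i + 1) =
      g 1 * g (2 * (M + 1)) * ∏ j ∈ Finset.Icc 1 M, (g (2 * j) * g (2 * j + 1)) := by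
  induction M with
  | zero => simp [Finset.prod_range_succ]
  | succ M ih =>
    rw [show 2 * (M + 1 + 1) = 2 * (M + 1) + 1 + 1 by ring, Finset.prod_range_succ,
      Finset.prod_range_succ, ih, Finset.prod_Icc_succ_top (by omega)]
    ring

lemma discr_sq_eq_gap_mul {q : Phase N} (hq : q ∈ phaseSpace N) (hN : 2 ≤ N) {k : ℕ}
    (h1 : 1 ≤ k) (h2 : k ≤ N - 1) (x : ℝ) :
    (discr q).eval x ^ 2 - 4 = ((∏ j, q.2 j) ^ 2)⁻¹ *
      (((x - lam q (2 * k)) * (lam q (2 * k + 1) - x)) * restProd q k x) := by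
  have h := prod_pairs (fun i => x - lam q i) (N - 1)
  rw [Nat.sub_add_cancel (by omega : 1 ≤ N)] at h
  rw [discr_sq_eq_prod hq hN, h, restProd,
    ← Finset.mul_prod_erase (Finset.Icc 1 (N - 1)) _ (Finset.mem_Icc.2 ⟨h1, h2⟩)]
  ring

/-- The `k`-th gap together with the two adjacent open bands. -/
def gapNhd (q : Phase N) (k : ℕ) : Set ℝ := Set.Ioo (lam q (2 * k - 1)) (lam q (2 * k + 2))

lemma gap_subset_gapNhd {q : Phase N} (hq : q ∈ phaseSpace N) (hN : 2 ≤ N) {k : ℕ}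
    (h1 : 1 ≤ k) (h2 : k ≤ N - 1) : Set.Icc (lam q (2 * k)) (lam q (2 * k + 1)) ⊆ gapNhd q k := by
  intro x hx
  have b1 := (band_structure hq hN).1 k h1 (by omega)
  have b2 := (band_structure hq hN).1 (k + 1) (by omega) (by omega)
  rw [show 2 * (k + 1) - 1 = 2 * k + 1 by omega, show 2 * (k + 1) = 2 * k + 2 by omega] at b2
  exact ⟨b1.trans_le hx.1, hx.2.trans_lt b2⟩

lemma gapNhd_lower {q : Phase N} (hN : 2 ≤ N) {k : ℕ} (h2 : k ≤ N - 1) {x : ℝ}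
    (hx : x ∈ gapNhd q k) {i : ℕ} (hi : 1 ≤ i) (hik : i < 2 * k) : lam q i < x :=
  (lam_mono q hN hi (by omega) (by omega)).trans_lt hx.1

lemma gapNhd_upper {q : Phase N} (hN : 2 ≤ N) {k : ℕ} {x : ℝ}
    (hx : x ∈ gapNhd q k) {i : ℕ} (hi : 2 * k + 2 ≤ i) (hi2 : i ≤ 2 * N) : x < lam q i :=
  hx.2.trans_le (lam_mono q hN (by omega) hi hi2)

lemma restProd_pos {q : Phase N} (hN : 2 ≤ N) {k : ℕ}
    (h1 : 1 ≤ k) (h2 : k ≤ N - 1) {x : ℝ} (hx : x ∈ gapNhd q k) : 0 < restProd q k x := by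
  refine mul_pos (mul_pos ?_ ?_) (Finset.prod_pos fun j hj => ?_)
  · exact sub_pos.2 (gapNhd_lower hN h2 hx le_rfl (by omega))
  · exact sub_pos.2 (gapNhd_upper hN hx (by omega) le_rfl)
  · obtain ⟨hjk, hj⟩ := Finset.mem_erase.1 hj
    obtain ⟨hj1, hj2⟩ := Finset.mem_Icc.1 hj
    rcases lt_or_gt_of_ne hjk with h | h
    · exact mul_pos (sub_pos.2 (gapNhd_lower hN h2 hx (by omega) (by omega)))
        (sub_pos.2 (gapNhd_lower hN h2 hx (by omega) (by omega)))
    · exact mul_pos_of_neg_of_neg (sub_neg.2 (gapNhd_upper hN hx (by omega) (by omega)))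
        (sub_neg.2 (gapNhd_upper hN hx (by omega) (by omega)))

lemma continuous_restProd (hN : 2 ≤ N) {k : ℕ} :
    Continuous fun z : Phase N × ℝ => restProd z.1 k z.2 := by
  have hl : ∀ i, 1 ≤ i → i ≤ 2 * N → Continuous fun z : Phase N × ℝ => lam z.1 i :=
    fun i hi1 hi2 => (continuous_lam hN hi1 hi2).comp continuous_fst
  unfold restProd
  refine ((continuous_snd.sub (hl _ le_rfl (by omega))).mul
    ((hl _ (by omega) le_rfl).sub continuous_snd)).mul (continuous_finsetProd _ fun j hj => ?_)
  have hj := Finset.mem_Icc.1 (Finset.mem_of_mem_erase hj)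
  exact (continuous_snd.sub (hl _ (by omega) (by omega))).mul
    (continuous_snd.sub (hl _ (by omega) (by omega)))

/-- The density `(∏ a_j) / √(restProd)` by which `1 / √(Δ² - 4)` differs from the arcsine density of
the `k`-th gap. -/
noncomputable def weight (q : Phase N) (k : ℕ) (x : ℝ) : ℝ := (∏ j, q.2 j) / √(restProd q k x)

lemma weight_pos {q : Phase N} (hq : q ∈ phaseSpace N) (hN : 2 ≤ N) {k : ℕ}
    (h1 : 1 ≤ k) (h2 : k ≤ N - 1) {x : ℝ} (hx : x ∈ gapNhd q k) : 0 < weight q k x :=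
  div_pos (Finset.prod_pos fun j _ => hq j) (Real.sqrt_pos.2 (restProd_pos hN h1 h2 hx))

lemma weight_continuousAt {q : Phase N} (hN : 2 ≤ N) {k : ℕ}
    (h1 : 1 ≤ k) (h2 : k ≤ N - 1) {x : ℝ} (hx : x ∈ gapNhd q k) :
    ContinuousAt (fun z : Phase N × ℝ => weight z.1 k z.2) (q, x) := by
  unfold weight
  refine ContinuousAt.div ?_ ?_ (Real.sqrt_pos.2 (restProd_pos hN h1 h2 hx)).ne'
  · exact Continuous.continuousAt (by fun_prop)
  · exact (Real.continuous_sqrt.comp (continuous_restProd hN)).continuousAt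

/-- On the gap, `√(Δ² - 4)` is the square root of the quadratic vanishing at the edges, over
`weight`. -/
lemma sqrt_discr_sq {q : Phase N} (hq : q ∈ phaseSpace N) (hN : 2 ≤ N) {k : ℕ}
    (h1 : 1 ≤ k) (h2 : k ≤ N - 1) {x : ℝ}
    (hx : x ∈ Set.Icc (lam q (2 * k)) (lam q (2 * k + 1))) :
    √((discr q).eval x ^ 2 - 4) =
      √((x - lam q (2 * k)) * (lam q (2 * k + 1) - x)) / weight q k x := by
  have ha : 0 < ∏ j, q.2 j := Finset.prod_pos fun j _ => hq j
  rw [discr_sq_eq_gap_mul hq hN h1 h2, Real.sqrt_mul (inv_nonneg.2 (sq_nonneg _)),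
    Real.sqrt_mul (mul_nonneg (sub_nonneg.2 hx.1) (sub_nonneg.2 hx.2)), Real.sqrt_inv,
    Real.sqrt_sq ha.le, weight]
  field_simp

open Complex

/-- Principal square roots and a reflection: `√(-z) = ∓ i √z` with the sign determined by the half
plane, so that for two points of the same imaginary part the signs agree. -/
lemma sqrt_mul_sqrt_neg {z w : ℂ} (hz : 0 < z.re) (hw : 0 < w.re) (him : z.im = w.im) :
    (-z) ^ (1 / 2 : ℂ) * (-w) ^ (1 / 2 : ℂ) = -(z ^ (1 / 2 : ℂ) * w ^ (1 / 2 : ℂ)) := by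
  have key : ∀ u : ℂ, 0 < u.re → (-u) ^ (1 / 2 : ℂ) =
      (if 0 < u.im then -I else I) * u ^ (1 / 2 : ℂ) := by
    intro u hu
    have hu0 : u ≠ 0 := by rintro rfl; simp at hu
    have hexp : exp (Real.pi * I * (1 / 2)) = I := by
      rw [show (Real.pi * I * (1 / 2) : ℂ) = Real.pi / 2 * I by ring, exp_pi_div_two_mul_I]
    rw [cpow_def_of_ne_zero (neg_ne_zero.2 hu0), cpow_def_of_ne_zero hu0]
    split_ifs with h
    · have : log (-u) = log u - Real.pi * I := by
        rw [log, log, norm_neg, arg_neg_eq_arg_sub_pi_of_im_pos h]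
        push_cast; ring
      rw [this, sub_mul, Complex.exp_sub, hexp, div_I]
      ring
    · have harg : arg (-u) = arg u + Real.pi := by
        rcases (not_lt.1 h).lt_or_eq with h | h
        · exact arg_neg_eq_arg_add_pi_of_im_neg h
        · rw [arg_neg_eq_arg_add_pi_iff]; exact Or.inr ⟨h, hu⟩
      have : log (-u) = log u + Real.pi * I := by
        rw [log, log, norm_neg, harg]
        push_cast; ring
      rw [this, add_mul, Complex.exp_add, hexp]
      ring
  rw [key z hz, key w hw, him]
  have hI : I * I = -1 := I_mul_I
  split_ifs <;> linear_combination (z ^ (1 / 2 : ℂ) * w ^ (1 / 2 : ℂ)) * hI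

/-- The holomorphic square root of `restProd` in the strip over `gapNhd`. -/
noncomputable def restRoot (q : Phase N) (k : ℕ) (z : ℂ) : ℂ :=
  (z - (lam q 1 : ℂ)) ^ (1 / 2 : ℂ) * ((lam q (2 * N) : ℂ) - z) ^ (1 / 2 : ℂ) *
    ∏ j ∈ (Finset.Icc 1 (N - 1)).erase k,
      if j < k then (z - (lam q (2 * j) : ℂ)) ^ (1 / 2 : ℂ) * (z - (lam q (2 * j + 1) : ℂ)) ^ (1 / 2 : ℂ)
      else ((lam q (2 * j) : ℂ) - z) ^ (1 / 2 : ℂ) * ((lam q (2 * j + 1) : ℂ) - z) ^ (1 / 2 : ℂ)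

/-- Near the `k`-th gap, each of the `N - 1 - k` gaps to the right contributes a factor `-1` when
its two roots are made holomorphic there. -/
lemma canonicalRoot_eq {q : Phase N} (hN : 2 ≤ N) {k : ℕ}
    (h1 : 1 ≤ k) (h2 : k ≤ N - 1) {z : ℂ} (hz : z.re ∈ gapNhd q k) :
    canonicalRoot q z = I * (((∏ j, q.2 j)⁻¹ : ℝ) : ℂ) * (-1) ^ (N - 1 - k) * restRoot q k z *
      ((z - (lam q (2 * k) : ℂ)) ^ (1 / 2 : ℂ) * (z - (lam q (2 * k + 1) : ℂ)) ^ (1 / 2 : ℂ)) := by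
  have hprod : ∏ j ∈ (Finset.Icc 1 (N - 1)).erase k, ((z - (lam q (2 * j) : ℂ)) ^ (1 / 2 : ℂ) *
        (z - (lam q (2 * j + 1) : ℂ)) ^ (1 / 2 : ℂ)) = (-1) ^ (N - 1 - k) *
      ∏ j ∈ (Finset.Icc 1 (N - 1)).erase k,
      (if j < k then (z - (lam q (2 * j) : ℂ)) ^ (1 / 2 : ℂ) *
        (z - (lam q (2 * j + 1) : ℂ)) ^ (1 / 2 : ℂ)
      else ((lam q (2 * j) : ℂ) - z) ^ (1 / 2 : ℂ) *
        ((lam q (2 * j + 1) : ℂ) - z) ^ (1 / 2 : ℂ)) := by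
    have hs : ((-1 : ℂ)) ^ (N - 1 - k) =
        ∏ j ∈ (Finset.Icc 1 (N - 1)).erase k, (if j < k then (1 : ℂ) else -1) := by
      rw [Finset.prod_ite, Finset.prod_const_one, one_mul, Finset.prod_const]
      congr 1
      rw [show ((Finset.Icc 1 (N - 1)).erase k).filter (fun j => ¬ j < k) =
        Finset.Ioc k (N - 1) by ext j; simp; omega, Nat.card_Ioc]
    rw [hs, ← Finset.prod_mul_distrib]
    refine Finset.prod_congr rfl fun j hj => ?_
    obtain ⟨hjk, hj⟩ := Finset.mem_erase.1 hj
    obtain ⟨hj1, hj2⟩ := Finset.mem_Icc.1 hj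
    split_ifs with h
    · rw [one_mul]
    · have u1 := gapNhd_upper hN hz (i := 2 * j) (by omega) (by omega)
      have u2 := gapNhd_upper hN hz (i := 2 * j + 1) (by omega) (by omega)
      have := sqrt_mul_sqrt_neg (z := (lam q (2 * j) : ℂ) - z) (w := (lam q (2 * j + 1) : ℂ) - z)
        (by simpa using u1) (by simpa using u2) (by simp)
      rw [neg_sub, neg_sub] at this
      rw [this, neg_one_mul]
  rw [canonicalRoot, restRoot,
    ← Finset.mul_prod_erase (Finset.Icc 1 (N - 1)) _ (Finset.mem_Icc.2 ⟨h1, h2⟩), hprod]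
  ring

lemma cpow_half_ofReal {t : ℝ} (ht : 0 ≤ t) : (t : ℂ) ^ (1 / 2 : ℂ) = (√t : ℝ) := by
  rw [Real.sqrt_eq_rpow, ofReal_cpow ht]
  norm_num

lemma restRoot_ofReal {q : Phase N} (hN : 2 ≤ N) {k : ℕ}
    (h1 : 1 ≤ k) (h2 : k ≤ N - 1) {x : ℝ} (hx : x ∈ gapNhd q k) :
    restRoot q k x = (√(restProd q k x) : ℝ) := by
  have p1 := sub_pos.2 (gapNhd_lower hN h2 hx (le_refl 1) (by omega))
  have p2 := sub_pos.2 (gapNhd_upper hN hx (i := 2 * N) (by omega) le_rfl)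
  rw [restRoot, restProd, Real.sqrt_mul (mul_nonneg p1.le p2.le), Real.sqrt_mul p1.le]
  rw [← ofReal_sub, ← ofReal_sub, cpow_half_ofReal p1.le, cpow_half_ofReal p2.le]
  have hprod : √(∏ j ∈ (Finset.Icc 1 (N - 1)).erase k,
      ((x - lam q (2 * j)) * (x - lam q (2 * j + 1)))) =
      ∏ j ∈ (Finset.Icc 1 (N - 1)).erase k, √((x - lam q (2 * j)) * (x - lam q (2 * j + 1))) := by
    have hnn : ∀ j ∈ (Finset.Icc 1 (N - 1)).erase k,
        0 ≤ (x - lam q (2 * j)) * (x - lam q (2 * j + 1)) := by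
      intro j hj
      obtain ⟨hjk, hj⟩ := Finset.mem_erase.1 hj
      obtain ⟨hj1, hj2⟩ := Finset.mem_Icc.1 hj
      rcases lt_or_gt_of_ne hjk with h | h
      · exact (mul_pos (sub_pos.2 (gapNhd_lower hN h2 hx (by omega) (by omega)))
          (sub_pos.2 (gapNhd_lower hN h2 hx (by omega) (by omega)))).le
      · exact (mul_pos_of_neg_of_neg (sub_neg.2 (gapNhd_upper hN hx (by omega) (by omega)))
          (sub_neg.2 (gapNhd_upper hN hx (by omega) (by omega)))).le
    rw [Real.sqrt_eq_rpow, ← Real.finsetProd_rpow _ _ hnn]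
    simp only [Real.sqrt_eq_rpow]
  rw [hprod]
  push_cast
  congr 1
  refine Finset.prod_congr rfl fun j hj => ?_
  obtain ⟨hjk, hj⟩ := Finset.mem_erase.1 hj
  obtain ⟨hj1, hj2⟩ := Finset.mem_Icc.1 hj
  split_ifs with h
  · have l1 := (sub_pos.2 (gapNhd_lower hN h2 hx (i := 2 * j) (by omega) (by omega))).le
    have l2 := (sub_pos.2 (gapNhd_lower hN h2 hx (i := 2 * j + 1) (by omega) (by omega))).le
    rw [Real.sqrt_mul l1, ← ofReal_sub, ← ofReal_sub, cpow_half_ofReal l1, cpow_half_ofReal l2]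
    push_cast; rfl
  · have l1 := (sub_pos.2 (gapNhd_upper hN hx (i := 2 * j) (by omega) (by omega))).le
    have l2 := (sub_pos.2 (gapNhd_upper hN hx (i := 2 * j + 1) (by omega) (by omega))).le
    rw [show (x - lam q (2 * j)) * (x - lam q (2 * j + 1)) =
      (lam q (2 * j) - x) * (lam q (2 * j + 1) - x) by ring, Real.sqrt_mul l1, ← ofReal_sub, ← ofReal_sub,
      cpow_half_ofReal l1, cpow_half_ofReal l2]
    push_cast; rfl

/-- In the vertical strip over `gapNhd` all radicands of `restRoot` have positive real part. -/
lemma restRoot_differentiableAt {q : Phase N} (hN : 2 ≤ N) {k : ℕ}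
    (h1 : 1 ≤ k) (h2 : k ≤ N - 1) {z : ℂ} (hz : z.re ∈ gapNhd q k) :
    DifferentiableAt ℂ (restRoot q k) z ∧ restRoot q k z ≠ 0 := by
  have lo : ∀ i, 1 ≤ i → i < 2 * k → DifferentiableAt ℂ (fun z => (z - (lam q i : ℂ)) ^ (1 / 2 : ℂ)) z ∧
      (z - (lam q i : ℂ)) ^ (1 / 2 : ℂ) ≠ 0 := by
    intro i hi1 hi2
    have hre : 0 < (z - (lam q i : ℂ)).re := by
      simpa using gapNhd_lower hN h2 hz hi1 hi2
    refine ⟨DifferentiableAt.cpow_const (by fun_prop) (Or.inl hre), ?_⟩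
    rw [Ne, cpow_eq_zero_iff]
    rintro ⟨h, -⟩
    rw [h] at hre; simp at hre
  have up : ∀ i, 2 * k + 2 ≤ i → i ≤ 2 * N →
      DifferentiableAt ℂ (fun z => ((lam q i : ℂ) - z) ^ (1 / 2 : ℂ)) z ∧
      ((lam q i : ℂ) - z) ^ (1 / 2 : ℂ) ≠ 0 := by
    intro i hi1 hi2
    have hre : 0 < ((lam q i : ℂ) - z).re := by
      simpa using gapNhd_upper hN hz hi1 hi2
    refine ⟨DifferentiableAt.cpow_const (by fun_prop) (Or.inl hre), ?_⟩
    rw [Ne, cpow_eq_zero_iff]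
    rintro ⟨h, -⟩
    rw [h] at hre; simp at hre
  have e1 := lo 1 le_rfl (by omega)
  have e2 := up (2 * N) (by omega) le_rfl
  constructor
  · unfold restRoot
    refine (e1.1.mul e2.1).mul ?_
    refine DifferentiableAt.fun_finsetProd fun j hj => ?_
    obtain ⟨hjk, hj⟩ := Finset.mem_erase.1 hj
    obtain ⟨hj1, hj2⟩ := Finset.mem_Icc.1 hj
    split_ifs with h
    · exact (lo _ (by omega) (by omega)).1.mul (lo _ (by omega) (by omega)).1
    · exact (up _ (by omega) (by omega)).1.mul (up _ (by omega) (by omega)).1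
  · refine mul_ne_zero (mul_ne_zero e1.2 e2.2) (Finset.prod_ne_zero_iff.2 fun j hj => ?_)
    obtain ⟨hjk, hj⟩ := Finset.mem_erase.1 hj
    obtain ⟨hj1, hj2⟩ := Finset.mem_Icc.1 hj
    split_ifs with h
    · exact mul_ne_zero (lo _ (by omega) (by omega)).2 (lo _ (by omega) (by omega)).2
    · exact mul_ne_zero (up _ (by omega) (by omega)).2 (up _ (by omega) (by omega)).2

/-- The parametrization of the `k`-th gap by an angle, which turns the arcsine density into the
constant one and stays meaningful when the gap collapses. -/
noncomputable def gapPoint (q : Phase N) (k : ℕ) (θ : ℝ) : ℝ := mid q k + gap q k / 2 * Real.cos θ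

lemma gap_nonneg (q : Phase N) (hN : 2 ≤ N) {k : ℕ} (h1 : 1 ≤ k) (h2 : k ≤ N - 1) :
    0 ≤ gap q k :=
  sub_nonneg.2 (lam_mono q hN (by omega) (by omega) (by omega))

lemma gapPoint_mem (q : Phase N) (hN : 2 ≤ N) {k : ℕ} (h1 : 1 ≤ k) (h2 : k ≤ N - 1) (θ : ℝ) :
    gapPoint q k θ ∈ Set.Icc (lam q (2 * k)) (lam q (2 * k + 1)) := by
  have h := gap_nonneg q hN h1 h2
  have c1 := Real.neg_one_le_cos θ
  have c2 := Real.cos_le_one θ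
  unfold gapPoint mid
  unfold gap at *
  constructor <;> nlinarith

/-- The normalizing integrals in terms of real averages over the gaps.  A collapsed gap, where the
average is a point evaluation, needs no separate treatment. -/
lemma period_eq {q : Phase N} (hq : q ∈ phaseSpace N) (hN : 2 ≤ N) {k : ℕ}
    (h1 : 1 ≤ k) (h2 : k ≤ N - 1) (ψ : ℂ[X]) :
    (1 / (2 * (Real.pi : ℂ))) *
        (∮ z in C((mid q k : ℂ), contourRadius q k), ψ.eval z / canonicalRoot q z) =
      (-1) ^ (N - 1 - k) * ((1 / (2 * (Real.pi : ℂ))) *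
        ∫ θ in (0 : ℝ)..2 * Real.pi, ψ.eval (gapPoint q k θ : ℂ) * (weight q k (gapPoint q k θ) : ℂ)) := by
  have b1 := (band_structure hq hN).1 k h1 (by omega)
  have b2 := (band_structure hq hN).1 (k + 1) (by omega) (by omega)
  rw [show 2 * (k + 1) - 1 = 2 * k + 1 by omega, show 2 * (k + 1) = 2 * k + 2 by omega] at b2
  have hg := gap_nonneg q hN h1 h2
  have hmin : 0 < min (lam q (2 * k) - lam q (2 * k - 1)) (lam q (2 * k + 2) - lam q (2 * k + 1)) :=
    lt_min (sub_pos.2 b1) (sub_pos.2 b2)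
  have hmin1 := min_le_left (lam q (2 * k) - lam q (2 * k - 1))
    (lam q (2 * k + 2) - lam q (2 * k + 1))
  have hmin2 := min_le_right (lam q (2 * k) - lam q (2 * k - 1))
    (lam q (2 * k + 2) - lam q (2 * k + 1))
  have hR : gap q k / 2 < contourRadius q k := by unfold contourRadius; linarith
  have hR0 : 0 < contourRadius q k := by linarith
  have hstrip : ∀ z : ℂ, ‖z - mid q k‖ ≤ contourRadius q k → z.re ∈ gapNhd q k := by
    intro z hz
    have h3 := (abs_re_le_norm (z - mid q k)).trans hz
    rw [sub_re, ofReal_re, abs_le] at h3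
    unfold contourRadius at h3
    unfold mid gap at h3
    constructor <;> linarith [h3.1, h3.2]
  have ha : ((∏ j, q.2 j : ℝ) : ℂ) ≠ 0 :=
    ofReal_ne_zero.2 (Finset.prod_pos fun j _ => hq j).ne'
  have hs : ((-1 : ℂ)) ^ (N - 1 - k) ≠ 0 := pow_ne_zero _ (by norm_num)
  have hs2 : ((-1 : ℂ)) ^ (N - 1 - k) * (-1) ^ (N - 1 - k) = 1 := by rw [← mul_pow]; simp
  set φ : ℂ → ℂ := fun z => ψ.eval z /
    (I * (((∏ j, q.2 j)⁻¹ : ℝ) : ℂ) * (-1) ^ (N - 1 - k) * restRoot q k z) with hφ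
  have hc1 : lam q (2 * k) = mid q k - gap q k / 2 := by unfold mid gap; ring
  have hc2 : lam q (2 * k + 1) = mid q k + gap q k / 2 := by unfold mid gap; ring
  have hdiff : DiffContOnCl ℂ φ (Metric.ball (mid q k : ℂ) (contourRadius q k)) := by
    apply DifferentiableOn.diffContOnCl
    rw [closure_ball _ hR0.ne']
    intro z hz
    obtain ⟨d, n⟩ := restRoot_differentiableAt hN h1 h2 (hstrip z (mem_closedBall_iff_norm.1 hz))
    refine DifferentiableAt.differentiableWithinAt ?_
    refine ψ.differentiable.differentiableAt.div (d.const_mul _) ?_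
    refine mul_ne_zero (mul_ne_zero (mul_ne_zero I_ne_zero ?_) hs) n
    rw [ofReal_inv]; exact inv_ne_zero ha
  have hint := circleIntegral_div_sqrt (by linarith : 0 ≤ gap q k / 2) hR hdiff
  rw [← hc1, ← hc2] at hint
  have hcongr : (∮ z in C((mid q k : ℂ), contourRadius q k), ψ.eval z / canonicalRoot q z) =
      ∮ z in C((mid q k : ℂ), contourRadius q k), φ z / ((z - (lam q (2 * k) : ℂ)) ^ (1 / 2 : ℂ) *
        (z - (lam q (2 * k + 1) : ℂ)) ^ (1 / 2 : ℂ)) := by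
    refine circleIntegral.integral_congr hR0.le fun z hz => ?_
    have hz' : ‖z - mid q k‖ ≤ contourRadius q k := by
      rw [← mem_sphere_iff_norm.1 hz]
    change _ / _ = _
    rw [canonicalRoot_eq hN h1 h2 (hstrip z hz'), hφ, div_div]
  have hpt : ∀ θ : ℝ, φ ((mid q k + gap q k / 2 * Real.cos θ : ℝ) : ℂ) = -I * (-1) ^ (N - 1 - k) *
      (ψ.eval (gapPoint q k θ : ℂ) * (weight q k (gapPoint q k θ) : ℂ)) := by
    intro θ
    have hx := gap_subset_gapNhd hq hN h1 h2 (gapPoint_mem q hN h1 h2 θ)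
    have hr := restRoot_ofReal hN h1 h2 hx
    have hn : ((√(restProd q k (gapPoint q k θ)) : ℝ) : ℂ) ≠ 0 :=
      ofReal_ne_zero.2 (Real.sqrt_pos.2 (restProd_pos hN h1 h2 hx)).ne'
    simp only [hφ]
    rw [← gapPoint, hr, weight, ofReal_inv, ofReal_div, div_eq_iff
      (mul_ne_zero (mul_ne_zero (mul_ne_zero I_ne_zero (inv_ne_zero ha)) hs) hn)]
    field_simp
    have hII : I * I = -1 := I_mul_I
    generalize ((-1 : ℂ)) ^ (N - 1 - k) = s at *
    linear_combination (-(eval (gapPoint q k θ : ℂ) ψ)) * hs2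
      + (s * s * eval (gapPoint q k θ : ℂ) ψ) * hII
  simp only [hcongr, hint, hpt]
  rw [intervalIntegral.integral_const_mul]
  have hII : I * I = -1 := I_mul_I
  generalize (∫ θ in (0 : ℝ)..2 * Real.pi, _ : ℂ) = J
  linear_combination (-(1 / (2 * (Real.pi : ℂ))) * (-1) ^ (N - 1 - k) * J) * hII

end Rest

/-! ### The normalized differential -/

section Abelian

variable {N : ℕ} [NeZero N]

lemma gapPoint_continuous (hN : 2 ≤ N) {k : ℕ} (h1 : 1 ≤ k) (h2 : k ≤ N - 1) :
    Continuous fun z : Phase N × ℝ => gapPoint z.1 k z.2 := by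
  have l1 : Continuous fun z : Phase N × ℝ => lam z.1 (2 * k) :=
    (continuous_lam hN (by omega) (by omega)).comp continuous_fst
  have l2 : Continuous fun z : Phase N × ℝ => lam z.1 (2 * k + 1) :=
    (continuous_lam hN (by omega) (by omega)).comp continuous_fst
  unfold gapPoint mid gap
  fun_prop

/-- The average of `x ^ j` over the `k`-th gap with respect to the density `weight`. -/
noncomputable def periodMoment (q : Phase N) (k j : ℕ) : ℝ :=
  1 / (2 * Real.pi) * ∫ θ in (0 : ℝ)..2 * Real.pi,
    gapPoint q k θ ^ j * weight q k (gapPoint q k θ)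

lemma moment_integrand_continuousAt {q : Phase N} (hq : q ∈ phaseSpace N) (hN : 2 ≤ N) {k : ℕ}
    (h1 : 1 ≤ k) (h2 : k ≤ N - 1) (j : ℕ) (θ : ℝ) :
    ContinuousAt (fun z : Phase N × ℝ => gapPoint z.1 k z.2 ^ j * weight z.1 k (gapPoint z.1 k z.2))
      (q, θ) := by
  have hg := (gapPoint_continuous hN h1 h2).continuousAt (x := (q, θ))
  refine (hg.pow j).mul ?_
  have hw := weight_continuousAt hN h1 h2
    (gap_subset_gapNhd hq hN h1 h2 (gapPoint_mem q hN h1 h2 θ))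
  exact ContinuousAt.comp (f := fun z : Phase N × ℝ => (z.1, gapPoint z.1 k z.2)) hw
    (continuousAt_fst.prodMk hg)

lemma moment_integrand_continuous {q : Phase N} (hq : q ∈ phaseSpace N) (hN : 2 ≤ N) {k : ℕ}
    (h1 : 1 ≤ k) (h2 : k ≤ N - 1) (j : ℕ) :
    Continuous fun θ : ℝ => gapPoint q k θ ^ j * weight q k (gapPoint q k θ) := by
  rw [continuous_iff_continuousAt]
  intro θ
  exact ContinuousAt.comp (f := fun t : ℝ => (q, t)) (moment_integrand_continuousAt hq hN h1 h2 j θ)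
    (by fun_prop)

lemma periodMoment_continuousAt {q : Phase N} (hq : q ∈ phaseSpace N) (hN : 2 ≤ N) {k : ℕ}
    (h1 : 1 ≤ k) (h2 : k ≤ N - 1) (j : ℕ) :
    ContinuousAt (fun q : Phase N => periodMoment q k j) q := by
  obtain ⟨K, hK, hqK, hKM⟩ := exists_compact_subset (isOpen_phaseSpace N) hq
  have hc : ContinuousOn (fun z : Phase N × ℝ =>
      gapPoint z.1 k z.2 ^ j * weight z.1 k (gapPoint z.1 k z.2))
      (K ×ˢ Set.uIcc 0 (2 * Real.pi)) := fun z hz =>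
    (moment_integrand_continuousAt (hKM hz.1) hN h1 h2 j z.2).continuousWithinAt
  obtain ⟨B, hB⟩ := (hK.prod isCompact_uIcc).exists_bound_of_continuousOn hc
  refine continuousAt_const.mul ?_
  refine intervalIntegral.continuousAt_of_dominated_interval (bound := fun _ => B) ?_ ?_ ?_ ?_
  · filter_upwards [(isOpen_phaseSpace N).mem_nhds hq] with r hr
    exact (moment_integrand_continuous hr hN h1 h2 j).aestronglyMeasurable
  · filter_upwards [mem_interior_iff_mem_nhds.1 hqK] with r hr
    exact Filter.Eventually.of_forall fun θ hθ => hB (r, θ) ⟨hr, Set.uIoc_subset_uIcc hθ⟩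
  · exact intervalIntegrable_const
  · refine Filter.Eventually.of_forall fun θ _ => ?_
    exact ContinuousAt.comp (f := fun r : Phase N => (r, θ))
      (moment_integrand_continuousAt hq hN h1 h2 j θ) (by fun_prop)

/-- The matrix of the normalizing conditions in the basis of monomials. -/
noncomputable def periodMatrix (q : Phase N) : Matrix (Fin (N - 1)) (Fin (N - 1)) ℝ :=
  fun k j => periodMoment q (k.val + 1) j.val

/-- A real polynomial without zeros in a gap has a definite sign there, and so has its average. -/
lemma exists_zero_in_gap {q : Phase N} (hq : q ∈ phaseSpace N) (hN : 2 ≤ N) {k : ℕ}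
    (h1 : 1 ≤ k) (h2 : k ≤ N - 1) {f : ℝ[X]}
    (hf : ∫ θ in (0 : ℝ)..2 * Real.pi, f.eval (gapPoint q k θ) * weight q k (gapPoint q k θ) = 0) :
    ∃ x ∈ Set.Icc (lam q (2 * k)) (lam q (2 * k + 1)), f.eval x = 0 := by
  by_contra! hne
  have hpi : 0 < 2 * Real.pi := by positivity
  have hcw : Continuous fun θ : ℝ => weight q k (gapPoint q k θ) := by
    have := moment_integrand_continuous hq hN h1 h2 0
    simp only [pow_zero, one_mul] at this
    exact this
  have hcg : Continuous fun θ : ℝ => gapPoint q k θ :=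
    Continuous.comp (g := fun z : Phase N × ℝ => gapPoint z.1 k z.2) (f := fun t : ℝ => (q, t))
      (gapPoint_continuous hN h1 h2) (Continuous.prodMk_right q)
  have hw : ∀ θ, 0 < weight q k (gapPoint q k θ) := fun θ =>
    weight_pos hq hN h1 h2 (gap_subset_gapNhd hq hN h1 h2 (gapPoint_mem q hN h1 h2 θ))
  have hc : Continuous fun θ : ℝ => f.eval (gapPoint q k θ) * weight q k (gapPoint q k θ) :=
    (Continuous.comp (g := fun x => f.eval x) f.continuous hcg).mul hcw
  have hsign : (∀ x ∈ Set.Icc (lam q (2 * k)) (lam q (2 * k + 1)), 0 < f.eval x) ∨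
      ∀ x ∈ Set.Icc (lam q (2 * k)) (lam q (2 * k + 1)), f.eval x < 0 := by
    by_contra! h
    obtain ⟨⟨x, hx, hx0⟩, y, hy, hy0⟩ := h
    obtain ⟨z, hz, hz0⟩ := isPreconnected_Icc.intermediate_value hx hy
      (f := fun x => f.eval x) f.continuous.continuousOn ⟨hx0, hy0⟩
    exact hne z hz hz0
  rcases hsign with h | h
  · have := intervalIntegral.intervalIntegral_pos_of_pos (hc.intervalIntegrable 0 (2 * Real.pi))
      (fun θ => mul_pos (h _ (gapPoint_mem q hN h1 h2 θ)) (hw θ)) hpi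
    exact this.ne' hf
  · have hc' : Continuous fun θ : ℝ => -(f.eval (gapPoint q k θ) * weight q k (gapPoint q k θ)) :=
      hc.neg
    have := intervalIntegral.intervalIntegral_pos_of_pos (hc'.intervalIntegrable 0 (2 * Real.pi))
      (fun θ => neg_pos.2 (mul_neg_of_neg_of_pos (h _ (gapPoint_mem q hN h1 h2 θ)) (hw θ))) hpi
    rw [intervalIntegral.integral_neg, hf, neg_zero] at this
    exact lt_irrefl _ this

/-- A polynomial of degree at most `N - 2` whose averages over all gaps vanish has a zero in each
of the `N - 1` gaps. -/
lemma periodMatrix_det_ne_zero {q : Phase N} (hq : q ∈ phaseSpace N) (hN : 2 ≤ N) :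
    (periodMatrix q).det ≠ 0 := by
  intro hdet
  obtain ⟨v, hv, hv0⟩ := Matrix.exists_mulVec_eq_zero_iff.2 hdet
  set f : ℝ[X] := ∑ j : Fin (N - 1), C (v j) * X ^ (j.val) with hf
  have hcoeff : ∀ j : Fin (N - 1), f.coeff j.val = v j := by
    intro j
    rw [hf, finsetSum_coeff]
    simp only [coeff_C_mul, coeff_X_pow]
    rw [Finset.sum_eq_single j]
    · simp
    · intro i _ hij
      rw [if_neg (fun h => hij (Fin.ext h.symm)), mul_zero]
    · simp
  have hdeg : f.natDegree < N - 1 := by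
    refine (natDegree_sum_le_of_forall_le (n := N - 2) _ _ fun j _ => ?_).trans_lt (by omega)
    exact (natDegree_C_mul_X_pow_le _ _).trans (by have := j.isLt; omega)
  have hzero : ∀ k : Fin (N - 1), ∃ x ∈ Set.Icc (lam q (2 * (k.val + 1)))
      (lam q (2 * (k.val + 1) + 1)), f.eval x = 0 := by
    intro k
    have hk := k.isLt
    refine exists_zero_in_gap hq hN (by omega) (by omega) ?_
    have h := congrFun hv0 k
    simp only [Matrix.mulVec, dotProduct, periodMatrix, periodMoment, Pi.zero_apply] at h
    have e : ∀ θ : ℝ, f.eval (gapPoint q (k.val + 1) θ) *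
        weight q (k.val + 1) (gapPoint q (k.val + 1) θ) =
        ∑ j : Fin (N - 1), v j * (gapPoint q (k.val + 1) θ ^ j.val *
          weight q (k.val + 1) (gapPoint q (k.val + 1) θ)) := by
      intro θ
      rw [hf, eval_finsetSum, Finset.sum_mul]
      simp [mul_assoc]
    simp only [e]
    rw [intervalIntegral.integral_finsetSum fun j _ =>
      ((moment_integrand_continuous hq hN (by omega) (by omega) j.val).const_mul _).intervalIntegrable
        _ _]
    simp only [intervalIntegral.integral_const_mul]
    have hpi : (1 / (2 * Real.pi)) ≠ 0 := by positivity
    apply mul_left_cancel₀ hpi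
    refine Eq.trans ?_ (h.trans (mul_zero _).symm)
    rw [Finset.mul_sum]
    exact Finset.sum_congr rfl fun j _ => by ring
  choose x hx hx0 using hzero
  have hxlt : ∀ i j : Fin (N - 1), i < j → x i < x j := by
    intro i j hij
    have hj := j.isLt
    have hij' : i.val < j.val := hij
    have b := (band_structure hq hN).1 (j.val + 1) (by omega) (by omega)
    have l := lam_mono q hN (i := 2 * (i.val + 1) + 1) (j := 2 * (j.val + 1) - 1) (by omega)
      (by omega) (by omega)
    exact ((hx i).2.trans l).trans_lt (b.trans_le (hx j).1)
  have hinj : Function.Injective x :=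
    (show StrictMono x from fun i j hij => hxlt i j hij).injective
  have hf0 : f = 0 := eq_zero_of_natDegree_lt_card_of_eval_eq_zero f hinj hx0 (by simpa using hdeg)
  apply hv
  funext j
  rw [← hcoeff, hf0]; simp

/-- The coefficient vector of `ψ_n`, as the solution of the linear system of `isAbelianPoly_iff`. -/
noncomputable def abelianCoeff (q : Phase N) (n : ℕ) : Fin (N - 1) → ℝ :=
  (periodMatrix q)⁻¹.mulVec fun k => if k.val + 1 = n then (-1) ^ (N - 1 - n) else 0

/-- The normalizing conditions are a linear system for the coefficients. -/
lemma isAbelianPoly_iff {q : Phase N} (hq : q ∈ phaseSpace N) (hN : 2 ≤ N) (n : ℕ) (ψ : ℂ[X]) :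
    IsAbelianPoly q n ψ ↔ ψ.natDegree ≤ N - 2 ∧
      ((periodMatrix q).map Complex.ofRealHom).mulVec (fun j => ψ.coeff j.val) =
        fun k => if k.val + 1 = n then (-1) ^ (N - 1 - n) else 0 := by
  unfold IsAbelianPoly
  refine and_congr_right fun hd => ?_
  have hrow : ∀ k : Fin (N - 1), (1 / (2 * (Real.pi : ℂ))) *
        (∮ z in C((mid q (k.val + 1) : ℂ), contourRadius q (k.val + 1)),
          ψ.eval z / canonicalRoot q z) =
      (-1) ^ (N - 1 - (k.val + 1)) *
        (((periodMatrix q).map Complex.ofRealHom).mulVec (fun j => ψ.coeff j.val) k) := by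
    intro k
    have hk := k.isLt
    rw [period_eq hq hN (by omega) (by omega)]
    congr 1
    simp only [Matrix.mulVec, dotProduct, Matrix.map_apply, periodMatrix, periodMoment]
    have e : ∀ θ : ℝ, ψ.eval (gapPoint q (k.val + 1) θ : ℂ) *
        (weight q (k.val + 1) (gapPoint q (k.val + 1) θ) : ℂ) =
        ∑ j : Fin (N - 1), ψ.coeff j.val * ((gapPoint q (k.val + 1) θ ^ j.val *
          weight q (k.val + 1) (gapPoint q (k.val + 1) θ) : ℝ) : ℂ) := by
      intro θ
      rw [eval_eq_sum_range' (show ψ.natDegree < N - 1 by omega), Finset.sum_mul,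
        Finset.sum_range]
      push_cast
      exact Finset.sum_congr rfl fun j _ => by ring
    simp only [e]
    rw [intervalIntegral.integral_finsetSum fun j _ => by
      refine Continuous.intervalIntegrable (continuous_const.mul ?_) _ _
      exact Complex.continuous_ofReal.comp
        (moment_integrand_continuous hq hN (by omega) (by omega) j.val)]
    rw [Finset.mul_sum]
    refine Finset.sum_congr rfl fun j _ => ?_
    rw [intervalIntegral.integral_const_mul, intervalIntegral.integral_ofReal]
    simp only [Complex.ofRealHom_eq_coe]
    push_cast
    ring
  have hs : ∀ k : ℕ, ((-1 : ℂ)) ^ k * (-1) ^ k = 1 := fun k => by rw [← mul_pow]; simp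
  constructor
  · intro h
    funext k
    have hk := k.isLt
    have h1 := h (k.val + 1) (by omega) (by omega)
    rw [hrow] at h1
    have h2 := congrArg (fun t => ((-1 : ℂ)) ^ (N - 1 - (k.val + 1)) * t) h1
    simp only [← mul_assoc, hs, one_mul] at h2
    rw [h2]
    split_ifs with h3
    · rw [h3, mul_one]
    · rw [mul_zero]
  · intro h k hk1 hk2
    have h1 := hrow ⟨k - 1, by omega⟩
    rw [h] at h1
    simp only [Nat.sub_add_cancel hk1] at h1
    rw [h1]
    split_ifs with h3
    · rw [h3, hs]
    · rw [mul_zero]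

lemma isAbelianPoly_abelianPoly {q : Phase N} (hq : q ∈ phaseSpace N) (hN : 2 ≤ N) (n : ℕ) :
    IsAbelianPoly q n (abelianPoly q n) := by
  refine Classical.epsilon_spec (p := IsAbelianPoly q n)
    ⟨∑ j : Fin (N - 1), C (abelianCoeff q n j : ℂ) * X ^ j.val, ?_⟩
  rw [isAbelianPoly_iff hq hN]
  constructor
  · refine natDegree_sum_le_of_forall_le _ _ fun j _ => ?_
    exact (natDegree_C_mul_X_pow_le _ _).trans (by have := j.isLt; omega)
  · have hcoeff : ∀ j : Fin (N - 1), (∑ j : Fin (N - 1), C (abelianCoeff q n j : ℂ) * X ^ j.val :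
        ℂ[X]).coeff j.val = Complex.ofRealHom (abelianCoeff q n j) := by
      intro j
      rw [finsetSum_coeff]
      simp only [coeff_C_mul, coeff_X_pow]
      rw [Finset.sum_eq_single j]
      · simp
      · intro i _ hij
        rw [if_neg (fun h => hij (Fin.ext h.symm)), mul_zero]
      · simp
    simp only [hcoeff]
    have h := RingHom.map_mulVec Complex.ofRealHom (periodMatrix q) (abelianCoeff q n)
    funext k
    rw [← Function.comp_def, ← h, abelianCoeff, Matrix.mulVec_mulVec,
      Matrix.mul_nonsing_inv _ (isUnit_iff_ne_zero.2 (periodMatrix_det_ne_zero hq hN)),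
      Matrix.one_mulVec]
    split_ifs <;> simp

/-- Uniqueness of `ψ_n`: its coefficients are real and given by `abelianCoeff`. -/
lemma abelianPoly_coeff {q : Phase N} (hq : q ∈ phaseSpace N) (hN : 2 ≤ N) (n : ℕ)
    (j : Fin (N - 1)) : (abelianPoly q n).coeff j.val = (abelianCoeff q n j : ℂ) := by
  have h := ((isAbelianPoly_iff hq hN n _).1 (isAbelianPoly_abelianPoly hq hN n)).2
  have hdet : IsUnit ((periodMatrix q).map Complex.ofRealHom).det := by
    rw [← RingHom.mapMatrix_apply, ← RingHom.map_det, isUnit_iff_ne_zero, Complex.ofRealHom_eq_coe,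
      Complex.ofReal_ne_zero]
    exact periodMatrix_det_ne_zero hq hN
  have hinj := Matrix.mulVec_injective_iff_isUnit.2 ((Matrix.isUnit_iff_isUnit_det _).2 hdet)
  have h2 : ((periodMatrix q).map Complex.ofRealHom).mulVec
      (Complex.ofRealHom ∘ abelianCoeff q n) =
        fun k => if k.val + 1 = n then (-1) ^ (N - 1 - n) else 0 := by
    funext k
    rw [← RingHom.map_mulVec, abelianCoeff, Matrix.mulVec_mulVec,
      Matrix.mul_nonsing_inv _ (isUnit_iff_ne_zero.2 (periodMatrix_det_ne_zero hq hN)),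
      Matrix.one_mulVec]
    split_ifs <;> simp
  exact congrFun (hinj (h.trans h2.symm)) j

lemma abelianCoeff_continuousAt {q : Phase N} (hq : q ∈ phaseSpace N) (hN : 2 ≤ N) (n : ℕ)
    (j : Fin (N - 1)) : ContinuousAt (fun q : Phase N => abelianCoeff q n j) q := by
  have hM : ContinuousAt (fun q : Phase N => periodMatrix q) q :=
    continuousAt_pi.2 fun k => continuousAt_pi.2 fun j =>
      periodMoment_continuousAt hq hN (by omega) (by have := k.isLt; omega) _
  have hd : ContinuousAt (fun q : Phase N => (periodMatrix q).det) q :=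
    (Continuous.matrix_det continuous_id).continuousAt.comp hM
  have ha : ContinuousAt (fun q : Phase N => (periodMatrix q).adjugate) q :=
    (Continuous.matrix_adjugate continuous_id).continuousAt.comp hM
  have hinv : ContinuousAt (fun q : Phase N => (periodMatrix q)⁻¹) q := by
    simp only [Matrix.inv_def, Ring.inverse_eq_inv']
    exact (hd.inv₀ (periodMatrix_det_ne_zero hq hN)).smul ha
  exact ((Continuous.matrix_mulVec continuous_id continuous_const).continuousAt.comp hinv :
    ContinuousAt (fun q : Phase N => abelianCoeff q n) q) |> fun h => continuousAt_pi.1 h j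

/-- The density of the normalized differential with respect to the arcsine density of its gap. -/
noncomputable def gapDensity (q : Phase N) (n : ℕ) (x : ℝ) : ℝ :=
  (∑ j : Fin (N - 1), abelianCoeff q n j * x ^ j.val) * weight q n x

lemma abelianPoly_eval {q : Phase N} (hq : q ∈ phaseSpace N) (hN : 2 ≤ N) (n : ℕ) (x : ℝ) :
    (abelianPoly q n).eval (x : ℂ) =
      ((∑ j : Fin (N - 1), abelianCoeff q n j * x ^ j.val : ℝ) : ℂ) := by
  have hd := (isAbelianPoly_abelianPoly hq hN n).1
  rw [eval_eq_sum_range' (show (abelianPoly q n).natDegree < N - 1 by omega), Finset.sum_range]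
  push_cast
  exact Finset.sum_congr rfl fun j _ => by rw [abelianPoly_coeff hq hN]

lemma gapDensity_continuousAt {q : Phase N} (hq : q ∈ phaseSpace N) (hN : 2 ≤ N) {n : ℕ}
    (h1 : 1 ≤ n) (h2 : n ≤ N - 1) {x : ℝ} (hx : x ∈ gapNhd q n) :
    ContinuousAt (fun z : Phase N × ℝ => gapDensity z.1 n z.2) (q, x) := by
  refine ContinuousAt.mul ?_ (weight_continuousAt hN h1 h2 hx)
  refine tendsto_finsetSum _ fun j _ => ?_
  have hj : ContinuousAt (fun z : Phase N × ℝ => abelianCoeff z.1 n j) (q, x) :=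
    ContinuousAt.comp (g := fun q : Phase N => abelianCoeff q n j) (f := Prod.fst)
      (abelianCoeff_continuousAt hq hN n j) continuousAt_fst
  exact hj.mul (continuousAt_snd.pow _)

/-- At a collapsed gap the normalization of `ψ_n` is a residue condition. -/
lemma gapDensity_collapsed {q : Phase N} (hq : q ∈ phaseSpace N) (hN : 2 ≤ N) {n : ℕ}
    (h1 : 1 ≤ n) (h2 : n ≤ N - 1) (hgap : gap q n = 0) :
    gapDensity q n (lam q (2 * n)) = (-1) ^ (N - 1 - n) := by
  have h := (isAbelianPoly_abelianPoly hq hN n).2 n h1 h2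
  rw [period_eq hq hN h1 h2, if_pos rfl] at h
  have hx : ∀ θ, gapPoint q n θ = lam q (2 * n) := by
    intro θ
    unfold gapPoint
    rw [hgap]
    unfold mid
    unfold gap at hgap
    linarith
  simp only [hx, abelianPoly_eval hq hN, intervalIntegral.integral_const] at h
  have hpi : (Real.pi : ℂ) ≠ 0 := by exact_mod_cast Real.pi_ne_zero
  rw [← Complex.ofReal_mul, ← gapDensity] at h
  simp only [sub_zero, Complex.real_smul] at h
  push_cast at h
  have h' : ((-1 : ℂ)) ^ (N - 1 - n) * (gapDensity q n (lam q (2 * n)) : ℂ) = 1 := by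
    rwa [one_div, inv_mul_cancel_left₀ (mul_ne_zero two_ne_zero hpi)] at h
  have hs : ((-1 : ℝ)) ^ (N - 1 - n) * (-1) ^ (N - 1 - n) = 1 := by rw [← mul_pow]; simp
  have h'' : ((-1 : ℝ)) ^ (N - 1 - n) * gapDensity q n (lam q (2 * n)) = 1 := by
    exact_mod_cast h'
  linear_combination ((-1 : ℝ)) ^ (N - 1 - n) * h'' - gapDensity q n (lam q (2 * n)) * hs

end Abelian

/-! ### The angle variable -/

section Angle

variable {N : ℕ} [NeZero N]

lemma gapDensity_continuousOn {q : Phase N} (hq : q ∈ phaseSpace N) (hN : 2 ≤ N) {n : ℕ}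
    (h1 : 1 ≤ n) (h2 : n ≤ N - 1) :
    ContinuousOn (gapDensity q n) (Set.Icc (lam q (2 * n)) (lam q (2 * n + 1))) := fun _ hx =>
  (ContinuousAt.comp (g := fun z : Phase N × ℝ => gapDensity z.1 n z.2) (f := fun t : ℝ => (q, t))
    (gapDensity_continuousAt hq hN h1 h2 (gap_subset_gapNhd hq hN h1 h2 hx))
    (Continuous.prodMk_right q).continuousAt).continuousWithinAt

lemma sheetSign_mul_self (q : Phase N) (n : ℕ) : sheetSign q n * sheetSign q n = 1 := by
  unfold sheetSign; split_ifs <;> norm_num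

lemma dir_mem_gap {q : Phase N} (hq : q ∈ phaseSpace N) (hN : 2 ≤ N) {n : ℕ}
    (h1 : 1 ≤ n) (h2 : n ≤ N - 1) :
    dir q n ∈ Set.Icc (lam q (2 * n)) (lam q (2 * n + 1)) :=
  (band_structure hq hN).2 n h1 h2

/-- The starred root in terms of the position of the Dirichlet eigenvalue in its gap. -/
lemma starRoot_mul_weight {q : Phase N} (hq : q ∈ phaseSpace N) (hN : 2 ≤ N) {n : ℕ}
    (h1 : 1 ≤ n) (h2 : n ≤ N - 1) :
    starRoot q n * weight q n (dir q n) = sheetSign q n *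
      √((dir q n - lam q (2 * n)) * (lam q (2 * n + 1) - dir q n)) := by
  have hm := dir_mem_gap hq hN h1 h2
  have hw := weight_pos hq hN h1 h2 (gap_subset_gapNhd hq hN h1 h2 hm)
  have h := sqrt_discr_sq hq hN h1 h2 hm
  have hsq := discr_sq_at_dir hq hN (j := n - 1) (by omega)
  rw [Nat.sub_add_cancel h1] at hsq
  rw [hsq, Real.sqrt_sq_eq_abs, eq_div_iff hw.ne'] at h
  rw [← h, ← mul_assoc]
  congr 1
  unfold sheetSign
  split_ifs with hs
  · rw [abs_of_nonneg hs, one_mul]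
  · rw [abs_of_neg (not_le.1 hs)]; ring

/-- The angle `η_n` as an integral against the arcsine density. -/
lemma eta_eq {q : Phase N} (hq : q ∈ phaseSpace N) (hN : 2 ≤ N) {n : ℕ}
    (h1 : 1 ≤ n) (h2 : n ≤ N - 1) :
    eta q n = ((∫ x in (lam q (2 * n))..(dir q n), sheetSign q n * (gapDensity q n x *
      (√((x - lam q (2 * n)) * (lam q (2 * n + 1) - x)))⁻¹) : ℝ) : ℂ) := by
  have hm := dir_mem_gap hq hN h1 h2
  rw [eta, ← intervalIntegral.integral_ofReal]
  refine intervalIntegral.integral_congr fun x hx => ?_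
  rw [Set.uIcc_of_le hm.1] at hx
  have hx' : x ∈ Set.Icc (lam q (2 * n)) (lam q (2 * n + 1)) := ⟨hx.1, hx.2.trans hm.2⟩
  have hs := sheetSign_mul_self q n
  rw [abelianPoly_eval hq hN, ← Complex.ofReal_div, sqrt_discr_sq hq hN h1 h2 hx', gapDensity]
  congr 1
  have hinv : (sheetSign q n)⁻¹ = sheetSign q n := inv_eq_of_mul_eq_one_right hs
  rw [div_eq_mul_inv, mul_inv, hinv, inv_div, div_eq_mul_inv]
  ring

/-- If the gap density is close to the sign `s`, then `γ_n e^{i η_n}` is close to the value for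
constant density `s`, which is elementary. -/
lemma zPlus_approx {q : Phase N} (hq : q ∈ phaseSpace N) (hN : 2 ≤ N) {n : ℕ}
    (h1 : 1 ≤ n) (h2 : n ≤ N - 1) {s e : ℝ} (hs : s * s = 1)
    (he : ∀ x ∈ Set.Icc (lam q (2 * n)) (lam q (2 * n + 1)), |gapDensity q n x - s| ≤ e) :
    ‖zPlus n q - (((2 * (mid q n - dir q n) : ℝ) : ℂ) +
      ((2 * s * (starRoot q n * weight q n (dir q n)) : ℝ) : ℂ) * Complex.I)‖ ≤
      gap q n * (e * Real.pi) := by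
  have hm := dir_mem_gap hq hN h1 h2
  rw [starRoot_mul_weight hq hN h1 h2]
  have hg := gap_nonneg q hN h1 h2
  have hc1 : lam q (2 * n) = mid q n - gap q n / 2 := by unfold mid gap; ring
  have hc2 : lam q (2 * n + 1) = mid q n + gap q n / 2 := by unfold mid gap; ring
  rcases hg.eq_or_lt with hg0 | hgpos
  · rw [← hg0] at hc1 hc2
    have hd : dir q n = mid q n := by
      rw [hc1, hc2] at hm; linarith [hm.1, hm.2]
    rw [zPlus, ← hg0, hd, hc1, hc2]
    simp
  have hr : 0 < gap q n / 2 := by linarith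
  have he0 : 0 ≤ e := (abs_nonneg _).trans (he _ hm)
  set k : ℝ → ℝ := fun x => (√((x - lam q (2 * n)) * (lam q (2 * n + 1) - x)))⁻¹ with hk
  set σ := sheetSign q n with hσ
  have hσσ : σ * σ = 1 := sheetSign_mul_self q n
  set θ := Real.arccos ((mid q n - dir q n) / (gap q n / 2)) with hθ
  obtain ⟨hkint, hkval⟩ : IntervalIntegrable k MeasureTheory.volume (lam q (2 * n)) (dir q n) ∧
      ∫ x in (lam q (2 * n))..(dir q n), k x = θ := by
    have := integral_inv_sqrt (m := mid q n) (r := gap q n / 2) (y := dir q n) hr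
      (by rw [← hc1]; exact hm.1) (by rw [← hc2]; exact hm.2)
    rw [← hc1, ← hc2] at this
    exact this
  have hDc : ContinuousOn (gapDensity q n) (Set.uIcc (lam q (2 * n)) (dir q n)) := by
    rw [Set.uIcc_of_le hm.1]
    exact (gapDensity_continuousOn hq hN h1 h2).mono (Set.Icc_subset_Icc_right hm.2)
  have hDint : IntervalIntegrable (fun x => gapDensity q n x * k x) MeasureTheory.volume
      (lam q (2 * n)) (dir q n) := hkint.continuousOn_mul hDc
  set η := ∫ x in (lam q (2 * n))..(dir q n), σ * (gapDensity q n x * k x) with hη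
  have hηdiff : |η - s * σ * θ| ≤ e * Real.pi := by
    have e1 : η - s * σ * θ = σ * ∫ x in (lam q (2 * n))..(dir q n), (gapDensity q n x - s) * k x := by
      have : ∫ x in (lam q (2 * n))..(dir q n), (gapDensity q n x - s) * k x =
          (∫ x in (lam q (2 * n))..(dir q n), gapDensity q n x * k x) - s * θ := by
        rw [← hkval, ← intervalIntegral.integral_const_mul,
          ← intervalIntegral.integral_sub hDint (hkint.const_mul s)]
        exact intervalIntegral.integral_congr fun x _ => by ring
      rw [this, hη, intervalIntegral.integral_const_mul]
      ring
    have e2 : |σ| = 1 := by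
      have : |σ| * |σ| = 1 := by rw [← abs_mul, hσσ, abs_one]
      nlinarith [abs_nonneg σ]
    rw [e1, abs_mul, e2, one_mul]
    have hbound := intervalIntegral.norm_integral_le_of_norm_le hm.1 (g := fun x => e * k x)
      (f := fun x => (gapDensity q n x - s) * k x) (Filter.Eventually.of_forall fun x hx => by
        rw [Real.norm_eq_abs, abs_mul, abs_of_nonneg (inv_nonneg.2 (Real.sqrt_nonneg _))]
        exact mul_le_mul_of_nonneg_right (he x ⟨hx.1.le, hx.2.trans hm.2⟩)
          (inv_nonneg.2 (Real.sqrt_nonneg _))) (hkint.const_mul e)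
    rw [intervalIntegral.integral_const_mul, hkval, Real.norm_eq_abs] at hbound
    exact hbound.trans (mul_le_mul_of_nonneg_left (Real.arccos_le_pi _) he0)
  -- For constant density `s` the angle is `s σ θ`, with `θ` the arcsine angle of `μ_n` in its gap.
  have hsgn : s * σ = 1 ∨ s * σ = -1 := by
    apply mul_self_eq_one_iff.1
    linear_combination σ * σ * hs + hσσ
  have hcos : gap q n * Real.cos (s * σ * θ) = 2 * (mid q n - dir q n) := by
    have : Real.cos (s * σ * θ) = Real.cos θ := by
      rcases hsgn with h | h <;> rw [h] <;> simp
    rw [this, hθ, Real.cos_arccos]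
    · field_simp
    · rw [le_div_iff₀ hr]; linarith [hm.2]
    · rw [div_le_iff₀ hr]; linarith [hm.1]
  have hsin : gap q n * Real.sin (s * σ * θ) =
      2 * s * (σ * √((dir q n - lam q (2 * n)) * (lam q (2 * n + 1) - dir q n))) := by
    have : Real.sin (s * σ * θ) = s * σ * Real.sin θ := by
      rcases hsgn with h | h <;> rw [h] <;> simp
    rw [this, hθ, Real.sin_arccos]
    have e : (dir q n - lam q (2 * n)) * (lam q (2 * n + 1) - dir q n) =
        (1 - ((mid q n - dir q n) / (gap q n / 2)) ^ 2) * (gap q n / 2) ^ 2 := by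
      rw [hc1, hc2]; field_simp; ring
    rw [e, Real.sqrt_mul' _ (sq_nonneg _), Real.sqrt_sq hr.le]
    ring
  have hz0 : (((2 * (mid q n - dir q n) : ℝ) : ℂ) +
      ((2 * s * (σ * √((dir q n - lam q (2 * n)) * (lam q (2 * n + 1) - dir q n))) : ℝ) : ℂ) *
        Complex.I) = gap q n * Complex.exp (Complex.I * (s * σ * θ : ℝ)) := by
    rw [← hcos, ← hsin, mul_comm Complex.I, Complex.exp_mul_I, ← Complex.ofReal_cos,
      ← Complex.ofReal_sin]
    push_cast
    ring
  have hz : zPlus n q = gap q n * Complex.exp (Complex.I * (η : ℝ)) := by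
    rw [zPlus, eta_eq hq hN h1 h2]
  have hexp : Complex.exp (Complex.I * (η : ℝ)) - Complex.exp (Complex.I * (s * σ * θ : ℝ)) =
      Complex.exp (Complex.I * (s * σ * θ : ℝ)) *
        (Complex.exp (Complex.I * (η - s * σ * θ : ℝ)) - 1) := by
    rw [mul_sub, ← Complex.exp_add, mul_one]
    congr 2
    push_cast; ring
  rw [hz, hz0, ← mul_sub, hexp, norm_mul, norm_mul, mul_comm Complex.I (s * σ * θ : ℝ),
    Complex.norm_exp_ofReal_mul_I, one_mul, Complex.norm_real, Real.norm_of_nonneg hg]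
  refine mul_le_mul_of_nonneg_left ?_ hg
  refine (Real.norm_exp_I_mul_ofReal_sub_one_le).trans ?_
  rw [Real.norm_eq_abs]
  exact hηdiff

end Angle

/-! ### First-order perturbation of the monodromy matrix -/

section Collapsed

variable {N : ℕ} [NeZero N] {p : Phase N} {n : ℕ}

lemma lam_eq_dir_of_collapsed (hp : p ∈ phaseSpace N) (hN : 2 ≤ N) (h1 : 1 ≤ n) (h2 : n ≤ N - 1)
    (hgap : gap p n = 0) : lam p (2 * n) = dir p n ∧ lam p (2 * n + 1) = dir p n := by
  have hm := dir_mem_gap hp hN h1 h2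
  unfold gap at hgap
  constructor <;> linarith [hm.1, hm.2]

/-- A collapsed gap is a double zero of `Δ² - 4`. -/
lemma derivative_discr_sq_collapsed (hp : p ∈ phaseSpace N) (hN : 2 ≤ N) (h1 : 1 ≤ n)
    (h2 : n ≤ N - 1) (hgap : gap p n = 0) :
    (derivative (discr p ^ 2 - 4)).eval (dir p n) = 0 := by
  obtain ⟨l1, l2⟩ := lam_eq_dir_of_collapsed hp hN h1 h2 hgap
  have hne : (∏ j, p.2 j) ^ 2 ≠ 0 := pow_ne_zero _ (Finset.prod_pos fun j _ => hp j).ne'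
  have h := charpoly_Q hp hN
  rw [charpoly_Q_eq_prod p hN,
    ← Finset.mul_prod_erase _ _ (Finset.mem_range.2 (show 2 * n - 1 < 2 * N by omega)),
    ← Finset.mul_prod_erase _ _ (Finset.mem_erase.2 ⟨show 2 * n ≠ 2 * n - 1 by omega,
      Finset.mem_range.2 (show 2 * n < 2 * N by omega)⟩),
    show 2 * n - 1 + 1 = 2 * n by omega, l1, l2] at h
  have h' := congrArg (fun f : ℝ[X] => (derivative f).eval (dir p n)) h
  simp only [derivative_mul, derivative_X_sub_C, derivative_C, eval_add, eval_mul, eval_sub, eval_X,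
    eval_C, sub_self, zero_mul, mul_zero, zero_add, add_zero, eval_one] at h'
  exact (mul_eq_zero.1 h'.symm).resolve_left hne

/-- At a collapsed gap all solutions are periodic or all are antiperiodic. -/
lemma monodromy_collapsed (hp : p ∈ phaseSpace N) (hN : 2 ≤ N) (h1 : 1 ≤ n)
    (h2 : n ≤ N - 1) (hgap : gap p n = 0) :
    (y₁ p N).eval (dir p n) = -(-1) ^ (N - 1 - n) ∧ (y₂ p N).eval (dir p n) = 0 ∧
      (y₁ p (N + 1)).eval (dir p n) = 0 ∧ (y₂ p (N + 1)).eval (dir p n) = -(-1) ^ (N - 1 - n) := by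
  obtain ⟨l1, l2⟩ := lam_eq_dir_of_collapsed hp hN h1 h2 hgap
  obtain ⟨hroots, hsign⟩ := dir_rootSeq hp hN
  have hmon := monodromy_at_dir hp hN (j := n - 1) (by omega)
  have hs := hsign (n - 1) (by omega)
  have hstar := discr_sq_at_dir hp hN (j := n - 1) (by omega)
  rw [Nat.sub_add_cancel h1] at hmon hs hstar
  obtain ⟨hC, hAD⟩ := hmon
  rw [(discr_sq_eq_zero_iff hp hN _).2 ⟨2 * n, by omega, by omega, l1.symm⟩] at hstar
  have hstar0 : starRoot p n = 0 := pow_eq_zero_iff two_ne_zero |>.1 hstar.symm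
  have hAD' : (y₁ p N).eval (dir p n) = (y₂ p (N + 1)).eval (dir p n) := sub_eq_zero.1 hstar0
  -- `Δ² - 4 = (A - D)² + 4 C B` has a double zero here and `C` a simple one, so `B` vanishes.
  have hC' : (derivative (y₁ p (N + 1))).eval (dir p n) ≠ 0 := by
    intro h
    have hm := hroots.rootMultiplicity_eq_one (j := n - 1) (by omega)
    simp only [Nat.sub_add_cancel h1] at hm
    have := (one_lt_rootMultiplicity_iff_isRoot hroots.ne_zero).2 ⟨hC, h⟩
    omega
  have hB : (y₂ p N).eval (dir p n) = 0 := by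
    have hd := derivative_discr_sq_collapsed hp hN h1 h2 hgap
    rw [discr_sq_sub_four hp] at hd
    simp only [derivative_add, derivative_mul, derivative_pow, derivative_sub, eval_add, eval_mul,
      eval_sub, eval_pow, hC, hAD', derivative_ofNat, eval_zero, sub_self] at hd
    have : (derivative (y₁ p (N + 1))).eval (dir p n) * (y₂ p N).eval (dir p n) = 0 := by
      simpa using hd
    exact (mul_eq_zero.1 this).resolve_left hC'
  have hpar : ((-1 : ℝ)) ^ (N - 1 + (n - 1)) = -(-1) ^ (N - 1 - n) := by
    rw [show N - 1 + (n - 1) = (N - 1 - n) + (2 * (n - 1) + 1) by omega, pow_add, pow_succ, pow_mul]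
    simp
  rw [hpar] at hs
  have hA : (y₁ p N).eval (dir p n) = -(-1) ^ (N - 1 - n) := by
    rw [← hAD'] at hAD
    have hss : ((-1 : ℝ)) ^ (N - 1 - n) = 1 ∨ ((-1 : ℝ)) ^ (N - 1 - n) = -1 :=
      neg_one_pow_eq_or ℝ _
    -- `A² = 1`, and the sign of `A` is known from the Sturm property.
    rcases hss with h | h <;> rw [h] at hs ⊢ <;> rcases mul_self_eq_one_iff.1 hAD with h' | h' <;>
      rw [h'] at hs <;> linarith
  exact ⟨hA, hB, hC, by rw [← hAD', hA]⟩

end Collapsed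

section Green

variable {N : ℕ} [NeZero N]

/-- The bilinear form `⟨v ·_s w, (β, α)⟩` on `ℝ^{2N}`. -/
def pairing (v w : ℕ → ℝ) (d : Phase N) : ℝ :=
  ∑ j : Fin N, (d.1 j * (v (j.val + 1) * w (j.val + 1)) +
    d.2 j * (v (j.val + 1) * w (j.val + 2) + w (j.val + 1) * v (j.val + 2)))

/-- Green's identity for solutions `v` at `(p, l)` and `y` at `(q, x)`. -/
lemma green {p q : Phase N} {l x : ℝ} {v y : ℕ → ℝ} (hv : Solves p l v) (hy : Solves q x y) (m : ℕ) :
    aSeq p m * (v m * y (m + 1) - v (m + 1) * y m) - aSeq p 0 * (v 0 * y 1 - v 1 * y 0) =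
      ∑ k ∈ Finset.range m, ((x - l) * (v (k + 1) * y (k + 1))
        - (bSeq q (k + 1) - bSeq p (k + 1)) * (v (k + 1) * y (k + 1))
        - (aSeq q (k + 1) - aSeq p (k + 1)) * (v (k + 1) * y (k + 2))
        - (aSeq q k - aSeq p k) * (v (k + 1) * y k)) := by
  induction m with
  | zero => simp
  | succ m ih =>
    rw [Finset.sum_range_succ, ← ih]
    have e1 := hv (m + 1) (by omega)
    have e2 := hy (m + 1) (by omega)
    simp only [Nat.add_sub_cancel] at e1 e2
    linear_combination -(y (m + 1)) * e1 + v (m + 1) * e2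

/-- For two periodic or two antiperiodic sequences, the pairing with `q - p` is the perturbation
term of Green's identity over one period. -/
lemma pairing_eq_range (v w : ℕ → ℝ) (p q : Phase N) {e : ℝ} (he : e * e = 1)
    (hv : v (N + 1) = e * v 1) (hw : w N = e * w 0) :
    pairing v w (q - p) = ∑ k ∈ Finset.range N,
      ((bSeq q (k + 1) - bSeq p (k + 1)) * (v (k + 1) * w (k + 1))
        + (aSeq q (k + 1) - aSeq p (k + 1)) * (v (k + 1) * w (k + 2))
        + (aSeq q k - aSeq p k) * (v (k + 1) * w k)) := by
  have hshift : ∑ k ∈ Finset.range N, (aSeq q k - aSeq p k) * (v (k + 1) * w k) =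
      ∑ k ∈ Finset.range N, (aSeq q (k + 1) - aSeq p (k + 1)) * (v (k + 2) * w (k + 1)) := by
    have h1 := Finset.sum_range_succ (fun k => (aSeq q k - aSeq p k) * (v (k + 1) * w k)) N
    have h2 := Finset.sum_range_succ' (fun k => (aSeq q k - aSeq p k) * (v (k + 1) * w k)) N
    rw [h1, aSeq_period, aSeq_period, hv, hw] at h2
    simp only [zero_add] at h2
    linear_combination h2 - (aSeq q 0 - aSeq p 0) * v 1 * w 0 * he
  rw [Finset.sum_add_distrib, hshift, ← Finset.sum_add_distrib, Finset.sum_range, pairing]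
  refine Finset.sum_congr rfl fun j _ => ?_
  simp only [bSeq, aSeq, per_succ, Prod.fst_sub, Prod.snd_sub, Pi.sub_apply]
  ring

open Asymptotics Filter Topology

lemma abs_aSeq_sub_le (p q : Phase N) (k : ℕ) : |aSeq q k - aSeq p k| ≤ ‖q - p‖ := by
  unfold aSeq per
  exact (norm_le_pi_norm (q.2 - p.2) _).trans (norm_snd_le (q - p))

lemma abs_bSeq_sub_le (p q : Phase N) (k : ℕ) : |bSeq q k - bSeq p k| ≤ ‖q - p‖ := by
  unfold bSeq per
  exact (norm_le_pi_norm (q.1 - p.1) _).trans (norm_fst_le (q - p))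

/-- The matrix element `a_0 e W(v, Y) - a_0 W(v, w)` between two pairs of initial values `v`, `w`,
where `Y` is the image of `w` under the monodromy matrix at `z` and `W` is the Wronskian form.  It
vanishes where the monodromy matrix is `e = ±1`. -/
noncomputable def monodromyForm (p : Phase N) (e : ℝ) (v w : ℕ → ℝ) (z : Phase N × ℝ) : ℝ :=
  aSeq p 0 * (e * (v 0 * (solPoly z.1 (w 0) (w 1) (N + 1)).eval z.2
    - v 1 * (solPoly z.1 (w 0) (w 1) N).eval z.2) - (v 0 * w 1 - v 1 * w 0))

/-- First-order expansion of the matrix elements of the monodromy matrix at a point where it is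
`e = ±1`.  By Green's identity it only needs the continuity of solutions. -/
lemma monodromy_expansion {p : Phase N} (hp : p ∈ phaseSpace N) {l e : ℝ} (he : e * e = 1)
    {v w : ℕ → ℝ} (hv : Solves p l v) (hw : Solves p l w)
    (hv0 : v N = e * v 0) (hv1 : v (N + 1) = e * v 1) (hw0 : w N = e * w 0) :
    (fun z : Phase N × ℝ => monodromyForm p e v w z
        - ((z.2 - l) * (∑ j ∈ Finset.Icc 1 N, v j * w j) - pairing v w (z.1 - p)))
      =o[𝓝 (p, l)] fun z => z - (p, l) := by
  set Y : Phase N × ℝ → ℕ → ℝ := fun z k => (solPoly z.1 (w 0) (w 1) k).eval z.2 with hY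
  have hY0 : ∀ k, Y (p, l) k = w k := fun k => (hw.eq_solPoly hp k).symm
  have hYo : ∀ k, (fun z => Y z k - w k) =o[𝓝 (p, l)] fun _ => (1 : ℝ) := by
    intro k
    rw [isLittleO_one_iff, ← hY0 k]
    have := (solPoly_continuousAt hp (w 0) (w 1) l k).tendsto
    exact tendsto_sub_nhds_zero_iff.2 this
  have hx : (fun z : Phase N × ℝ => z.2 - l) =O[𝓝 (p, l)] fun z => z - (p, l) :=
    IsBigO.of_bound 1 (Eventually.of_forall fun z => by
      rw [one_mul]; exact norm_snd_le (z - (p, l)))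
  have hA : ∀ k, (fun z : Phase N × ℝ => aSeq z.1 k - aSeq p k) =O[𝓝 (p, l)] fun z => z - (p, l) :=
    fun k => IsBigO.of_bound 1 (Eventually.of_forall fun z => by
      rw [one_mul]
      exact (abs_aSeq_sub_le p z.1 k).trans (norm_fst_le (z - (p, l))))
  have hB : ∀ k, (fun z : Phase N × ℝ => bSeq z.1 k - bSeq p k) =O[𝓝 (p, l)] fun z => z - (p, l) :=
    fun k => IsBigO.of_bound 1 (Eventually.of_forall fun z => by
      rw [one_mul]
      exact (abs_bSeq_sub_le p z.1 k).trans (norm_fst_le (z - (p, l))))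
  have hmul : ∀ {f : Phase N × ℝ → ℝ} (_ : f =O[𝓝 (p, l)] fun z => z - (p, l)) (c : ℝ) (k : ℕ),
      (fun z => f z * (c * (Y z k - w k))) =o[𝓝 (p, l)] fun z => z - (p, l) := by
    intro f hf c k
    have h1 : (fun z => c * (Y z k - w k)) =o[𝓝 (p, l)] fun _ => (1 : ℝ) :=
      (hYo k).const_mul_left c
    have := hf.norm_right.mul_isLittleO h1
    simp only [mul_one] at this
    exact this.of_norm_right
  have hsum : (fun z : Phase N × ℝ => ∑ k ∈ Finset.range N,
      ((z.2 - l) * (v (k + 1) * (Y z (k + 1) - w (k + 1)))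
        - (bSeq z.1 (k + 1) - bSeq p (k + 1)) * (v (k + 1) * (Y z (k + 1) - w (k + 1)))
        - (aSeq z.1 (k + 1) - aSeq p (k + 1)) * (v (k + 1) * (Y z (k + 2) - w (k + 2)))
        - (aSeq z.1 k - aSeq p k) * (v (k + 1) * (Y z k - w k))))
      =o[𝓝 (p, l)] fun z => z - (p, l) :=
    IsLittleO.fun_sum fun k _ => (((hmul hx _ _).sub (hmul (hB _) _ _)).sub (hmul (hA _) _ _)).sub
      (hmul (hA _) _ _)
  refine hsum.congr' ?_ EventuallyEq.rfl
  have hev : ∀ᶠ z : Phase N × ℝ in 𝓝 (p, l), z.1 ∈ phaseSpace N :=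
    continuousAt_fst.eventually ((isOpen_phaseSpace N).mem_nhds hp)
  filter_upwards [hev] with z hz
  have hg := green hv (solves_solPoly hz (w 0) (w 1) z.2) N
  have hs0 : (solPoly z.1 (w 0) (w 1) 0).eval z.2 = w 0 := by simp [solPoly]
  have hs1 : (solPoly z.1 (w 0) (w 1) 1).eval z.2 = w 1 := by simp [solPoly]
  simp only [hs0, hs1] at hg
  rw [aSeq_period, hv0, hv1] at hg
  have hIcc : ∑ j ∈ Finset.Icc 1 N, v j * w j = ∑ k ∈ Finset.range N, v (k + 1) * w (k + 1) := by
    rw [Finset.range_eq_Ico, Finset.sum_Ico_add' (fun k => v k * w k) 0 N 1]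
    rfl
  rw [pairing_eq_range v w p z.1 he hv1 hw0, hIcc, Finset.mul_sum, ← Finset.sum_sub_distrib]
  have : aSeq p 0 * (e * (v 0 * Y z (N + 1) - v 1 * Y z N) - (v 0 * w 1 - v 1 * w 0)) =
      aSeq p 0 * (e * v 0 * Y z (N + 1) - e * v 1 * Y z N) - aSeq p 0 * (v 0 * w 1 - v 1 * w 0) := by
    ring
  change _ = aSeq p 0 * (e * (v 0 * Y z (N + 1) - v 1 * Y z N) - (v 0 * w 1 - v 1 * w 0)) - _
  rw [this, hg, ← Finset.sum_sub_distrib]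
  exact Finset.sum_congr rfl fun k _ => by simp only [hY]; ring

end Green

/-! ### The edges of an opening gap and the Dirichlet eigenvalue to first order -/

open Asymptotics Filter Topology

section Pairing

variable {N : ℕ}

lemma pairing_comm (v w : ℕ → ℝ) (d : Phase N) : pairing v w d = pairing w v d := by
  unfold pairing
  exact Finset.sum_congr rfl fun j _ => by ring

lemma pairing_isBigO (v w : ℕ → ℝ) (l : Filter (Phase N)) :
    (fun d => pairing v w d) =O[l] fun d => d := by
  unfold pairing
  refine IsBigO.fun_sum fun j _ => IsBigO.add ?_ ?_
  · refine (IsBigO.of_bound ‖v (j.val + 1) * w (j.val + 1)‖ (Eventually.of_forall fun d => ?_))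
    rw [norm_mul, mul_comm]
    exact mul_le_mul_of_nonneg_left ((norm_le_pi_norm d.1 j).trans (norm_fst_le d)) (norm_nonneg _)
  · refine (IsBigO.of_bound ‖v (j.val + 1) * w (j.val + 2) + w (j.val + 1) * v (j.val + 2)‖
      (Eventually.of_forall fun d => ?_))
    rw [norm_mul, mul_comm]
    exact mul_le_mul_of_nonneg_left ((norm_le_pi_norm d.2 j).trans (norm_snd_le d)) (norm_nonneg _)

lemma pairing_sub_isBigO (v w : ℕ → ℝ) (p : Phase N) :
    (fun q => pairing v w (q - p)) =O[𝓝 p] fun q => q - p :=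
  (pairing_isBigO v w ⊤).comp_tendsto tendsto_top

lemma tendsto_shift (p : Phase N) (l c : ℝ) :
    Tendsto (fun q : Phase N => ((q, l + c * ‖q - p‖) : Phase N × ℝ)) (𝓝 p) (𝓝 (p, l)) := by
  have : Continuous fun q : Phase N => ((q, l + c * ‖q - p‖) : Phase N × ℝ) := by fun_prop
  have h0 := this.tendsto p
  simpa using h0

/-- The linear parts of the forms in `monodromy_expansion`. -/
lemma linearForm_isBigO (p : Phase N) (l : ℝ) (v w : ℕ → ℝ) (c : ℝ) :
    (fun z : Phase N × ℝ => (z.2 - l) * c - pairing v w (z.1 - p))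
      =O[𝓝 (p, l)] fun z => ‖z - (p, l)‖ := by
  refine IsBigO.norm_right (IsBigO.sub ?_ ?_)
  · refine IsBigO.of_bound ‖c‖ (Eventually.of_forall fun z => ?_)
    rw [norm_mul, mul_comm]
    exact mul_le_mul_of_nonneg_left (norm_snd_le (z - (p, l))) (norm_nonneg _)
  · have h1 : (fun z : Phase N × ℝ => pairing v w (z.1 - p)) =O[𝓝 (p, l)] fun z => z.1 - p :=
      (pairing_isBigO v w ⊤).comp_tendsto tendsto_top
    exact h1.trans (IsBigO.of_bound 1 (Eventually.of_forall fun z => by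
      rw [one_mul]; exact norm_fst_le (z - (p, l))))

lemma isLittleO_mul_sub_mul {α : Type*} {l : Filter α} {f f' k k' u : α → ℝ}
    (h1 : (fun z => f z - f' z) =o[l] u) (h2 : (fun z => k z - k' z) =o[l] u)
    (h1' : f' =O[l] u) (h2' : k' =O[l] u) :
    (fun z => f z * k z - f' z * k' z) =o[l] fun z => u z * u z := by
  have hf : f =O[l] u := by
    simpa using h1.isBigO.add h1'
  refine ((h1.mul_isBigO h2').add (hf.mul_isLittleO h2)).congr_left fun z => ?_
  ring

/-- If `f = k` up to terms small against `‖u‖` and `|f|`, then `f = k` up to terms small against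
`‖u‖`. -/
lemma isLittleO_of_self {α E : Type*} [NormedAddCommGroup E] {l : Filter α} {f k : α → ℝ}
    {u : α → E} {w : α → ℝ} (hfk : (fun z => f z - k z) =o[l] w)
    (hw : ∀ z, |w z| ≤ ‖u z‖ + |f z|) (hk : k =O[l] u) : (fun z => f z - k z) =o[l] u ∧ w =O[l] u := by
  have hwu : w =O[l] u := by
    obtain ⟨c, hc⟩ := hk.bound
    refine IsBigO.of_bound (2 + 2 * c) ?_
    filter_upwards [hc, hfk.bound (show (0 : ℝ) < 1 / 2 by norm_num)] with z h1 h2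
    simp only [Real.norm_eq_abs] at h1 h2 ⊢
    have h3 : |f z| ≤ |f z - k z| + |k z| := by
      simpa using abs_add_le (f z - k z) (k z)
    have := hw z
    linarith
  exact ⟨hfk.trans_isBigO hwu, hwu⟩

end Pairing

section Frame

variable {N : ℕ} [NeZero N]

/-- The common eigenvalue `±1` of the monodromy matrix at the `n`-th gap, if that gap is
collapsed. -/
def collapsedSign (N n : ℕ) : ℝ := -(-1) ^ (N - 1 - n)

lemma collapsedSign_mul_self (N n : ℕ) : collapsedSign N n * collapsedSign N n = 1 := by
  unfold collapsedSign
  rcases neg_one_pow_eq_or ℝ (N - 1 - n) with h | h <;> rw [h] <;> norm_num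

/-- A point `p` of the phase space whose `n`-th gap is collapsed, with the orthonormal basis
`g = g_n`, `h = h_n` of solutions at that gap. -/
structure CollapsedFrame (p : Phase N) (n : ℕ) (g h : ℕ → ℝ) : Prop where
  mem : p ∈ phaseSpace N
  one_le : 1 ≤ n
  le : n ≤ N - 1
  gap_eq : gap p n = 0
  dirichlet : IsDirichletVector p n g
  conjugate : IsConjugateVector p n g h

namespace CollapsedFrame

variable {p : Phase N} {n : ℕ} {g h : ℕ → ℝ}

lemma two_le (F : CollapsedFrame p n g h) : 2 ≤ N := by
  have := F.one_le; have := F.le; omega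

lemma lam_eq (F : CollapsedFrame p n g h) :
    lam p (2 * n) = dir p n ∧ lam p (2 * n + 1) = dir p n :=
  lam_eq_dir_of_collapsed F.mem F.two_le F.one_le F.le F.gap_eq

lemma dir_mem_gapNhd (F : CollapsedFrame p n g h) : dir p n ∈ gapNhd p n :=
  gap_subset_gapNhd F.mem F.two_le F.one_le F.le (dir_mem_gap F.mem F.two_le F.one_le F.le)

/-- Multiplication by `±1` over a period, for every solution at a collapsed gap. -/
lemma period (F : CollapsedFrame p n g h) {y : ℕ → ℝ} (hy : Solves p (dir p n) y) :
    y N = collapsedSign N n * y 0 ∧ y (N + 1) = collapsedSign N n * y 1 := by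
  obtain ⟨hA, hB, hC, hD⟩ := monodromy_collapsed F.mem F.two_le F.one_le F.le F.gap_eq
  rw [hy.eq_fundamental F.mem N, hy.eq_fundamental F.mem (N + 1), hA, hB, hC, hD, collapsedSign]
  constructor <;> ring

/-- The Wronskian `κ = a_0 g(0) h(1)` of `g` and `h`, as `g(1) = 0`. -/
def wron (p : Phase N) (g h : ℕ → ℝ) : ℝ := aSeq p 0 * g 0 * h 1

lemma wron_pos (F : CollapsedFrame p n g h) : 0 < wron p g h :=
  mul_pos (mul_pos (aSeq_pos F.mem 0) F.dirichlet.at_zero) F.conjugate.at_one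

/-- `monodromy_expansion` at a collapsed gap, for solutions with inner product `c` over a period. -/
lemma expansion (F : CollapsedFrame p n g h) {v w : ℕ → ℝ} (hv : Solves p (dir p n) v)
    (hw : Solves p (dir p n) w) {c : ℝ} (hc : ∑ j ∈ Finset.Icc 1 N, v j * w j = c) :
    (fun z : Phase N × ℝ => monodromyForm p (collapsedSign N n) v w z
        - ((z.2 - dir p n) * c - pairing v w (z.1 - p)))
      =o[𝓝 (p, dir p n)] fun z => ‖z - (p, dir p n)‖ := by
  rw [← hc]
  exact (monodromy_expansion F.mem (collapsedSign_mul_self N n) hv hw (F.period hv).1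
    (F.period hv).2 (F.period hw).1).norm_right

lemma expansion_gg (F : CollapsedFrame p n g h) :
    (fun z : Phase N × ℝ => monodromyForm p (collapsedSign N n) g g z
        - ((z.2 - dir p n) * 1 - pairing g g (z.1 - p)))
      =o[𝓝 (p, dir p n)] fun z => ‖z - (p, dir p n)‖ :=
  F.expansion F.dirichlet.solves F.dirichlet.solves
    (by simpa only [pow_two] using F.dirichlet.normalized)

lemma expansion_hh (F : CollapsedFrame p n g h) :
    (fun z : Phase N × ℝ => monodromyForm p (collapsedSign N n) h h z
        - ((z.2 - dir p n) * 1 - pairing h h (z.1 - p)))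
      =o[𝓝 (p, dir p n)] fun z => ‖z - (p, dir p n)‖ :=
  F.expansion F.conjugate.solves F.conjugate.solves
    (by simpa only [pow_two] using F.conjugate.normalized)

lemma expansion_gh (F : CollapsedFrame p n g h) :
    (fun z : Phase N × ℝ => monodromyForm p (collapsedSign N n) g h z
        - ((z.2 - dir p n) * 0 - pairing g h (z.1 - p)))
      =o[𝓝 (p, dir p n)] fun z => ‖z - (p, dir p n)‖ :=
  F.expansion F.dirichlet.solves F.conjugate.solves
    (by simpa only [mul_comm] using F.conjugate.orthogonal)

lemma expansion_hg (F : CollapsedFrame p n g h) :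
    (fun z : Phase N × ℝ => monodromyForm p (collapsedSign N n) h g z
        - ((z.2 - dir p n) * 0 - pairing h g (z.1 - p)))
      =o[𝓝 (p, dir p n)] fun z => ‖z - (p, dir p n)‖ :=
  F.expansion F.conjugate.solves F.dirichlet.solves F.conjugate.orthogonal

/-- The determinant of the forms is the discriminant up to a factor, as the monodromy matrix is
unimodular. -/
lemma det_form (F : CollapsedFrame p n g h) {z : Phase N × ℝ} (hz : z.1 ∈ phaseSpace N) :
    monodromyForm p (collapsedSign N n) g g z * monodromyForm p (collapsedSign N n) h h z
      - monodromyForm p (collapsedSign N n) g h z * monodromyForm p (collapsedSign N n) h g z =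
    wron p g h ^ 2 * (2 - collapsedSign N n * (discr z.1).eval z.2) := by
  have he := collapsedSign_mul_self N n
  have hg1 := F.dirichlet.at_one
  have hdet := congrArg (eval z.2) (monodromy_det hz)
  simp only [eval_sub, eval_mul, eval_one] at hdet
  simp only [monodromyForm, solPoly_linear, eval_add, eval_mul, eval_C, hg1, discr, wron]
  linear_combination (aSeq p 0 * g 0 * h 1) ^ 2 * (collapsedSign N n ^ 2 * hdet + he)

/-- The quadratic form whose zeros in `X` are the gap edges to first order. -/
lemma det_form_expansion (F : CollapsedFrame p n g h) :
    (fun z : Phase N × ℝ => wron p g h ^ 2 * (2 - collapsedSign N n * (discr z.1).eval z.2)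
        - (((z.2 - dir p n) * 1 - pairing g g (z.1 - p)) *
            ((z.2 - dir p n) * 1 - pairing h h (z.1 - p)) - pairing g h (z.1 - p) ^ 2))
      =o[𝓝 (p, dir p n)] fun z => ‖z - (p, dir p n)‖ * ‖z - (p, dir p n)‖ := by
  have h1 := isLittleO_mul_sub_mul F.expansion_gg F.expansion_hh (linearForm_isBigO _ _ _ _ _)
    (linearForm_isBigO _ _ _ _ _)
  have h2 := isLittleO_mul_sub_mul F.expansion_gh F.expansion_hg (linearForm_isBigO _ _ _ _ _)
    (linearForm_isBigO _ _ _ _ _)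
  refine (h1.sub h2).congr' ?_ EventuallyEq.rfl
  have hev : ∀ᶠ z : Phase N × ℝ in 𝓝 (p, dir p n), z.1 ∈ phaseSpace N :=
    continuousAt_fst.eventually ((isOpen_phaseSpace N).mem_nhds F.mem)
  filter_upwards [hev] with z hz
  rw [← F.det_form hz, pairing_comm h g]
  ring

lemma det_form_isBigO (F : CollapsedFrame p n g h) :
    (fun z : Phase N × ℝ => wron p g h ^ 2 * (2 - collapsedSign N n * (discr z.1).eval z.2))
      =O[𝓝 (p, dir p n)] fun z => ‖z - (p, dir p n)‖ * ‖z - (p, dir p n)‖ := by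
  have h1 : (fun z : Phase N × ℝ => ((z.2 - dir p n) * 1 - pairing g g (z.1 - p)) *
      ((z.2 - dir p n) * 1 - pairing h h (z.1 - p)))
      =O[𝓝 (p, dir p n)] fun z => ‖z - (p, dir p n)‖ * ‖z - (p, dir p n)‖ :=
    (linearForm_isBigO _ _ _ _ _).mul (linearForm_isBigO _ _ _ _ _)
  have h2 := (linearForm_isBigO p (dir p n) g h 0).mul (linearForm_isBigO p (dir p n) g h 0)
  refine (F.det_form_expansion.isBigO.add (h1.sub h2)).congr_left fun z => ?_
  ring

/-- The ratio of `(x - λ_{2n}) (x - λ_{2n+1})` and the determinant of the forms. -/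
noncomputable def edgeRatio (p : Phase N) (n : ℕ) (g h : ℕ → ℝ) (z : Phase N × ℝ) : ℝ :=
  weight z.1 n z.2 ^ 2 * (2 + collapsedSign N n * (discr z.1).eval z.2) / wron p g h ^ 2

lemma edgeRatio_continuousAt (F : CollapsedFrame p n g h) :
    ContinuousAt (edgeRatio p n g h) (p, dir p n) :=
  (((weight_continuousAt F.two_le F.one_le F.le F.dir_mem_gapNhd).pow 2).mul
    (continuousAt_const.add (continuousAt_const.mul (discr_continuousAt F.mem _)))).div_const _

/-- By the factorizations of `Δ² - 4` over the eigenvalues and as `(Δ - 2) (Δ + 2)`. -/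
lemma edges_mul (F : CollapsedFrame p n g h) : ∀ᶠ z : Phase N × ℝ in 𝓝 (p, dir p n),
    (z.2 - lam z.1 (2 * n)) * (z.2 - lam z.1 (2 * n + 1)) = edgeRatio p n g h z *
      (wron p g h ^ 2 * (2 - collapsedSign N n * (discr z.1).eval z.2)) := by
  have hev : ∀ᶠ z : Phase N × ℝ in 𝓝 (p, dir p n), z.1 ∈ phaseSpace N :=
    continuousAt_fst.eventually ((isOpen_phaseSpace N).mem_nhds F.mem)
  have hpos : ∀ᶠ z : Phase N × ℝ in 𝓝 (p, dir p n), 0 < restProd z.1 n z.2 :=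
    (continuous_restProd F.two_le).continuousAt.eventually
      (lt_mem_nhds (restProd_pos F.two_le F.one_le F.le F.dir_mem_gapNhd))
  filter_upwards [hev, hpos] with z hz hr
  have ha : 0 < ∏ j, z.1.2 j := Finset.prod_pos fun j _ => hz j
  have hd := discr_sq_eq_gap_mul hz F.two_le F.one_le F.le z.2
  have hκ := F.wron_pos
  have he := collapsedSign_mul_self N n
  have hw : weight z.1 n z.2 ^ 2 * restProd z.1 n z.2 = (∏ j, z.1.2 j) ^ 2 := by
    rw [weight, div_pow, Real.sq_sqrt hr.le]
    field_simp
  have : edgeRatio p n g h z * (wron p g h ^ 2 * (2 - collapsedSign N n * (discr z.1).eval z.2)) =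
      weight z.1 n z.2 ^ 2 * (4 - (discr z.1).eval z.2 ^ 2) := by
    rw [edgeRatio]
    field_simp
    linear_combination -weight z.1 n z.2 ^ 2 * (discr z.1).eval z.2 ^ 2 * he
  rw [this]
  have hd' : (4 - (discr z.1).eval z.2 ^ 2) * (∏ j, z.1.2 j) ^ 2 =
      (z.2 - lam z.1 (2 * n)) * (z.2 - lam z.1 (2 * n + 1)) * restProd z.1 n z.2 := by
    have : 4 - (discr z.1).eval z.2 ^ 2 = -((discr z.1).eval z.2 ^ 2 - 4) := by ring
    rw [this, hd]
    field_simp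
    ring
  apply mul_right_cancel₀ hr.ne'
  rw [← hd', ← hw]
  ring

/-- At `p` itself both quantities are `(x - μ_n)²` to leading order, which gives the value of the
ratio at the collapsed gap. -/
lemma edgeRatio_eq_one (F : CollapsedFrame p n g h) : edgeRatio p n g h (p, dir p n) = 1 := by
  have hline : Tendsto (fun t : ℝ => ((p, dir p n + t) : Phase N × ℝ)) (𝓝[≠] 0)
      (𝓝 (p, dir p n)) := by
    have : Continuous fun t : ℝ => ((p, dir p n + t) : Phase N × ℝ) := by fun_prop
    have h0 := this.tendsto 0
    rw [add_zero] at h0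
    exact h0.mono_left nhdsWithin_le_nhds
  have h1 := F.det_form_expansion.comp_tendsto hline
  have hV : Tendsto (fun t : ℝ => edgeRatio p n g h (p, dir p n + t)) (𝓝[≠] 0)
      (𝓝 (edgeRatio p n g h (p, dir p n))) := F.edgeRatio_continuousAt.tendsto.comp hline
  have hm := hline.eventually F.edges_mul
  have hpair : ∀ v w, pairing v w (0 : Phase N) = 0 := fun v w => by simp [pairing]
  have hnorm : ∀ t : ℝ, ‖((p, dir p n + t) : Phase N × ℝ) - (p, dir p n)‖ = |t| := fun t => by
    simp [Prod.norm_def]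
  simp only [Function.comp_def, hnorm, sub_self, hpair, abs_mul_abs_self] at h1
  have h2 := (h1.tendsto_div_nhds_zero).add_const 1
  rw [zero_add] at h2
  have h3 := hV.mul h2
  rw [mul_one] at h3
  refine tendsto_nhds_unique h3 (tendsto_const_nhds.congr' ?_)
  filter_upwards [hm, self_mem_nhdsWithin] with t ht ht0
  have ht0' : t ≠ 0 := ht0
  simp only [F.lam_eq.1, F.lam_eq.2, add_sub_cancel_left] at ht ⊢
  field_simp
  linear_combination ht

/-- The weight at the collapsed gap, read off from `edgeRatio_eq_one` and `Δ = ±2`. -/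
lemma weight_eq (F : CollapsedFrame p n g h) : weight p n (dir p n) = wron p g h / 2 := by
  have hκ := F.wron_pos
  have hw := weight_pos F.mem F.two_le F.one_le F.le F.dir_mem_gapNhd
  obtain ⟨hA, -, -, hD⟩ := monodromy_collapsed F.mem F.two_le F.one_le F.le F.gap_eq
  have he := collapsedSign_mul_self N n
  have hr := F.edgeRatio_eq_one
  rw [edgeRatio, div_eq_one_iff_eq (pow_pos hκ 2).ne'] at hr
  simp only [discr, eval_add, hA, hD] at hr
  rw [← collapsedSign] at hr
  have h' : (2 * weight p n (dir p n)) ^ 2 = wron p g h ^ 2 := by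
    linear_combination hr - 2 * weight p n (dir p n) ^ 2 * he
  have := (pow_left_inj₀ (by positivity) hκ.le two_ne_zero).1 h'
  linarith

/-- The gap edges are to first order the zeros of the determinant of the linearized forms. -/
lemma edges_expansion (F : CollapsedFrame p n g h) :
    (fun z : Phase N × ℝ => (z.2 - lam z.1 (2 * n)) * (z.2 - lam z.1 (2 * n + 1))
        - (((z.2 - dir p n) * 1 - pairing g g (z.1 - p)) *
            ((z.2 - dir p n) * 1 - pairing h h (z.1 - p)) - pairing g h (z.1 - p) ^ 2))
      =o[𝓝 (p, dir p n)] fun z => ‖z - (p, dir p n)‖ * ‖z - (p, dir p n)‖ := by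
  have hV : (fun z => edgeRatio p n g h z - 1) =o[𝓝 (p, dir p n)] fun _ => (1 : ℝ) := by
    rw [isLittleO_one_iff, ← F.edgeRatio_eq_one]
    exact tendsto_sub_nhds_zero_iff.2 F.edgeRatio_continuousAt.tendsto
  have h1 := hV.mul_isBigO F.det_form_isBigO
  simp only [one_mul] at h1
  refine (h1.add F.det_form_expansion).congr' ?_ EventuallyEq.rfl
  filter_upwards [F.edges_mul] with z hz
  rw [hz]
  ring

/-- `edges_expansion` at the two points at distance `‖q - p‖` from the collapsed gap.  The
quadratic in `x` on either side is determined by its values there, up to errors of second order.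
-/
lemma edges_shift (F : CollapsedFrame p n g h) {c : ℝ} (hc : |c| = 1) :
    (fun q : Phase N => (dir p n + c * ‖q - p‖ - lam q (2 * n)) *
          (dir p n + c * ‖q - p‖ - lam q (2 * n + 1))
        - ((c * ‖q - p‖ - pairing g g (q - p)) * (c * ‖q - p‖ - pairing h h (q - p))
            - pairing g h (q - p) ^ 2))
      =o[𝓝 p] fun q => ‖q - p‖ * ‖q - p‖ := by
  have h1 := F.edges_expansion.comp_tendsto (tendsto_shift p (dir p n) c)
  have hnorm : ∀ q : Phase N, ‖((q, dir p n + c * ‖q - p‖) : Phase N × ℝ) - (p, dir p n)‖ =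
      ‖q - p‖ := fun q => by
    rw [Prod.norm_def, Prod.fst_sub, Prod.snd_sub, add_sub_cancel_left, norm_mul, norm_norm,
      Real.norm_eq_abs, hc, one_mul, max_self]
  simpa only [Function.comp_def, hnorm, add_sub_cancel_left, mul_one] using h1

/-- The sum of the gap edges to first order, from the difference of `edges_shift` for `c = 1` and
`c = -1`. -/
lemma edges_add (F : CollapsedFrame p n g h) :
    (fun q : Phase N => (lam q (2 * n) - dir p n) + (lam q (2 * n + 1) - dir p n)
        - (pairing g g (q - p) + pairing h h (q - p))) =o[𝓝 p] fun q => ‖q - p‖ := by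
  have h1 := (F.edges_shift (c := 1) (by simp)).sub (F.edges_shift (c := -1) (by simp))
  have h2 : (fun q : Phase N => ‖q - p‖ * ((lam q (2 * n) - dir p n) +
      (lam q (2 * n + 1) - dir p n) - (pairing g g (q - p) + pairing h h (q - p))))
      =o[𝓝 p] fun q => ‖q - p‖ * ‖q - p‖ :=
    (h1.const_mul_left (-1 / 2)).congr_left fun q => by ring
  rw [isLittleO_iff] at h2 ⊢
  intro c hc
  filter_upwards [h2 hc] with q hq
  rcases (norm_nonneg (q - p)).eq_or_lt with h0 | h0
  · have : q = p := sub_eq_zero.1 (norm_eq_zero.1 h0.symm)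
    subst this
    simp [F.lam_eq, pairing]
  · rw [norm_mul, norm_mul, norm_norm] at hq
    rw [norm_norm]
    exact le_of_mul_le_mul_left (by linarith) h0

/-- From the sum of `edges_shift` for `c = 1` and `c = -1`. -/
lemma edges_prod (F : CollapsedFrame p n g h) :
    (fun q : Phase N => (lam q (2 * n) - dir p n) * (lam q (2 * n + 1) - dir p n))
      =O[𝓝 p] fun q => ‖q - p‖ * ‖q - p‖ := by
  have hpair := fun v w => (pairing_sub_isBigO v w p).norm_right
  have h1 := ((F.edges_shift (c := 1) (by simp)).add (F.edges_shift (c := -1) (by simp))).isBigO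
  have h2 := ((hpair g g).mul (hpair h h)).sub ((hpair g h).mul (hpair g h))
  exact ((h1.const_mul_left (1 / 2)).add h2).congr_left fun q => by ring

/-- The gap opens at most linearly, as `γ_n² = (X + Y)² - 4 X Y` for the displacements `X`, `Y` of
the edges.  The edges themselves need not be differentiable. -/
lemma gap_isBigO (F : CollapsedFrame p n g h) :
    (fun q : Phase N => gap q n) =O[𝓝 p] fun q => ‖q - p‖ := by
  have hpair := fun v w => (pairing_sub_isBigO v w p).norm_right
  have h1 : (fun q : Phase N => (lam q (2 * n) - dir p n) + (lam q (2 * n + 1) - dir p n))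
      =O[𝓝 p] fun q => ‖q - p‖ :=
    (F.edges_add.isBigO.add ((hpair g g).add (hpair h h))).congr_left fun q => by ring
  have h2 := (h1.mul h1).sub (F.edges_prod.const_mul_left 4)
  refine (IsBigO.of_pow (n := 2) two_ne_zero (h2.congr (fun q => ?_) fun q => ?_))
  · simp only [Pi.pow_apply, gap]; ring
  · simp only [Pi.pow_apply]; ring

lemma tendsto_lam (F : CollapsedFrame p n g h) :
    Tendsto (fun q : Phase N => lam q (2 * n)) (𝓝 p) (𝓝 (dir p n)) ∧
      Tendsto (fun q : Phase N => lam q (2 * n + 1)) (𝓝 p) (𝓝 (dir p n)) := by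
  have h1 := F.one_le
  have h2 := F.le
  have hN := F.two_le
  constructor
  · exact ((continuous_lam hN (by omega) (by omega)).tendsto' p _ F.lam_eq.1)
  · exact ((continuous_lam hN (by omega) (by omega)).tendsto' p _ F.lam_eq.2)

lemma eventually_mem (F : CollapsedFrame p n g h) : ∀ᶠ q in 𝓝 p, q ∈ phaseSpace N :=
  (isOpen_phaseSpace N).mem_nhds F.mem

lemma tendsto_dir (F : CollapsedFrame p n g h) :
    Tendsto (fun q : Phase N => ((q, dir q n) : Phase N × ℝ)) (𝓝 p) (𝓝 (p, dir p n)) := by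
  refine tendsto_id.prodMk_nhds ?_
  refine tendsto_of_tendsto_of_tendsto_of_le_of_le' F.tendsto_lam.1 F.tendsto_lam.2 ?_ ?_ <;>
  filter_upwards [F.eventually_mem] with q hq
  · exact (dir_mem_gap hq F.two_le F.one_le F.le).1
  · exact (dir_mem_gap hq F.two_le F.one_le F.le).2

lemma y₁_dir (F : CollapsedFrame p n g h) {q : Phase N} (hq : q ∈ phaseSpace N) :
    (y₁ q (N + 1)).eval (dir q n) = 0 := by
  have := F.le
  have := F.one_le
  have h := (monodromy_at_dir hq F.two_le (j := n - 1) (by omega)).1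
  rwa [Nat.sub_add_cancel F.one_le] at h

/-- Where `y₁ (N + 1)` vanishes, so does the form at `(g, g)`. -/
lemma dir_expansion_aux (F : CollapsedFrame p n g h) :
    (fun q : Phase N => (dir q n - dir p n) - pairing g g (q - p)) =o[𝓝 p] (fun q => q - p) ∧
      (fun q : Phase N => ‖((q, dir q n) : Phase N × ℝ) - (p, dir p n)‖) =O[𝓝 p]
        fun q => q - p := by
  refine isLittleO_of_self ?_ ?_ (pairing_sub_isBigO g g p)
  · have h1 := F.expansion_gg.comp_tendsto F.tendsto_dir
    refine h1.neg_left.congr' ?_ EventuallyEq.rfl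
    filter_upwards [F.eventually_mem] with q hq
    have hC := F.y₁_dir hq
    simp only [Function.comp_def, monodromyForm, solPoly_linear, eval_add, eval_mul, eval_C,
      F.dirichlet.at_one, hC]
    ring
  · intro q
    rw [abs_norm]
    exact max_le ((le_add_iff_nonneg_right _).2 (abs_nonneg _))
      ((le_add_iff_nonneg_left _).2 (norm_nonneg _))

/-- The Dirichlet eigenvalue to first order. -/
lemma dir_expansion (F : CollapsedFrame p n g h) :
    (fun q : Phase N => (dir q n - dir p n) - pairing g g (q - p)) =o[𝓝 p] fun q => q - p :=
  F.dir_expansion_aux.1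

/-- The starred root to first order: at a Dirichlet eigenvalue it is up to a constant the sum of the
forms at `(g, h)` and `(h, g)`. -/
lemma starRoot_expansion (F : CollapsedFrame p n g h) :
    (fun q : Phase N => wron p g h * collapsedSign N n * starRoot q n - 2 * pairing g h (q - p))
      =o[𝓝 p] fun q => q - p := by
  have h1 := (F.expansion_gh.add F.expansion_hg).comp_tendsto F.tendsto_dir
  refine (h1.trans_isBigO F.dir_expansion_aux.2).neg_left.congr' ?_ EventuallyEq.rfl
  filter_upwards [F.eventually_mem] with q hq
  have hC := F.y₁_dir hq
  simp only [Function.comp_def, monodromyForm, solPoly_linear, eval_add, eval_mul, eval_C,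
    F.dirichlet.at_one, hC, starRoot, wron]
  rw [pairing_comm h g]
  ring

lemma starRoot_weight_expansion (F : CollapsedFrame p n g h) :
    (fun q : Phase N => starRoot q n * weight q n (dir q n)
        - collapsedSign N n * pairing g h (q - p)) =o[𝓝 p] fun q => ‖q - p‖ := by
  have hκ := F.wron_pos
  have he := collapsedSign_mul_self N n
  have hpair := (pairing_sub_isBigO g h p).norm_right
  have h1 : (fun q : Phase N => starRoot q n
      - 2 * collapsedSign N n / wron p g h * pairing g h (q - p)) =o[𝓝 p] fun q => ‖q - p‖ := by
    refine (F.starRoot_expansion.norm_right.const_mul_left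
      (collapsedSign N n / wron p g h)).congr_left fun q => ?_
    field_simp
    linear_combination wron p g h * starRoot q n * he
  have hw : (fun q : Phase N => weight q n (dir q n) - wron p g h / 2) =o[𝓝 p]
      fun _ => (1 : ℝ) := by
    have hc := (weight_continuousAt F.two_le F.one_le F.le F.dir_mem_gapNhd).tendsto
    simp only [F.weight_eq] at hc
    have hw0 := tendsto_sub_nhds_zero_iff.2 (hc.comp F.tendsto_dir)
    exact (isLittleO_one_iff ℝ).2 hw0
  have h2 : (fun q : Phase N => starRoot q n) =O[𝓝 p] fun q => ‖q - p‖ :=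
    (h1.isBigO.add (hpair.const_mul_left (2 * collapsedSign N n / wron p g h))).congr_left
      fun q => by ring
  have h3 := h2.mul_isLittleO hw
  simp only [mul_one] at h3
  refine (h3.add (h1.const_mul_left (wron p g h / 2))).congr_left fun q => ?_
  field_simp
  ring

/-- The gap density tends to its value at the collapsed gap, uniformly on the shrinking gaps. -/
lemma gapDensity_near (F : CollapsedFrame p n g h) {e : ℝ} (he : 0 < e) :
    ∀ᶠ q in 𝓝 p, ∀ x ∈ Set.Icc (lam q (2 * n)) (lam q (2 * n + 1)),
      |gapDensity q n x - -collapsedSign N n| ≤ e := by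
  have hc := (gapDensity_continuousAt F.mem F.two_le F.one_le F.le F.dir_mem_gapNhd).tendsto
  have hval := gapDensity_collapsed F.mem F.two_le F.one_le F.le F.gap_eq
  rw [F.lam_eq.1] at hval
  simp only [hval] at hc
  have hs : -collapsedSign N n = (-1) ^ (N - 1 - n) := neg_neg _
  rw [hs]
  have hev := hc.eventually (Metric.ball_mem_nhds _ he)
  obtain ⟨U, hU, V, hV, hUV⟩ := mem_nhds_prod_iff.1 hev
  obtain ⟨d, hd, hball⟩ := Metric.mem_nhds_iff.1 hV
  filter_upwards [hU, F.tendsto_lam.1.eventually (lt_mem_nhds (sub_lt_self _ hd)),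
    F.tendsto_lam.2.eventually (gt_mem_nhds (lt_add_of_pos_right _ hd))] with q hq h1 h2 x hx
  have hxV : x ∈ V := hball (by
    rw [Metric.mem_ball, Real.dist_eq, abs_lt]
    constructor <;> linarith [hx.1, hx.2])
  have := hUV (Set.mk_mem_prod hq hxV)
  exact (Metric.mem_ball.1 this).le

/-- `z_n^+` to first order at a collapsed gap: the real part is `2 (τ_n - μ_n)`, the imaginary part
comes from the starred root. -/
lemma zPlus_expansion (F : CollapsedFrame p n g h) :
    (fun q : Phase N => zPlus n q - (((pairing h h (q - p) - pairing g g (q - p) : ℝ) : ℂ)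
        - ((2 * pairing g h (q - p) : ℝ) : ℂ) * Complex.I)) =o[𝓝 p] fun q => q - p := by
  have he := collapsedSign_mul_self N n
  have happrox : (fun q : Phase N => zPlus n q - (((2 * (mid q n - dir q n) : ℝ) : ℂ) +
      ((2 * -collapsedSign N n * (starRoot q n * weight q n (dir q n)) : ℝ) : ℂ) * Complex.I))
      =o[𝓝 p] fun q => q - p := by
    have hgap : (fun q : Phase N => gap q n) =O[𝓝 p] fun q => q - p := F.gap_isBigO.of_norm_right
    refine IsLittleO.trans_isBigO ?_ hgap
    rw [isLittleO_iff]
    intro c hc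
    filter_upwards [F.eventually_mem, F.gapDensity_near (div_pos hc Real.pi_pos)] with q hq hd
    have h := zPlus_approx hq F.two_le F.one_le F.le (s := -collapsedSign N n)
      (by linear_combination he) hd
    rw [div_mul_cancel₀ _ Real.pi_ne_zero] at h
    rw [Real.norm_of_nonneg (gap_nonneg q F.two_le F.one_le F.le)]
    linarith
  have hre : (fun q : Phase N => 2 * (mid q n - dir q n)
      - (pairing h h (q - p) - pairing g g (q - p))) =o[𝓝 p] fun q => q - p :=
    (F.edges_add.of_norm_right.sub (F.dir_expansion.const_mul_left 2)).congr_left fun q => by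
      unfold mid; ring
  have him : (fun q : Phase N => 2 * -collapsedSign N n * (starRoot q n * weight q n (dir q n))
      + 2 * pairing g h (q - p)) =o[𝓝 p] fun q => q - p :=
    (F.starRoot_weight_expansion.of_norm_right.const_mul_left (-2 * collapsedSign N n)).congr_left
      fun q => by linear_combination 2 * pairing g h (q - p) * he
  have hre' : (fun q : Phase N => ((2 * (mid q n - dir q n)
      - (pairing h h (q - p) - pairing g g (q - p)) : ℝ) : ℂ)) =o[𝓝 p] fun q => q - p :=
    (hre.norm_left.congr_left fun q => (Complex.norm_real _).symm).of_norm_left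
  have him' : (fun q : Phase N => ((2 * -collapsedSign N n *
      (starRoot q n * weight q n (dir q n)) + 2 * pairing g h (q - p) : ℝ) : ℂ) * Complex.I)
      =o[𝓝 p] fun q => q - p :=
    (him.norm_left.congr_left fun q => by
      rw [norm_mul, Complex.norm_real, Complex.norm_I, mul_one]).of_norm_left
  refine (happrox.add (hre'.add him')).congr_left fun q => ?_
  push_cast
  ring

end CollapsedFrame

end Frame

end Toda

theorem mainTheorem4 (N : ℕ) [NeZero N] (n : ℕ) (hn1 : 1 ≤ n) (hn2 : n ≤ N - 1)
    (p : Toda.Phase N) (hp : p ∈ Toda.collapsedSet N n)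
    (g h : ℕ → ℝ) (hg : Toda.IsDirichletVector p n g) (hh : Toda.IsConjugateVector p n g h) :
    Toda.HasGradientBA (Toda.zPlus n)
      (Toda.symProd N (fun j => (h j : ℂ) - Complex.I * (g j : ℂ))
        (fun j => (h j : ℂ) - Complex.I * (g j : ℂ))) p := by
  have F : Toda.CollapsedFrame p n g h := ⟨hp.1, hn1, hn2, hp.2, hg, hh⟩
  have hz : Toda.zPlus n p = 0 := by simp [Toda.zPlus, hp.2]
  refine HasFDerivAt.of_isLittleO (F.zPlus_expansion.congr_left fun q => ?_)
  rw [hz, sub_zero]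
  -- `(h - i g) ·_s (h - i g) = h ·_s h - g ·_s g - 2 i h ·_s g`, paired with `q - p`.
  congr 1
  simp only [_root_.sum_apply, _root_.add_apply,
    ContinuousLinearMap.smulRight_apply, ContinuousLinearMap.comp_apply,
    ContinuousLinearMap.proj_apply, ContinuousLinearMap.coe_fst', ContinuousLinearMap.coe_snd',
    Toda.pairing, Toda.symProd, Complex.real_smul]
  push_cast
  rw [Finset.mul_sum, Finset.sum_mul, ← Finset.sum_sub_distrib, ← Finset.sum_sub_distrib]
  refine Finset.sum_congr rfl fun j _ => ?_
  ring_nf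
  rw [Complex.I_sq]
  ring
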